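/- Let $\pi$ be a finitely generated torsion-free nilpotent group of class $c$, with lower central series $\pi=\pi_1\supset\pi_2\supset\cdots\supset\pi_{c+1}=1$, $\pi_{j+1}=[\pi,\pi_j]$, and isolators $\sqrt{\pi_j}=\{x\in\pi : x^k\in\pi_j \text{ for some } k\ge 1\}$; let $\phi:\pi\to\pi$ be an endomorphism. Let $G$ be the real Mal'cev completion of $\pi$ and $\mathfrak G$ its Lie algebra, that is, the group of group-like elements and the Lie algebra of primitive elements of the completed group algebra $\varprojlim_n \mathbb R[\pi]/I^n$ ($I$ the augmentation ideal), with $\exp:\mathfrak G\to G$ given by the exponential series and with the canonical homomorphism $\pi\to G$. Let $D:G\to G$ be the extension of $\phi$ induced by functoriality and $D_*:\mathfrak G\to\mathfrak G$ its differential (so $D(\exp X)=\exp(D_*X)$), called the linearization of $\phi$. Then there are integers $k_j\ge 0$, isomorphisms $\sqrt{\pi_j}/\sqrt{\pi_{j+1}}\cong\mathbb Z^{k_j}$ and elements $a_{j1},\dots,a_{jk_j}\in\sqrt{\pi_j}$ mapping to the standard basis of $\mathbb Z^{k_j}$ ($1\le j\le c$), such that the elements $\log a_{ji}$ form a basis of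 $\mathfrak G$ with respect to which $D_*$ is a lower triangular block matrix whose diagonal blocks $D_1,\dots,D_c$ are the integer matrices representing the endomorphisms of $\sqrt{\pi_j}/\sqrt{\pi_{j+1}}\cong\mathbb Z^{k_j}$ induced by $\phi$. Moreover, for every finite generating set $S$ of $\pi$, with $L(\gamma,S)$ the word length, the growth rate $$\mathrm{GR}(\phi)=\sup_{\gamma\in\pi}\ \limsup_{m\to\infty} L(\phi^m(\gamma),S)^{1/m}$$ is finite and satisfies $$\mathrm{GR}(\phi)=\max_{1\le j\le c}\ \mathrm{sp}(D_j)^{1/j},$$ where $\mathrm{sp}(D_j)$ is the maximum of the absolute values of the complex eigenvalues of $D_j$ (and the maximum over the empty set is $0$). In particular, $\mathrm{GR}(\phi)$ is an algebraic integer. -/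

import Mathlib

open scoped ENNReal commutatorElement Matrix

namespace MalcevGrowth

/-! ### Isolators -/

theorem sup_lcs_le {G : Type*} [Group G] (x : G) (i : ℕ) :
    (Subgroup.zpowers x ⊔ commutator G).lowerCentralSeries (i + 1) ≤
      (⊤ : Subgroup G).lowerCentralSeries (i + 2) := by
  induction i with
  | zero =>
    rw [Subgroup.lowerCentralSeries_succ, Subgroup.lowerCentralSeries_zero, Subgroup.commutator_le]
    set K := (⊤ : Subgroup G).lowerCentralSeries (0 + 2) with hK
    have hc : ∀ b ∈ commutator G, ∀ g : G,
        Commute (QuotientGroup.mk' K b) (QuotientGroup.mk' K g) := by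
      intro b hb g
      rw [← commutatorElement_eq_one_iff_commute, ← map_commutatorElement,
        ← MonoidHom.mem_ker, QuotientGroup.ker_mk']
      exact Subgroup.commutator_mem_commutator hb (Subgroup.mem_top g)
    intro a ha b hb
    obtain ⟨a₁, ha₁, a₂, ha₂, rfl⟩ := Subgroup.mem_sup_of_normal_right.1 ha
    obtain ⟨b₁, hb₁, b₂, hb₂, rfl⟩ := Subgroup.mem_sup_of_normal_right.1 hb
    rw [← QuotientGroup.ker_mk' K, MonoidHom.mem_ker, map_commutatorElement,
      commutatorElement_eq_one_iff_commute, map_mul]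
    refine Commute.mul_left ?_ (hc _ ha₂ _)
    rw [map_mul]
    refine Commute.mul_right ?_ (hc _ hb₂ _).symm
    obtain ⟨m, rfl⟩ := Subgroup.mem_zpowers_iff.1 ha₁
    obtain ⟨n, rfl⟩ := Subgroup.mem_zpowers_iff.1 hb₁
    exact (Commute.zpow_zpow_self x m n).map _
  | succ i ih =>
    rw [Subgroup.lowerCentralSeries_succ]
    exact Subgroup.commutator_mono ih le_top

theorem isOfFinOrder_mul_of_lcs (c : ℕ) : ∀ (G : Type*) [Group G],
    (⊤ : Subgroup G).lowerCentralSeries c = ⊥ →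
    ∀ x y : G, IsOfFinOrder x → IsOfFinOrder y → IsOfFinOrder (x * y) := by
  induction c with
  | zero =>
    intro G _ h x y _ _
    have hx : x * y ∈ (⊤ : Subgroup G) := Subgroup.mem_top _
    rw [← Subgroup.lowerCentralSeries_zero (⊤ : Subgroup G), h, Subgroup.mem_bot] at hx
    rw [hx]
    exact IsOfFinOrder.one
  | succ c ih =>
    intro G _ h x y hx hy
    rcases Nat.eq_zero_or_pos c with rfl | hc
    · have hxy : Commute x y := by
        rw [← commutatorElement_eq_one_iff_commute, ← Subgroup.mem_bot, ← h]
        exact Subgroup.commutator_mem_commutator (Subgroup.mem_top x) (Subgroup.mem_top y)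
      exact hxy.isOfFinOrder_mul hx hy
    · obtain ⟨i, rfl⟩ : ∃ i, c = i + 1 := ⟨c - 1, by omega⟩
      set N := Subgroup.zpowers x ⊔ commutator G with hN
      have hxN : x ∈ N := Subgroup.mem_sup_left (Subgroup.mem_zpowers x)
      have hNbot : (⊤ : Subgroup N).lowerCentralSeries (i + 1) = ⊥ := by
        have h1 := Subgroup.top_subtype_lowerCentralSeries N (i + 1)
        have h2 := sup_lcs_le x i
        rw [h, ← hN, ← h1, le_bot_iff, Subgroup.map_eq_bot_iff_of_injective _
          N.subtype_injective] at h2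
        exact h2
      have hconj : ∀ k : ℕ, y ^ k * x * (y ^ k)⁻¹ ∈ N := by
        intro k
        have : y ^ k * x * (y ^ k)⁻¹ = ⁅y ^ k, x⁆ * x := by
          simp [commutatorElement_def]
        rw [this]
        exact N.mul_mem (Subgroup.mem_sup_right (Subgroup.commutator_mem_commutator
          (Subgroup.mem_top _) (Subgroup.mem_top _))) hxN
      have key : ∀ n : ℕ, ∃ z ∈ N, IsOfFinOrder z ∧ (x * y) ^ n = z * y ^ n := by
        intro n
        induction n with
        | zero => exact ⟨1, N.one_mem, IsOfFinOrder.one, by simp⟩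
        | succ n ihn =>
          obtain ⟨z, hz, hzf, hzn⟩ := ihn
          refine ⟨z * (y ^ n * x * (y ^ n)⁻¹), N.mul_mem hz (hconj n), ?_, ?_⟩
          · have h3 : IsOfFinOrder (y ^ n * x * (y ^ n)⁻¹) := by
              have := (MulAut.conj (y ^ n)).toMonoidHom.isOfFinOrder hx
              rwa [MulEquiv.coe_toMonoidHom, MulAut.conj_apply] at this
            have h4 := ih N hNbot ⟨z, hz⟩ ⟨_, hconj n⟩
              (Submonoid.isOfFinOrder_coe.1 hzf)
              (Submonoid.isOfFinOrder_coe.1 h3)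
            exact Submonoid.isOfFinOrder_coe.2 h4
          · rw [pow_succ, hzn]
            group
      obtain ⟨n, hn, hyn⟩ := isOfFinOrder_iff_pow_eq_one.1 hy
      obtain ⟨z, -, hzf, hz⟩ := key n
      rw [hyn, mul_one] at hz
      rw [← hz] at hzf
      exact hzf.of_pow hn.ne'

theorem isOfFinOrder_mul {G : Type*} [Group G] [Group.IsNilpotent G] {x y : G}
    (hx : IsOfFinOrder x) (hy : IsOfFinOrder y) : IsOfFinOrder (x * y) :=
  isOfFinOrder_mul_of_lcs _ G Subgroup.lowerCentralSeries_nilpotencyClass x y hx hy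

theorem isOfFinOrder_mk_iff {π : Type*} [Group π] (H : Subgroup π) [H.Normal] (x : π) :
    IsOfFinOrder (x : π ⧸ H) ↔ ∃ k : ℕ, 1 ≤ k ∧ x ^ k ∈ H := by
  rw [isOfFinOrder_iff_pow_eq_one]
  refine exists_congr fun k => and_congr Iff.rfl ?_
  rw [← QuotientGroup.mk_pow, QuotientGroup.eq_one_iff]

/-- The isolator `√H = {x | x ^ k ∈ H for some k ≥ 1}` of a normal subgroup `H` of a nilpotent
group. -/
def isolator {π : Type*} [Group π] [Group.IsNilpotent π] (H : Subgroup π) [H.Normal] :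
    Subgroup π where
  carrier := {x | ∃ k : ℕ, 1 ≤ k ∧ x ^ k ∈ H}
  one_mem' := ⟨1, le_rfl, by simp [H.one_mem]⟩
  mul_mem' {x y} hx hy := by
    simp only [Set.mem_ofPred_eq, ← isOfFinOrder_mk_iff] at hx hy ⊢
    exact isOfFinOrder_mul hx hy
  inv_mem' {x} := by
    rintro ⟨k, hk, h⟩
    exact ⟨k, hk, by rw [inv_pow]; exact H.inv_mem h⟩

theorem mem_isolator {π : Type*} [Group π] [Group.IsNilpotent π] {H : Subgroup π} [H.Normal]
    {x : π} : x ∈ isolator H ↔ ∃ k : ℕ, 1 ≤ k ∧ x ^ k ∈ H := Iff.rfl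

instance isolator_normal {π : Type*} [Group π] [Group.IsNilpotent π] (H : Subgroup π)
    [hH : H.Normal] : (isolator H).Normal where
  conj_mem := by
    rintro x ⟨k, hk, h⟩ g
    exact ⟨k, hk, by rw [conj_pow]; exact hH.conj_mem _ h g⟩

/-- The terms of the adapted central series, indexed from `0`: `adaptedSeries π j` is the isolator
of the `(j + 1)`-st term of the lower central series `π = π₁ ⊇ π₂ = [π, π] ⊇ ⋯`
(Mathlib's `lowerCentralSeries` is indexed from `0`). -/
def adaptedSeries (π : Type*) [Group π] [Group.IsNilpotent π] (j : ℕ) : Subgroup π :=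
  isolator ((⊤ : Subgroup π).lowerCentralSeries j)

instance adaptedSeries_normal (π : Type*) [Group π] [Group.IsNilpotent π] (j : ℕ) :
    (adaptedSeries π j).Normal :=
  isolator_normal _

theorem map_mem_adaptedSeries {π : Type*} [Group π] [Group.IsNilpotent π] (φ : π →* π) (j : ℕ)
    {x : π} (hx : x ∈ adaptedSeries π j) : φ x ∈ adaptedSeries π j := by
  obtain ⟨k, hk, h⟩ := hx
  refine ⟨k, hk, ?_⟩
  rw [← map_pow]
  have := Subgroup.mem_map_of_mem φ h
  rw [Subgroup.map_lowerCentralSeries] at this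
  exact Subgroup.lowerCentralSeries_mono _ le_top this

/-- The successive quotients of the adapted central series. -/
abbrev AdaptedQuotient (π : Type*) [Group π] [Group.IsNilpotent π] (j : ℕ) : Type _ :=
  adaptedSeries π j ⧸ (adaptedSeries π (j + 1)).subgroupOf (adaptedSeries π j)

/-- The restriction of an endomorphism of `π` to a term of the adapted central series. -/
def adaptedRestrict {π : Type*} [Group π] [Group.IsNilpotent π] (φ : π →* π) (j : ℕ) :
    adaptedSeries π j →* adaptedSeries π j :=
  (φ.comp (adaptedSeries π j).subtype).codRestrict _ fun x => map_mem_adaptedSeries φ j x.2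

/-- The endomorphism of the `j`-th successive quotient of the adapted central series induced by
an endomorphism of `π`. -/
def adaptedQuotientMap {π : Type*} [Group π] [Group.IsNilpotent π] (φ : π →* π) (j : ℕ) :
    AdaptedQuotient π j →* AdaptedQuotient π j :=
  QuotientGroup.map _ _ (adaptedRestrict φ j) fun _ hx => map_mem_adaptedSeries φ (j + 1) hx

/-! ### The completed group algebra -/

noncomputable section

/-- The augmentation `ℝ[π] → ℝ`, sending every group element to `1`. -/
def augmentation (π : Type*) [Group π] : MonoidAlgebra ℝ π →ₐ[ℝ] ℝ :=
  MonoidAlgebra.lift ℝ ℝ π 1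

/-- The augmentation ideal of `ℝ[π]`. -/
def augIdeal (π : Type*) [Group π] : Ideal (MonoidAlgebra ℝ π) :=
  RingHom.ker (augmentation π)

instance augIdeal_isTwoSided (π : Type*) [Group π] : (augIdeal π).IsTwoSided :=
  inferInstanceAs (RingHom.ker (augmentation π)).IsTwoSided

/-- The quotient `ℝ[π] / Iⁿ` of the group algebra by a power of its augmentation ideal. -/
abbrev TruncatedAlgebra (π : Type*) [Group π] (n : ℕ) : Type _ :=
  MonoidAlgebra ℝ π ⧸ (augIdeal π) ^ n

/-- The completed group algebra `lim ℝ[π] / Iⁿ`, as the algebra of compatible families. -/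
def completedAlgebra (π : Type*) [Group π] : Subalgebra ℝ (∀ n, TruncatedAlgebra π n) where
  carrier := {x | ∀ m n : ℕ, ∀ h : m ≤ n,
    Ideal.Quotient.factorₐ ℝ (Ideal.pow_le_pow_right h) (x n) = x m}
  mul_mem' {x y} hx hy m n h := by
    rw [Pi.mul_apply, map_mul, hx m n h, hy m n h, Pi.mul_apply]
  add_mem' {x y} hx hy m n h := by
    rw [Pi.add_apply, map_add, hx m n h, hy m n h, Pi.add_apply]
  algebraMap_mem' r m n h := by
    rw [Pi.algebraMap_apply, AlgHom.commutes, Pi.algebraMap_apply]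

theorem augmentation_mapDomain {G H : Type*} [Group G] [Group H] (f : G →* H)
    (x : MonoidAlgebra ℝ G) :
    augmentation H (MonoidAlgebra.mapDomainAlgHom ℝ ℝ f x) = augmentation G x := by
  have : (augmentation H).comp (MonoidAlgebra.mapDomainAlgHom ℝ ℝ f) = augmentation G := by
    ext g
    simp [augmentation]
  exact DFunLike.congr_fun this x

theorem augIdeal_pow_le_comap {G H : Type*} [Group G] [Group H] (f : G →* H) (n : ℕ) :
    augIdeal G ^ n ≤ Ideal.comap (MonoidAlgebra.mapDomainAlgHom ℝ ℝ f) (augIdeal H ^ n) := by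
  have h1 : augIdeal G ≤ Ideal.comap (MonoidAlgebra.mapDomainAlgHom ℝ ℝ f) (augIdeal H) := by
    intro x hx
    change augmentation H (MonoidAlgebra.mapDomainAlgHom ℝ ℝ f x) = 0
    rw [augmentation_mapDomain]
    exact hx
  induction n with
  | zero =>
    intro x _
    simp [Submodule.pow_zero]
  | succ n ih =>
    rw [Ideal.IsTwoSided.pow_succ, Ideal.mul_le]
    intro r hr s hs
    rw [Ideal.mem_comap, map_mul, Ideal.IsTwoSided.pow_succ]
    exact Ideal.mul_mem_mul (h1 hr) (ih hs)

/-- The map `ℝ[G] / Iⁿ → ℝ[H] / Iⁿ` induced by a group homomorphism. -/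
def truncatedMap {G H : Type*} [Group G] [Group H] (f : G →* H) (n : ℕ) :
    TruncatedAlgebra G n →ₐ[ℝ] TruncatedAlgebra H n :=
  Ideal.Quotient.liftₐ _ ((Ideal.Quotient.mkₐ ℝ (augIdeal H ^ n)).comp
    (MonoidAlgebra.mapDomainAlgHom ℝ ℝ f)) fun _ ha =>
      Ideal.Quotient.eq_zero_iff_mem.2 (augIdeal_pow_le_comap f n ha)

theorem truncatedMap_mk {G H : Type*} [Group G] [Group H] (f : G →* H) (n : ℕ)
    (x : MonoidAlgebra ℝ G) :
    truncatedMap f n (Ideal.Quotient.mkₐ ℝ _ x) =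
      Ideal.Quotient.mkₐ ℝ _ (MonoidAlgebra.mapDomainAlgHom ℝ ℝ f x) := rfl

/-- The map of completed group algebras induced by a group homomorphism. -/
def completedMap {G H : Type*} [Group G] [Group H] (f : G →* H) :
    completedAlgebra G →ₐ[ℝ] completedAlgebra H :=
  AlgHom.codRestrict
    (AlgHom.pi fun n => (truncatedMap f n).comp
      ((Pi.evalAlgHom ℝ _ n).comp (completedAlgebra G).val))
    (completedAlgebra H) fun x m n h => by
      change Ideal.Quotient.factorₐ ℝ _ (truncatedMap f n (x.1 n)) = truncatedMap f m (x.1 m)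
      rw [← x.2 m n h]
      obtain ⟨y, hy⟩ := Ideal.Quotient.mkₐ_surjective ℝ _ (x.1 n)
      rw [← hy]
      rfl

theorem completedMap_apply {G H : Type*} [Group G] [Group H] (f : G →* H)
    (x : completedAlgebra G) (n : ℕ) : (completedMap f x).1 n = truncatedMap f n (x.1 n) := rfl

theorem completedMap_comp {G H K : Type*} [Group G] [Group H] [Group K] (f : H →* K) (g : G →* H)
    (x : completedAlgebra G) : completedMap f (completedMap g x) = completedMap (f.comp g) x := by
  refine Subtype.ext (funext fun n => ?_)
  rw [completedMap_apply, completedMap_apply, completedMap_apply]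
  obtain ⟨y, hy⟩ := Ideal.Quotient.mkₐ_surjective ℝ _ (x.1 n)
  rw [← hy, truncatedMap_mk, truncatedMap_mk, truncatedMap_mk, MonoidAlgebra.mapDomainAlgHom_comp]
  rfl

/-- The canonical map from `π` to its completed group algebra. -/
def toCompleted (π : Type*) [Group π] : π →* completedAlgebra π where
  toFun g := ⟨fun n => Ideal.Quotient.mkₐ ℝ _ (MonoidAlgebra.of ℝ π g), fun _ _ _ => rfl⟩
  map_one' := by
    refine Subtype.ext (funext fun n => ?_)
    rw [map_one]
    exact map_one (Ideal.Quotient.mkₐ ℝ (augIdeal π ^ n))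
  map_mul' a b := by
    refine Subtype.ext (funext fun n => ?_)
    simp only [map_mul]
    rfl

theorem completedMap_toCompleted {G H : Type*} [Group G] [Group H] (f : G →* H) (g : G) :
    completedMap f (toCompleted G g) = toCompleted H (f g) := by
  refine Subtype.ext (funext fun n => ?_)
  change truncatedMap f n (Ideal.Quotient.mkₐ ℝ _ (MonoidAlgebra.of ℝ G g)) =
    Ideal.Quotient.mkₐ ℝ _ (MonoidAlgebra.of ℝ H (f g))
  rw [truncatedMap_mk]
  simp

/-- The diagonal homomorphism `π → π × π`. -/
abbrev diag (π : Type*) [Group π] : π →* π × π := (MonoidHom.id π).prod (MonoidHom.id π)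

theorem commute_inl_inr {π : Type*} [Group π] (x y : completedAlgebra π) :
    Commute (completedMap (MonoidHom.inl π π) x) (completedMap (MonoidHom.inr π π) y) := by
  refine Subtype.ext (funext fun n => ?_)
  change truncatedMap (MonoidHom.inl π π) n (x.1 n) * truncatedMap (MonoidHom.inr π π) n (y.1 n) =
    truncatedMap (MonoidHom.inr π π) n (y.1 n) * truncatedMap (MonoidHom.inl π π) n (x.1 n)
  obtain ⟨a, ha⟩ := Ideal.Quotient.mkₐ_surjective ℝ _ (x.1 n)
  obtain ⟨b, hb⟩ := Ideal.Quotient.mkₐ_surjective ℝ _ (y.1 n)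
  rw [← ha, ← hb, truncatedMap_mk, truncatedMap_mk, ← map_mul, ← map_mul]
  congr 1
  clear ha hb
  induction a using MonoidAlgebra.induction_on with
  | of g =>
    induction b using MonoidAlgebra.induction_on with
    | of h => simp [MonoidAlgebra.single_mul_single]
    | add b c hb' hc' =>
      rw [map_add, mul_add, add_mul, hb', hc']
    | smul r b hb' =>
      rw [map_smul, mul_smul_comm, smul_mul_assoc, hb']
  | add a c ha' hc' =>
    rw [map_add, mul_add, add_mul, ha', hc']
  | smul r a ha' =>
    rw [map_smul, mul_smul_comm, smul_mul_assoc, ha']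

/-! ### The Malcev completion and its Lie algebra -/

/-- The real Malcev completion of `π`: the group of group-like elements `g` of the completed group
algebra, `Δ g = g ⊗ g`. The completed tensor square of the completed group algebra of `π` is the
completed group algebra of `π × π`; under this identification `Δ` is induced by the diagonal, and
`x ⊗ 1` and `1 ⊗ x` are the images of `x` under the two inclusions `π → π × π`. For a finitely
generated torsion-free nilpotent `π` this is the connected and simply connected nilpotent Lie group
in which `π` is a lattice. -/
def malcevCompletion (π : Type*) [Group π] : Subgroup (completedAlgebra π)ˣ where
  carrier := {u | completedMap (diag π) u =
    completedMap (MonoidHom.inl π π) u * completedMap (MonoidHom.inr π π) u}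
  one_mem' := by
    change completedMap _ _ = completedMap _ _ * completedMap _ _
    simp
  mul_mem' {u v} hu hv := by
    change completedMap _ _ = completedMap _ _ * completedMap _ _ at hu hv ⊢
    rw [Units.val_mul, map_mul, map_mul, map_mul, hu, hv,
      (commute_inl_inr _ _).symm.mul_mul_mul_comm]
  inv_mem' {u} hu := by
    change completedMap _ _ = completedMap _ _ * completedMap _ _ at hu ⊢
    have h1 : completedMap (diag π) (u : completedAlgebra π) *
        completedMap (diag π) (↑u⁻¹ : completedAlgebra π) = 1 := by
      rw [← map_mul, Units.mul_inv, map_one]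
    have h2 : (completedMap (MonoidHom.inl π π) (↑u⁻¹ : completedAlgebra π) *
        completedMap (MonoidHom.inr π π) (↑u⁻¹ : completedAlgebra π)) *
        completedMap (diag π) (u : completedAlgebra π) = 1 := by
      rw [hu, (commute_inl_inr _ _).symm.mul_mul_mul_comm, ← map_mul, ← map_mul, Units.inv_mul,
        map_one, map_one, one_mul]
    exact (left_inv_eq_right_inv h2 h1).symm

instance completedLieRing (π : Type*) [Group π] : LieRing (completedAlgebra π) :=
  LieRing.ofAssociativeRing

instance completedLieAlgebra (π : Type*) [Group π] : LieAlgebra ℝ (completedAlgebra π) :=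
  LieAlgebra.ofAssociativeAlgebra

/-- The Malcev Lie algebra of `π`: the Lie algebra of primitive elements `X` of the completed group
algebra, `Δ X = X ⊗ 1 + 1 ⊗ X`, with the commutator bracket. -/
def malcevLieAlgebra (π : Type*) [Group π] : LieSubalgebra ℝ (completedAlgebra π) where
  carrier := {x | completedMap (diag π) x =
    completedMap (MonoidHom.inl π π) x + completedMap (MonoidHom.inr π π) x}
  zero_mem' := by
    change completedMap _ _ = completedMap _ _ + completedMap _ _
    simp
  add_mem' {x y} hx hy := by
    change completedMap _ _ = completedMap _ _ + completedMap _ _ at hx hy ⊢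
    rw [map_add, map_add, map_add, hx, hy, add_add_add_comm]
  smul_mem' r x hx := by
    change completedMap _ _ = completedMap _ _ + completedMap _ _ at hx ⊢
    rw [map_smul, map_smul, map_smul, hx, smul_add]
  lie_mem' {x y} hx hy := by
    change completedMap _ _ = completedMap _ _ + completedMap _ _ at hx hy ⊢
    simp only [LieRing.of_associative_ring_bracket, map_sub, map_mul, hx, hy]
    have h1 := (commute_inl_inr x y).eq
    have h2 := (commute_inl_inr y x).eq
    simp only [add_mul, mul_add, h1, h2]
    abel

/-- The canonical homomorphism from `π` to its Malcev completion. -/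
def toMalcev (π : Type*) [Group π] : π →* malcevCompletion π :=
  (Units.map (toCompleted π)).comp toUnits.toMonoidHom |>.codRestrict _ fun g => by
    change completedMap _ (toCompleted π g) =
      completedMap _ (toCompleted π g) * completedMap _ (toCompleted π g)
    rw [completedMap_toCompleted, completedMap_toCompleted, completedMap_toCompleted, ← map_mul]
    simp

theorem completedMap_diag {G H : Type*} [Group G] [Group H] (f : G →* H) (x : completedAlgebra G) :
    completedMap (diag H) (completedMap f x) = completedMap (f.prodMap f) (completedMap (diag G) x) := by
  rw [completedMap_comp, completedMap_comp]
  rfl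

theorem completedMap_inl {G H : Type*} [Group G] [Group H] (f : G →* H) (x : completedAlgebra G) :
    completedMap (MonoidHom.inl H H) (completedMap f x) =
      completedMap (f.prodMap f) (completedMap (MonoidHom.inl G G) x) := by
  rw [completedMap_comp, completedMap_comp]
  congr 2
  ext g <;> simp

theorem completedMap_inr {G H : Type*} [Group G] [Group H] (f : G →* H) (x : completedAlgebra G) :
    completedMap (MonoidHom.inr H H) (completedMap f x) =
      completedMap (f.prodMap f) (completedMap (MonoidHom.inr G G) x) := by
  rw [completedMap_comp, completedMap_comp]
  congr 2
  ext g <;> simp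

/-- The extension `D` of an endomorphism `φ` of `π` to the Malcev completion. -/
def malcevMap {π : Type*} [Group π] (φ : π →* π) : malcevCompletion π →* malcevCompletion π :=
  ((Units.map (completedMap φ : completedAlgebra π →* completedAlgebra π)).comp
    (malcevCompletion π).subtype).codRestrict _ fun u => by
      have hu : completedMap (diag π) _ = completedMap _ _ * completedMap _ _ := u.2
      change completedMap _ (completedMap φ _) =
        completedMap _ (completedMap φ _) * completedMap _ (completedMap φ _)
      rw [completedMap_diag, completedMap_inl, completedMap_inr, ← map_mul]
      exact congrArg _ hu

theorem malcevMap_toMalcev {π : Type*} [Group π] (φ : π →* π) (g : π) :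
    malcevMap φ (toMalcev π g) = toMalcev π (φ g) :=
  Subtype.ext (Units.ext (completedMap_toCompleted φ g))

/-- The linearization `D_*` of an endomorphism `φ` of `π`: the endomorphism of the Malcev Lie
algebra induced by the extension of `φ` to the completed group algebra. It is the differential of
`D`: see `malcevMap_malcevExp` below. -/
def linearization {π : Type*} [Group π] (φ : π →* π) :
    malcevLieAlgebra π →ₗ⁅ℝ⁆ malcevLieAlgebra π where
  toFun X := ⟨completedMap φ X.1, by
    have hX : completedMap (diag π) _ = completedMap _ _ + completedMap _ _ := X.2
    change completedMap _ (completedMap φ _) =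
      completedMap _ (completedMap φ _) + completedMap _ (completedMap φ _)
    rw [completedMap_diag, completedMap_inl, completedMap_inr, ← map_add, hX]⟩
  map_add' X Y := Subtype.ext (map_add (completedMap φ) X.1 Y.1)
  map_smul' r X := Subtype.ext (map_smul (completedMap φ) r X.1)
  map_lie' {X Y} := by
    refine Subtype.ext ?_
    change completedMap φ ⁅X.1, Y.1⁆ = ⁅completedMap φ X.1, completedMap φ Y.1⁆
    simp only [LieRing.of_associative_ring_bracket, map_sub, map_mul]

/-! ### The exponential map -/

theorem primitive_one {π : Type*} [Group π] (X : malcevLieAlgebra π) : X.1.1 1 = 0 := by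
  have hX : completedMap (diag π) X.1 = completedMap _ X.1 + completedMap _ X.1 := X.2
  have h1 := congrFun (congrArg Subtype.val hX) 1
  change truncatedMap _ 1 (X.1.1 1) = truncatedMap _ 1 (X.1.1 1) + truncatedMap _ 1 (X.1.1 1) at h1
  obtain ⟨y, hy⟩ := Ideal.Quotient.mkₐ_surjective ℝ _ (X.1.1 1)
  rw [← hy] at h1 ⊢
  rw [truncatedMap_mk, truncatedMap_mk, truncatedMap_mk, ← map_add, Ideal.Quotient.mkₐ_eq_mk,
    Ideal.Quotient.mk_eq_mk_iff_sub_mem, Submodule.pow_one] at h1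
  rw [Ideal.Quotient.mkₐ_eq_mk, Ideal.Quotient.eq_zero_iff_mem, Submodule.pow_one]
  change augmentation _ _ = 0 at h1 ⊢
  rw [map_sub, map_add, augmentation_mapDomain, augmentation_mapDomain, augmentation_mapDomain]
    at h1
  linarith

theorem primitive_pow {π : Type*} [Group π] (X : malcevLieAlgebra π) {n k : ℕ} (h : n ≤ k) :
    X.1.1 n ^ k = 0 := by
  refine pow_eq_zero_of_le h ?_
  rcases Nat.eq_zero_or_pos n with rfl | hn
  · have : Subsingleton (TruncatedAlgebra π 0) :=
      Ideal.Quotient.subsingleton_iff.2 (by simp [Submodule.pow_zero])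
    exact Subsingleton.elim _ _
  obtain ⟨y, hy⟩ := Ideal.Quotient.mkₐ_surjective ℝ _ (X.1.1 n)
  have h1 := X.1.2 1 n hn
  rw [primitive_one, ← hy, Ideal.Quotient.mkₐ_eq_mk, Ideal.Quotient.factorₐ_apply_mk, Ideal.Quotient.eq_zero_iff_mem,
    Submodule.pow_one] at h1
  rw [← hy, ← map_pow, Ideal.Quotient.mkₐ_eq_mk, Ideal.Quotient.eq_zero_iff_mem]
  exact Ideal.pow_mem_pow h1 n

/-- The truncated exponential series. -/
def truncatedExp {A : Type*} [Ring A] [Algebra ℝ A] (n : ℕ) (a : A) : A :=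
  ∑ k ∈ Finset.range n, (k.factorial : ℝ)⁻¹ • a ^ k

theorem truncatedExp_add {A : Type*} [Ring A] [Algebra ℝ A] {n : ℕ} {a b : A} (hab : Commute a b)
    (ha : a ^ n = 0) (hb : b ^ n = 0) (hc : (a + b) ^ n = 0) :
    truncatedExp n (a + b) = truncatedExp n a * truncatedExp n b := by
  let _ : Module ℚ A := Module.compHom A (algebraMap ℚ ℝ)
  have key : ∀ x : A, x ^ n = 0 → truncatedExp n x = IsNilpotent.exp x := by
    intro x hx
    rw [IsNilpotent.exp_eq_sum hx]
    refine Finset.sum_congr rfl fun k _ => ?_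
    change _ = (algebraMap ℚ ℝ (k.factorial : ℚ)⁻¹) • x ^ k
    simp
  rw [key _ ha, key _ hb, key _ hc]
  exact IsNilpotent.exp_add_of_commute hab ⟨n, ha⟩ ⟨n, hb⟩

theorem truncatedExp_of_le {A : Type*} [Ring A] [Algebra ℝ A] {m n : ℕ} (h : m ≤ n) {a : A}
    (ha : a ^ m = 0) : truncatedExp n a = truncatedExp m a := by
  refine (Finset.sum_subset (Finset.range_subset_range.2 h) fun k _ hk => ?_).symm
  rw [pow_eq_zero_of_le (by simpa using hk) ha, smul_zero]

theorem map_truncatedExp {A B : Type*} [Ring A] [Algebra ℝ A] [Ring B] [Algebra ℝ B]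
    (f : A →ₐ[ℝ] B) (n : ℕ) (a : A) : f (truncatedExp n a) = truncatedExp n (f a) := by
  simp [truncatedExp, map_sum]

/-- The exponential `∑ Xᵏ / k!` of a primitive element `X`, in the completed group algebra. (In
`ℝ[π] / Iⁿ` the terms with `k ≥ n` vanish.) -/
def completedExp {π : Type*} [Group π] (X : malcevLieAlgebra π) : completedAlgebra π :=
  ⟨fun n => truncatedExp n (X.1.1 n), fun m n h => by
    rw [map_truncatedExp, X.1.2 m n h, truncatedExp_of_le h (primitive_pow X le_rfl)]⟩

theorem completedExp_mul_neg {π : Type*} [Group π] (X : malcevLieAlgebra π) :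
    completedExp X * completedExp (-X) = 1 := by
  refine Subtype.ext (funext fun n => ?_)
  change truncatedExp n (X.1.1 n) * truncatedExp n (-(X.1.1 n)) = 1
  have hX := primitive_pow X (le_refl n)
  rw [← truncatedExp_add (Commute.refl _).neg_right hX (primitive_pow (-X) le_rfl)
    (by
      rw [add_neg_cancel]
      rcases Nat.eq_zero_or_pos n with rfl | hn
      · rw [pow_zero] at hX ⊢
        exact hX
      · exact zero_pow hn.ne'), add_neg_cancel]
  rcases Nat.eq_zero_or_pos n with rfl | hn
  · rw [pow_zero] at hX
    rw [hX]
    rfl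
  · rw [truncatedExp, Finset.sum_eq_single_of_mem 0 (Finset.mem_range.2 hn)
      fun k _ hk => by rw [zero_pow hk, smul_zero]]
    simp

/-- The exponential map from the Malcev Lie algebra to the Malcev completion. -/
def malcevExp {π : Type*} [Group π] (X : malcevLieAlgebra π) : malcevCompletion π :=
  ⟨⟨completedExp X, completedExp (-X), completedExp_mul_neg X, by
    have := completedExp_mul_neg (-X)
    rwa [neg_neg] at this⟩, by
    have hX : completedMap (diag π) X.1 = completedMap _ X.1 + completedMap _ X.1 := X.2
    refine Subtype.ext (funext fun n => ?_)
    change truncatedMap _ n (truncatedExp n (X.1.1 n)) =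
      truncatedMap _ n (truncatedExp n (X.1.1 n)) * truncatedMap _ n (truncatedExp n (X.1.1 n))
    have hn : truncatedMap (diag π) n (X.1.1 n) = truncatedMap (MonoidHom.inl π π) n (X.1.1 n) +
      truncatedMap (MonoidHom.inr π π) n (X.1.1 n) := congrFun (congrArg Subtype.val hX) n
    have h0 := primitive_pow X (le_refl n)
    rw [map_truncatedExp, map_truncatedExp, map_truncatedExp, hn]
    refine truncatedExp_add (congrFun (congrArg Subtype.val (commute_inl_inr X.1 X.1).eq) n) ?_ ?_ ?_
    · rw [← map_pow, h0, map_zero]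
    · rw [← map_pow, h0, map_zero]
    · rw [← hn, ← map_pow, h0, map_zero]⟩

/-- `D (exp X) = exp (D_* X)`: the linearization is the differential of the extension `D`. -/
theorem malcevMap_malcevExp {π : Type*} [Group π] (φ : π →* π) (X : malcevLieAlgebra π) :
    malcevMap φ (malcevExp X) = malcevExp (linearization φ X) := by
  refine Subtype.ext (Units.ext (Subtype.ext (funext fun n => ?_)))
  exact map_truncatedExp (truncatedMap φ n) n (X.1.1 n)

/-! ### Growth rates -/

/-- The word length of `γ` with respect to `S`: the least length of a word in the letters
`S ∪ S⁻¹` that represents `γ`. -/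
def wordLength {π : Type*} [Group π] (S : Finset π) (γ : π) : ℕ :=
  sInf {n | ∃ w : List π, (∀ x ∈ w, x ∈ S ∨ x⁻¹ ∈ S) ∧ w.prod = γ ∧ w.length = n}

/-- The growth rate of an endomorphism `φ` of a group generated by the finite set `S`:
the supremum over `γ` of `limsup L(φᵏ γ, S) ^ (1 / k)`. -/
def growthRate {π : Type*} [Group π] (S : Finset π) (φ : π →* π) : ℝ≥0∞ :=
  ⨆ γ : π, Filter.limsup
    (fun k : ℕ => (wordLength S (φ^[k] γ) : ℝ≥0∞) ^ (1 / (k : ℝ))) Filter.atTop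

end

end MalcevGrowth

open MalcevGrowth

namespace MalcevGrowth

/-! ### Lower central series and torsion-free nilpotent groups -/

/-! The argument runs through real polynomial functions on `π`. Give the `j`-th isolator (counted
from 1) weight `j`, and say that `f` has degree at most `d` if each difference `f (h g) - f g` with
`h` of weight `k` has degree at most `d - k`. Isolators satisfy `[√π_i, √π_j] ⊆ √π_{i+j}`, because
commuting powers force commutation in a torsion-free nilpotent group. Two facts about these
functions carry the theorem. First, every coordinate of the `j`-th quotient extends from `√π_j` to a
function of degree `j` on all of `π` (`exists_coordFun`), one infinite cyclic extension at a time.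
Second, these extensions generate: a function of degree `d` is a polynomial of weighted degree `d`
in them (`IsPoly.mem_filtration`). The second fact is stated for an arbitrary multiplicative
filtration of the function algebra, so that it serves both halves of the theorem.

Lie algebra. Functions killing `I ^ n` are the functionals on `ℝ[π] / I ^ n`, and they are
polynomial. A primitive element acts on them as a derivation at the identity, so the functions on
which it vanishes are closed under products; by generation it is determined by its values on the
coordinates. The logarithm of `x ∈ √π_j` takes on the `j`-th coordinates the values of the class of
`x`, as comparison of linear terms along the powers of `x` shows. Hence the pairing of the
logarithms of an adapted basis with the coordinates is block triangular with identity diagonal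
blocks. This makes the logarithms a basis and, since `D_* log x = log (φ x)`, gives the shape of the
matrix.

Growth, lower bound. A function of degree `j` is at most of the order of the `j`-th power of word
length (`IsPoly.le_wordLength_pow`). Applied to the coordinates along the orbits of basis elements,
this bounds the entries of the powers of `D_j`, hence its spectral radius.

Growth, upper bound. Let `b ≥ 1` with `sp(D_j) < b ^ j` for all `j`. Along an orbit the `j`-th
coordinates obey a linear recursion with matrix `D_j`, whose error term is a polynomial of weighted
degree `j` in earlier coordinates; by induction they are `O(b ^ (j m))`, and by generation every
function of degree `d` is `O(b ^ (d m))`. Conversely, such bounds on polynomial functions bound word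
length by `O(b ^ m)` (`Tame.lengthBounded`), because an element of `√π_j` raised to a power of size
`R ^ j` is, modulo `√π_{j+1}`, a word of length `O(R)`. If every `sp(D_j) < 1`, the integer matrices
`D_j` are nilpotent and all orbits end at the identity. -/

/-- The three subgroups lemma, applied in `G ⧸ K`. -/
theorem commutator_commutator_le_of_rotate {G : Type*} [Group G] (A B C K : Subgroup G) [K.Normal]
    (h1 : ⁅⁅B, C⁆, A⁆ ≤ K) (h2 : ⁅⁅C, A⁆, B⁆ ≤ K) : ⁅⁅A, B⁆, C⁆ ≤ K := by
  have key : ∀ L : Subgroup G, L ≤ K ↔ L.map (QuotientGroup.mk' K) = ⊥ := fun L => by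
    rw [Subgroup.map_eq_bot_iff, QuotientGroup.ker_mk']
  simp only [key, Subgroup.map_commutator] at h1 h2 ⊢
  exact Subgroup.commutator_commutator_eq_bot_of_rotate h1 h2

/-- Induction on `j` by the three subgroups lemma. The `+ 1` comes from indexing the series from
`0`: with indices from `1` the weights simply add. -/
theorem commutator_lowerCentralSeries_le {G : Type*} [Group G] (i j : ℕ) :
    ⁅(⊤ : Subgroup G).lowerCentralSeries i, (⊤ : Subgroup G).lowerCentralSeries j⁆ ≤
      (⊤ : Subgroup G).lowerCentralSeries (i + j + 1) := by
  induction j generalizing i with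
  | zero => rw [Subgroup.lowerCentralSeries_zero, add_zero, Subgroup.lowerCentralSeries_succ]
  | succ j ih =>
    rw [Subgroup.lowerCentralSeries_succ ⊤ j, Subgroup.commutator_comm]
    refine commutator_commutator_le_of_rotate _ _ _ _ ?_ ?_
    · rw [Subgroup.commutator_comm ⊤, ← Subgroup.lowerCentralSeries_succ]
      refine (ih (i + 1)).trans (le_of_eq ?_)
      congr 1; omega
    · refine (Subgroup.commutator_mono (ih i) le_rfl).trans (le_of_eq ?_)
      rw [← Subgroup.lowerCentralSeries_succ]
      congr 1

/-! ### Subgroups of finitely generated nilpotent groups are finitely generated. -/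

theorem subgroup_fg_of_commGroup {A : Type*} [CommGroup A] [Group.FG A] (H : Subgroup A) :
    H.FG := by
  have h1 : AddGroup.FG (Additive A) := AddGroup.fg_of_group_fg
  have h2 : Module.Finite ℤ (Additive A) := Module.Finite.iff_addGroup_fg.2 h1
  have h3 : (AddSubgroup.toIntSubmodule (Subgroup.toAddSubgroup H)).FG := IsNoetherian.noetherian _
  rw [Subgroup.fg_iff_add_fg]
  simpa using (Submodule.fg_iff_addSubgroup_fg _).1 h3

theorem subgroup_fg_of_le_center {G : Type*} [Group G] {K H : Subgroup G}
    (hK : K ≤ Subgroup.center G) (hfg : K.FG) (hHK : H ≤ K) : H.FG := by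
  let _ : CommGroup K := { (inferInstance : Group K) with
    mul_comm := fun a b => Subtype.ext (Subgroup.mem_center_iff.1 (hK b.2) a) }
  have : Group.FG K := (Group.fg_iff_subgroup_fg K).2 hfg
  have h := (Group.fg_iff_subgroup_fg _).2 (subgroup_fg_of_commGroup (H.subgroupOf K))
  have h2 := Group.fg_of_surjective (f := (Subgroup.subgroupOfEquivOfLe hHK).toMonoidHom)
    (Subgroup.subgroupOfEquivOfLe hHK).surjective
  exact (Group.fg_iff_subgroup_fg H).1 h2

theorem subgroup_fg_of_extension {G : Type*} [Group G] (K H : Subgroup G) [K.Normal]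
    (h1 : (H.map (QuotientGroup.mk' K)).FG) (h2 : (H ⊓ K).FG) : H.FG := by
  obtain ⟨S, hS, hSf⟩ := (Subgroup.fg_iff _).1 h1
  obtain ⟨T, hT, hTf⟩ := (Subgroup.fg_iff _).1 h2
  have hex : ∀ s ∈ S, ∃ g ∈ H, QuotientGroup.mk' K g = s := fun s hs => by
    have : s ∈ H.map (QuotientGroup.mk' K) := hS ▸ Subgroup.subset_closure hs
    exact this
  choose! f hf hfs using hex
  refine (Subgroup.fg_iff _).2 ⟨f '' S ∪ T, le_antisymm ?_ ?_, (hSf.image f).union hTf⟩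
  · rw [Subgroup.closure_le]
    rintro x (⟨s, hs, rfl⟩ | hx)
    · exact hf s hs
    · have : x ∈ H ⊓ K := hT ▸ Subgroup.subset_closure hx
      exact this.1
  · intro x hx
    have hmap : (Subgroup.closure (f '' S)).map (QuotientGroup.mk' K) =
        H.map (QuotientGroup.mk' K) := by
      rw [MonoidHom.map_closure, ← hS, Set.image_image]
      congr 1
      ext y
      simp only [Set.mem_image]
      exact ⟨fun ⟨s, hs, h⟩ => by rwa [← h, hfs s hs], fun hy => ⟨y, hy, hfs y hy⟩⟩
    have hx' : QuotientGroup.mk' K x ∈ (Subgroup.closure (f '' S)).map (QuotientGroup.mk' K) :=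
      hmap ▸ Subgroup.mem_map_of_mem _ hx
    obtain ⟨y, hy, hyx⟩ := hx'
    have hyH : y ∈ H := by
      refine (Subgroup.closure_le _).2 ?_ hy
      rintro _ ⟨s, hs, rfl⟩
      exact hf s hs
    have hK : y⁻¹ * x ∈ K := QuotientGroup.eq.1 hyx
    have h3 : y⁻¹ * x ∈ Subgroup.closure T := hT ▸ ⟨H.mul_mem (H.inv_mem hyH) hx, hK⟩
    rw [← mul_inv_cancel_left y x]
    exact Subgroup.mul_mem _ (Subgroup.closure_mono Set.subset_union_left hy)
      (Subgroup.closure_mono Set.subset_union_right h3)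

/-- Modulo the term after next, the commutator of a term of the series with `G` is multiplicative in
each variable, so commutators of generators generate the next quotient. -/
theorem exists_finite_lowerCentralSeries_le {G : Type*} [Group G] [Group.FG G] (j : ℕ) :
    ∃ T : Set G, T.Finite ∧ T ⊆ (⊤ : Subgroup G).lowerCentralSeries j ∧
      (⊤ : Subgroup G).lowerCentralSeries j ≤
        Subgroup.closure T ⊔ (⊤ : Subgroup G).lowerCentralSeries (j + 1) := by
  obtain ⟨S, hS, hSf⟩ := Group.fg_iff.1 (inferInstance : Group.FG G)
  induction j with
  | zero => exact ⟨S, hSf, by simp, by rw [hS]; exact le_sup_of_le_left le_top⟩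
  | succ j ih =>
    obtain ⟨T, hTf, hTj, hT⟩ := ih
    set M := (⊤ : Subgroup G).lowerCentralSeries (j + 1 + 1) with hM
    set T' := Set.image2 (fun x s => ⁅x, s⁆) T S with hT'
    have hT'j : T' ⊆ (⊤ : Subgroup G).lowerCentralSeries (j + 1) := by
      rintro _ ⟨x, hx, s, -, rfl⟩
      exact Subgroup.commutator_mem_commutator (hTj hx) (Subgroup.mem_top s)
    set C := Subgroup.closure T' ⊔ M with hC
    have hCj : C ≤ (⊤ : Subgroup G).lowerCentralSeries (j + 1) :=
      sup_le ((Subgroup.closure_le _).2 hT'j) (Subgroup.lowerCentralSeries_antitone _ (by omega))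
    have hcomm : ∀ x ∈ (⊤ : Subgroup G).lowerCentralSeries (j + 1), ∀ g, ⁅x, g⁆ ∈ C :=
      fun x hx g => Subgroup.mem_sup_right
        (Subgroup.commutator_mem_commutator hx (Subgroup.mem_top g))
    -- Normality of `C` lets the conjugations in the commutator expansions below be ignored. It
    -- holds because conjugating an element of `C` changes it by an element of `M`.
    have hCn : C.Normal := ⟨fun c hc g => by
      have : g * c * g⁻¹ = ⁅c, g⁆⁻¹ * c := by rw [commutatorElement_def]; group
      rw [this]
      exact C.mul_mem (C.inv_mem (hcomm c (hCj hc) g)) hc⟩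
    refine ⟨T', hTf.image2 _ hSf, hT'j, ?_⟩
    rw [Subgroup.lowerCentralSeries_succ, Subgroup.commutator_le]
    have h1 : ∀ x ∈ T, ∀ g, ⁅x, g⁆ ∈ C := by
      intro x hx g
      have hg : g ∈ Subgroup.closure S := hS ▸ Subgroup.mem_top g
      induction hg using Subgroup.closure_induction with
      | mem s hs => exact Subgroup.mem_sup_left (Subgroup.subset_closure ⟨x, hx, s, hs, rfl⟩)
      | one => simp [C.one_mem]
      | mul a b _ _ ha hb =>
        rw [commutatorElement_mul_right_eq_mul_conj, mul_assoc, mul_assoc, ← mul_assoc a]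
        exact C.mul_mem ha (hCn.conj_mem _ hb a)
      | inv a _ ha =>
        rw [commutatorElement_inv_right, ← commutatorElement_inv]
        simpa using hCn.conj_mem _ (C.inv_mem ha) a⁻¹
    intro x hx g _
    have hx' := hT hx
    obtain ⟨y, hy, z, hz, rfl⟩ := Subgroup.mem_sup_of_normal_right.1 hx'
    rw [commutatorElement_mul_left_eq_conj_mul]
    refine C.mul_mem (hCn.conj_mem _ (hcomm z hz g) y) ?_
    clear hx hx'
    induction hy using Subgroup.closure_induction with
    | mem x hx => exact h1 x hx g
    | one => simp [C.one_mem]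
    | mul a b _ _ ha hb =>
      rw [commutatorElement_mul_left_eq_conj_mul]
      exact C.mul_mem (hCn.conj_mem _ hb a) ha
    | inv a _ ha =>
      rw [commutatorElement_inv_left, ← commutatorElement_inv]
      simpa using hCn.conj_mem _ (C.inv_mem ha) a⁻¹

/-- Induction on the length: `K`, the term just before the trivial one, is central and finitely
generated, so `H ⊓ K` is finitely generated, while the image of `H` lies in a quotient of smaller
class. -/
theorem subgroup_fg_of_lowerCentralSeries_eq_bot (c : ℕ) : ∀ (G : Type*) [Group G] [Group.FG G],
    (⊤ : Subgroup G).lowerCentralSeries c = ⊥ → ∀ H : Subgroup G, H.FG := by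
  induction c with
  | zero =>
    intro G _ _ h H
    rw [Subgroup.lowerCentralSeries_zero] at h
    have : H = ⊥ := eq_bot_mono le_top h
    exact this ▸ Subgroup.FG.bot
  | succ c ih =>
    intro G _ _ h H
    set K := (⊤ : Subgroup G).lowerCentralSeries c with hK
    have hfg : K.FG := by
      obtain ⟨T, hTf, hTj, hT⟩ := exists_finite_lowerCentralSeries_le (G := G) c
      rw [h, sup_bot_eq] at hT
      exact (Subgroup.fg_iff _).2 ⟨T, le_antisymm ((Subgroup.closure_le _).2 hTj) hT, hTf⟩
    have hcen : K ≤ Subgroup.center G := by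
      rw [← Subgroup.commutator_top_right_eq_bot_iff_le_center, hK,
        ← Subgroup.lowerCentralSeries_succ, h]
    refine subgroup_fg_of_extension K H (ih (G ⧸ K) ?_ _)
      (subgroup_fg_of_le_center hcen hfg inf_le_right)
    have : (⊤ : Subgroup (G ⧸ K)) = (⊤ : Subgroup G).map (QuotientGroup.mk' K) :=
      (Subgroup.map_top_of_surjective _ (QuotientGroup.mk'_surjective K)).symm
    rw [this, ← Subgroup.map_lowerCentralSeries, Subgroup.map_eq_bot_iff, QuotientGroup.ker_mk']

theorem subgroup_fg_of_isNilpotent {G : Type*} [Group G] [Group.FG G] [Group.IsNilpotent G]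
    (H : Subgroup G) : H.FG :=
  subgroup_fg_of_lowerCentralSeries_eq_bot _ G Subgroup.lowerCentralSeries_nilpotencyClass H

/-! ### Uniqueness of roots in torsion-free nilpotent groups. -/

/-- The subgroup generated by `x` and the commutators has smaller class and contains both `x` and `y
x y⁻¹`. These have the same `k`-th power, since `x ^ k = y ^ k` commutes with `y`; by induction they
agree. So `x` and `y` commute, and `x y⁻¹` is torsion. -/
theorem pow_left_injective_of_lcs (c : ℕ) : ∀ (G : Type*) [Group G],
    (⊤ : Subgroup G).lowerCentralSeries c = ⊥ → (∀ g : G, IsOfFinOrder g → g = 1) →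
    ∀ (x y : G) (k : ℕ), 1 ≤ k → x ^ k = y ^ k → x = y := by
  induction c with
  | zero =>
    intro G _ h _ x y _ _ _
    rw [Subgroup.lowerCentralSeries_zero] at h
    have key : ∀ z : G, z = 1 := fun z => Subgroup.mem_bot.1 (h ▸ Subgroup.mem_top z)
    rw [key x, key y]
  | succ c ih =>
    intro G _ h htf x y k hk hxy
    have hcomm : Commute x y := by
      rcases Nat.eq_zero_or_pos c with rfl | hc
      · rw [← commutatorElement_eq_one_iff_commute, ← Subgroup.mem_bot, ← h]
        exact Subgroup.commutator_mem_commutator (Subgroup.mem_top x) (Subgroup.mem_top y)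
      · obtain ⟨i, rfl⟩ : ∃ i, c = i + 1 := ⟨c - 1, by omega⟩
        set N := Subgroup.zpowers x ⊔ commutator G with hN
        have hxN : x ∈ N := Subgroup.mem_sup_left (Subgroup.mem_zpowers x)
        have hNbot : (⊤ : Subgroup N).lowerCentralSeries (i + 1) = ⊥ := by
          have h1 := Subgroup.top_subtype_lowerCentralSeries N (i + 1)
          have h2 := sup_lcs_le x i
          rw [h, ← hN, ← h1, le_bot_iff, Subgroup.map_eq_bot_iff_of_injective _
            N.subtype_injective] at h2
          exact h2
        have hconj : y * x * y⁻¹ ∈ N := by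
          have : y * x * y⁻¹ = ⁅y, x⁆ * x := by simp [commutatorElement_def]
          rw [this]
          exact N.mul_mem (Subgroup.mem_sup_right (Subgroup.commutator_mem_commutator
            (Subgroup.mem_top _) (Subgroup.mem_top _))) hxN
        have h3 : (y * x * y⁻¹) ^ k = x ^ k := by
          rw [conj_pow, hxy, mul_inv_eq_iff_eq_mul, ← pow_succ, ← pow_succ']
        have h4 := ih N hNbot (fun g hg => Subtype.ext (htf g (Submonoid.isOfFinOrder_coe.2 hg)))
          ⟨_, hconj⟩ ⟨x, hxN⟩ k hk (Subtype.ext h3)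
        have h5 := congrArg Subtype.val h4
        rw [mul_inv_eq_iff_eq_mul] at h5
        exact h5.symm
    have h6 : (x * y⁻¹) ^ k = 1 := by
      rw [hcomm.inv_right.mul_pow, inv_pow, hxy, mul_inv_cancel]
    exact mul_inv_eq_one.1 (htf _ (isOfFinOrder_iff_pow_eq_one.2 ⟨k, hk, h6⟩))

/-- If `x ^ k` commutes with `y`, then `x` and its conjugate by `y` are `k`-th roots of the same
element, hence equal. This is used once for each variable. -/
theorem commute_of_commute_pow {G : Type*} [Group G] [Group.IsNilpotent G]
    (htf : ∀ g : G, IsOfFinOrder g → g = 1) {x y : G} {k l : ℕ} (hk : 1 ≤ k) (hl : 1 ≤ l)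
    (h : Commute (x ^ k) (y ^ l)) : Commute x y := by
  have key : ∀ (x y : G) (k : ℕ), 1 ≤ k → Commute (x ^ k) y → Commute x y := by
    intro x y k hk h
    have h3 : (y * x * y⁻¹) ^ k = x ^ k := by
      rw [conj_pow, mul_inv_eq_iff_eq_mul]
      exact h.symm
    have h5 := pow_left_injective_of_lcs _ G Subgroup.lowerCentralSeries_nilpotencyClass htf
      _ _ k hk h3
    rw [mul_inv_eq_iff_eq_mul] at h5
    exact h5.symm
  exact (key y x l hl (key x (y ^ l) k hk h).symm).symm

/-! ### The adapted series -/

section adapted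

variable {π : Type*} [Group π] [Group.IsNilpotent π]

theorem le_adaptedSeries (j : ℕ) : (⊤ : Subgroup π).lowerCentralSeries j ≤ adaptedSeries π j :=
  fun x hx => ⟨1, le_rfl, by rwa [pow_one]⟩

theorem adaptedSeries_antitone : Antitone (adaptedSeries π) := by
  rintro i j hij x ⟨k, hk, h⟩
  exact ⟨k, hk, Subgroup.lowerCentralSeries_antitone _ hij h⟩

theorem adaptedSeries_zero : adaptedSeries π 0 = ⊤ :=
  top_le_iff.1 (le_adaptedSeries 0)

theorem mem_adaptedSeries_of_pow_mem {j k : ℕ} (hk : 1 ≤ k) {x : π}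
    (h : x ^ k ∈ adaptedSeries π j) : x ∈ adaptedSeries π j := by
  obtain ⟨l, hl, h⟩ := h
  exact ⟨k * l, Nat.mul_pos hk hl, by rwa [pow_mul]⟩

theorem quotient_adaptedSeries_torsionFree (j : ℕ) (g : π ⧸ adaptedSeries π j)
    (hg : IsOfFinOrder g) : g = 1 := by
  induction g using QuotientGroup.induction_on with
  | H x =>
    obtain ⟨k, hk, h⟩ := (isOfFinOrder_mk_iff _ x).1 hg
    exact (QuotientGroup.eq_one_iff x).2 (mem_adaptedSeries_of_pow_mem hk h)

/-- Suitable powers of `x` and `y` lie in the lower central series and commute in the quotient by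
the target isolator. That quotient is torsion-free, so `x` and `y` commute there too. -/
theorem commutator_mem_adaptedSeries {i j : ℕ} {x y : π} (hx : x ∈ adaptedSeries π i)
    (hy : y ∈ adaptedSeries π j) : ⁅x, y⁆ ∈ adaptedSeries π (i + j + 1) := by
  obtain ⟨k, hk, hxk⟩ := hx
  obtain ⟨l, hl, hyl⟩ := hy
  have h1 : ⁅x ^ k, y ^ l⁆ ∈ adaptedSeries π (i + j + 1) :=
    le_adaptedSeries _ (commutator_lowerCentralSeries_le i j
      (Subgroup.commutator_mem_commutator hxk hyl))
  have key : ∀ a b : π, ⁅a, b⁆ ∈ adaptedSeries π (i + j + 1) ↔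
      Commute (QuotientGroup.mk' (adaptedSeries π (i + j + 1)) a)
        (QuotientGroup.mk' (adaptedSeries π (i + j + 1)) b) := fun a b => by
    rw [← commutatorElement_eq_one_iff_commute, ← map_commutatorElement, ← MonoidHom.mem_ker,
      QuotientGroup.ker_mk']
  rw [key] at h1 ⊢
  rw [map_pow, map_pow] at h1
  exact commute_of_commute_pow (quotient_adaptedSeries_torsionFree _) hk hl h1

theorem adaptedSeries_nilpotencyClass (htf : ∀ g : π, IsOfFinOrder g → g = 1) :
    adaptedSeries π (Group.nilpotencyClass π) = ⊥ := by
  rw [eq_bot_iff]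
  rintro x ⟨k, hk, h⟩
  rw [Subgroup.lowerCentralSeries_nilpotencyClass, Subgroup.mem_bot] at h
  exact htf x (isOfFinOrder_iff_pow_eq_one.2 ⟨k, hk, h⟩)

theorem adaptedQuotient_mul_comm (j : ℕ) (a b : AdaptedQuotient π j) : a * b = b * a := by
  induction a using QuotientGroup.induction_on with
  | H x =>
    induction b using QuotientGroup.induction_on with
    | H y =>
      rw [← commutatorElement_eq_one_iff_mul_comm]
      change ((⁅x, y⁆ : adaptedSeries π j) : AdaptedQuotient π j) = 1
      rw [QuotientGroup.eq_one_iff, Subgroup.mem_subgroupOf]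
      exact adaptedSeries_antitone (by omega) (commutator_mem_adaptedSeries x.2 y.2)

theorem exists_adaptedQuotient_mulEquiv [Group.FG π] (j : ℕ) :
    ∃ r : ℕ, Nonempty (AdaptedQuotient π j ≃* Multiplicative (Fin r → ℤ)) := by
  let _ : CommGroup (AdaptedQuotient π j) :=
    { (inferInstance : Group (AdaptedQuotient π j)) with mul_comm := adaptedQuotient_mul_comm j }
  have h0 : Group.FG (adaptedSeries π j) :=
    (Group.fg_iff_subgroup_fg _).2 (subgroup_fg_of_isNilpotent _)
  have h1 : Group.FG (AdaptedQuotient π j) := QuotientGroup.fg _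
  have h2 : Module.Finite ℤ (Additive (AdaptedQuotient π j)) :=
    Module.Finite.iff_addGroup_fg.2 AddGroup.fg_of_group_fg
  have h3 : IsMulTorsionFree (AdaptedQuotient π j) := by
    refine ⟨fun n hn a b hab => ?_⟩
    have h4 : (a * b⁻¹) ^ n = 1 := by
      rw [mul_pow, inv_pow, show a ^ n = b ^ n from hab, mul_inv_cancel]
    rw [← mul_inv_eq_one]
    obtain ⟨x, hx⟩ := QuotientGroup.mk_surjective (a * b⁻¹)
    rw [← hx, ← QuotientGroup.mk_pow, QuotientGroup.eq_one_iff, Subgroup.mem_subgroupOf] at h4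
    rw [← hx, QuotientGroup.eq_one_iff, Subgroup.mem_subgroupOf]
    exact mem_adaptedSeries_of_pow_mem (Nat.one_le_iff_ne_zero.2 hn) h4
  exact ⟨_, ⟨AddEquiv.toMultiplicativeRight
    (Module.finBasis ℤ (Additive (AdaptedQuotient π j))).equivFun.toAddEquiv⟩⟩

end adapted


/-! ### Polynomial functions on filtered groups -/

/-- The difference `g ↦ f (h g) - f g`. -/
def leftDiff {G : Type*} [Group G] (h : G) (f : G → ℝ) : G → ℝ := fun g => f (h * g) - f g

/-- `PolyOn Γ N d f`: on the subgroup `N`, the function `f` is polynomial of degree at most `d` with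
respect to the filtration `Γ`, that is, differences by elements of `N ⊓ Γ k` lower the degree
by `k`. -/
inductive PolyOn {G : Type*} [Group G] (Γ : ℕ → Subgroup G) (N : Subgroup G) : ℤ → (G → ℝ) → Prop
  | neg {d : ℤ} {f : G → ℝ} (hd : d < 0) (hf : ∀ x ∈ N, f x = 0) : PolyOn Γ N d f
  | step {d : ℤ} {f : G → ℝ} (hd : 0 ≤ d)
      (hf : ∀ k : ℕ, 1 ≤ k → ∀ h ∈ N, h ∈ Γ k → PolyOn Γ N (d - k) (leftDiff h f)) : PolyOn Γ N d f

namespace PolyOn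

variable {G : Type*} [Group G] {Γ : ℕ → Subgroup G} {N : Subgroup G} {d e : ℤ} {f g : G → ℝ}

theorem eq_zero (hf : PolyOn Γ N d f) (hd : d < 0) : ∀ x ∈ N, f x = 0 := by
  cases hf with
  | neg _ h => exact h
  | step h _ => omega

theorem diff (hf : PolyOn Γ N d f) {k : ℕ} (hk : 1 ≤ k) {h : G} (hN : h ∈ N) (hΓ : h ∈ Γ k) :
    PolyOn Γ N (d - k) (leftDiff h f) := by
  cases hf with
  | neg hd hf =>
    exact neg (by omega) fun x hx => by simp [leftDiff, hf x hx, hf _ (N.mul_mem hN hx)]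
  | step _ hf => exact hf k hk h hN hΓ

theorem congr (hf : PolyOn Γ N d f) (hfg : ∀ x ∈ N, f x = g x) : PolyOn Γ N d g := by
  induction hf generalizing g with
  | neg hd hf => exact neg hd fun x hx => by rw [← hfg x hx, hf x hx]
  | step hd _ ih =>
    exact step hd fun k hk h hN hΓ => ih k hk h hN hΓ fun x hx => by
      simp [leftDiff, hfg x hx, hfg _ (N.mul_mem hN hx)]

theorem zero_of_lt : ∀ (n : ℕ) (d : ℤ), d < n → PolyOn Γ N d 0 := by
  intro n
  induction n with
  | zero => exact fun d hd => neg (by simpa using hd) fun _ _ => rfl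
  | succ n ih =>
    intro d hd
    by_cases h0 : d < 0
    · exact neg h0 fun _ _ => rfl
    · refine step (by omega) fun k hk h _ _ => ?_
      have : leftDiff h (0 : G → ℝ) = 0 := by ext; simp [leftDiff]
      rw [this]
      exact ih _ (by push_cast at hd; omega)

theorem zero (d : ℤ) : PolyOn Γ N d 0 := zero_of_lt (d.toNat + 1) d (by omega)

theorem of_eq_zero (hf : ∀ x ∈ N, f x = 0) : PolyOn Γ N d f :=
  (zero d).congr fun x hx => (hf x hx).symm

theorem const (c : ℝ) : PolyOn Γ N 0 (fun _ => c) :=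
  step le_rfl fun k _ h _ _ => of_eq_zero fun x _ => by simp [leftDiff]

theorem mono (hf : PolyOn Γ N d f) (hde : d ≤ e) : PolyOn Γ N e f := by
  induction hf generalizing e with
  | neg hd hf => exact of_eq_zero hf
  | step hd _ ih => exact step (by omega) fun k hk h hN hΓ => ih k hk h hN hΓ (by omega)

theorem add (hf : PolyOn Γ N d f) (hg : PolyOn Γ N d g) : PolyOn Γ N d (f + g) := by
  induction hf generalizing g with
  | neg hd hf => exact neg hd fun x hx => by simp [hf x hx, hg.eq_zero hd x hx]
  | @step d f hd _ ih =>
    refine step hd fun k hk h hN hΓ => ?_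
    have : leftDiff h (f + g) = leftDiff h f + leftDiff h g := by
      ext x; simp only [leftDiff, Pi.add_apply]; ring
    rw [this]
    exact ih k hk h hN hΓ (hg.diff hk hN hΓ)

theorem smul (c : ℝ) (hf : PolyOn Γ N d f) : PolyOn Γ N d (c • f) := by
  induction hf with
  | neg hd hf => exact neg hd fun x hx => by simp [hf x hx]
  | @step d f hd _ ih =>
    refine step hd fun k hk h hN hΓ => ?_
    have : leftDiff h (c • f) = c • leftDiff h f := by
      ext x; simp only [leftDiff, Pi.smul_apply, smul_eq_mul, mul_sub]
    rw [this]
    exact ih k hk h hN hΓ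

theorem sub (hf : PolyOn Γ N d f) (hg : PolyOn Γ N d g) : PolyOn Γ N d (f - g) := by
  have : f - g = f + (-1 : ℝ) • g := by ext; simp [sub_eq_add_neg]
  rw [this]
  exact hf.add (hg.smul _)

theorem sum {ι : Type*} (s : Finset ι) (F : ι → G → ℝ) (hF : ∀ i ∈ s, PolyOn Γ N d (F i)) :
    PolyOn Γ N d (∑ i ∈ s, F i) := by
  classical
  induction s using Finset.induction_on with
  | empty => simpa using zero d
  | insert i s hi ih =>
    rw [Finset.sum_insert hi]
    exact (hF i (by simp)).add (ih fun k hk => hF k (by simp [hk]))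

theorem mul (hf : PolyOn Γ N d f) (hg : PolyOn Γ N e g) : PolyOn Γ N (d + e) (f * g) := by
  induction hf generalizing e g with
  | neg hd hf => exact of_eq_zero fun x hx => by simp [hf x hx]
  | @step d f hd hf ih =>
    induction hg with
    | neg he hg => exact of_eq_zero fun x hx => by simp [hg x hx]
    | @step e g he hg ih2 =>
      refine step (by omega) fun k hk h hN hΓ => ?_
      -- The discrete Leibniz rule has a second-order term. Each of the three summands has total
      -- degree at most `d + e - k`.
      have key : leftDiff h (f * g) =
          leftDiff h f * g + f * leftDiff h g + leftDiff h f * leftDiff h g := by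
        ext x; simp only [leftDiff, Pi.add_apply, Pi.mul_apply]; ring
      rw [key]
      refine ((?_ : PolyOn Γ N _ _).add ?_).add ?_
      · exact (ih k hk h hN hΓ (step he hg)).mono (by omega)
      · exact (ih2 k hk h hN hΓ).mono (by omega)
      · exact (ih k hk h hN hΓ (hg k hk h hN hΓ)).mono (by omega)

theorem comp_hom {G' : Type*} [Group G'] {Γ' : ℕ → Subgroup G'} {N' : Subgroup G'} {f : G' → ℝ}
    (hf : PolyOn Γ' N' d f) (φ : G →* G') (hN : ∀ x ∈ N, φ x ∈ N')
    (hΓ : ∀ k, ∀ x ∈ Γ k, φ x ∈ Γ' k) : PolyOn Γ N d (f ∘ φ) := by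
  induction hf with
  | neg hd hf => exact neg hd fun x hx => hf _ (hN x hx)
  | step hd _ ih =>
    refine step hd fun k hk h hhN hhΓ => ?_
    have := ih k hk (φ h) (hN h hhN) (hΓ k h hhΓ)
    refine this.congr fun x _ => ?_
    simp [leftDiff]

end PolyOn

/-! ### Extension of polynomial functions along an infinite cyclic quotient -/

section extension

variable {G : Type*} [Group G] {Γ : ℕ → Subgroup G} {N : Subgroup G} {j : ℕ}

/-- A family of functions, indexed by `ℤ`, whose `l`-th differences are polynomial functions of
degree at most `d - j l`. -/
def PolyFamily (Γ : ℕ → Subgroup G) (N : Subgroup G) (j : ℕ) (d : ℤ) (φ : ℤ → G → ℝ) : Prop :=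
  ∀ (l : ℕ) (t : ℤ), PolyOn Γ N (d - j * l) ((fwdDiff (1 : ℤ))^[l] φ t)

namespace PolyFamily

variable {d e : ℤ} {φ ψ : ℤ → G → ℝ}

theorem apply (hφ : PolyFamily Γ N j d φ) (t : ℤ) : PolyOn Γ N d (φ t) := by
  simpa using hφ 0 t

theorem fwdDiff (hφ : PolyFamily Γ N j d φ) : PolyFamily Γ N j (d - j) (fwdDiff (1 : ℤ) φ) := by
  intro l t
  have := hφ (l + 1) t
  rw [Function.iterate_succ_apply] at this
  exact this.mono (le_of_eq (by push_cast; ring))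

theorem of_fwdDiff (h0 : ∀ t, PolyOn Γ N d (φ t))
    (h1 : PolyFamily Γ N j (d - j) (_root_.fwdDiff (1 : ℤ) φ)) : PolyFamily Γ N j d φ := by
  rintro (_ | l) t
  · simpa using h0 t
  · rw [Function.iterate_succ_apply]
    exact (h1 l t).mono (le_of_eq (by push_cast; ring))

theorem mono (hφ : PolyFamily Γ N j d φ) (h : d ≤ e) : PolyFamily Γ N j e φ :=
  fun l t => (hφ l t).mono (by omega)

theorem add (hφ : PolyFamily Γ N j d φ) (hψ : PolyFamily Γ N j d ψ) :
    PolyFamily Γ N j d (φ + ψ) := by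
  intro l t
  rw [fwdDiff_iter_add]
  exact (hφ l t).add (hψ l t)

theorem zero : PolyFamily Γ N j d 0 := by
  intro l t
  have : (_root_.fwdDiff (1 : ℤ))^[l] (0 : ℤ → G → ℝ) = 0 := by
    induction l with
    | zero => rfl
    | succ l ih =>
      rw [Function.iterate_succ_apply', ih]
      ext; simp [_root_.fwdDiff]
  rw [this]
  exact PolyOn.zero _

theorem congr (hφ : PolyFamily Γ N j d φ) (h : ∀ t, ∀ x ∈ N, φ t x = ψ t x) :
    PolyFamily Γ N j d ψ := by
  intro l
  induction l generalizing φ ψ d with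
  | zero => exact fun t => (hφ 0 t).congr (h t)
  | succ l ih =>
    intro t
    rw [Function.iterate_succ_apply]
    refine (ih hφ.fwdDiff (ψ := _root_.fwdDiff (1 : ℤ) ψ) (fun t x hx => ?_) t).mono
      (le_of_eq (by push_cast; ring))
    simp [_root_.fwdDiff, h _ x hx]

theorem of_eq_zero (h : ∀ t, ∀ x ∈ N, φ t x = 0) : PolyFamily Γ N j d φ :=
  zero.congr fun t x hx => (h t x hx).symm

theorem const {f : G → ℝ} (hf : PolyOn Γ N d f) : PolyFamily Γ N j d (fun _ => f) :=
  of_fwdDiff (fun _ => hf) (of_eq_zero fun t x _ => by simp [_root_.fwdDiff])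

theorem shift (hφ : PolyFamily Γ N j d φ) (s : ℤ) : PolyFamily Γ N j d (fun t => φ (t + s)) := by
  intro l
  induction l generalizing φ d with
  | zero => exact fun t => hφ 0 (t + s)
  | succ l ih =>
    intro t
    rw [Function.iterate_succ_apply]
    have : _root_.fwdDiff (1 : ℤ) (fun t => φ (t + s)) =
        fun t => (_root_.fwdDiff (1 : ℤ) φ) (t + s) := by
      ext t x; simp only [_root_.fwdDiff]; rw [add_right_comm]
    rw [this]
    exact (ih hφ.fwdDiff t).mono (le_of_eq (by push_cast; ring))

theorem shift_sub (hφ : PolyFamily Γ N j d φ) (s : ℤ) :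
    PolyFamily Γ N j (d - j) (fun t => φ (t + s) - φ t) := by
  induction s using Int.induction_on with
  | zero => exact of_eq_zero fun t x _ => by simp
  | succ n ih =>
    refine (ih.add (hφ.fwdDiff.shift n)).congr fun t x _ => ?_
    simp only [Pi.add_apply, Pi.sub_apply, _root_.fwdDiff, ← add_assoc]
    ring
  | pred n ih =>
    have h2 : PolyFamily Γ N j (d - j) (fun t => -_root_.fwdDiff (1 : ℤ) φ (t + (-n - 1))) := by
      intro l t
      have := (hφ.fwdDiff.shift (-n - 1) l t).smul (-1)
      rw [show (fun t => -_root_.fwdDiff (1 : ℤ) φ (t + (-n - 1))) =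
        (-1 : ℝ) • fun t => _root_.fwdDiff (1 : ℤ) φ (t + (-n - 1)) by ext; simp,
        fwdDiff_iter_const_smul]
      exact this
    refine (ih.add h2).congr fun t x _ => ?_
    simp only [Pi.add_apply, Pi.sub_apply, Pi.neg_apply, _root_.fwdDiff]
    rw [show t + (-(n : ℤ) - 1) + 1 = t + -n by ring]
    ring

variable {a : G} [N.Normal] (hΓ : ∀ k, (Γ k).Normal)
  (hcomm : ∀ k l, 1 ≤ k → 1 ≤ l → ∀ x ∈ Γ k, ∀ y ∈ Γ l, ⁅x, y⁆ ∈ Γ (k + l))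
  (hj : 1 ≤ j) (ha : a ∈ Γ j)

include hΓ hcomm hj ha in
-- Since `m * a ^ t = a ^ t * (a ^ (-t) * m * a ^ t)`, left translation by `m` on the coset `a ^ t
-- N` acts on the `N`-component through a conjugate that varies with `t`. Passing from `t` to `t +
-- 1` changes this conjugate by a conjugate of `⁅a⁻¹, m⁆`, which has weight `k + j`. The outer
-- induction is on the degree `d`; the inner one is on `d - k`, that is, upwards in the weight of
-- `m`.
theorem diff_conj (n : ℕ) : ∀ d : ℤ, d < n → ∀ (i : ℕ) (k : ℕ), 1 ≤ k → d - k < i →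
    ∀ m ∈ N, m ∈ Γ k → ∀ φ : ℤ → G → ℝ, PolyFamily Γ N j d φ →
      PolyFamily Γ N j (d - k) (fun t => leftDiff (a ^ (-t) * m * a ^ t) (φ t)) := by
  have hconj : ∀ {k : ℕ} {m : G}, m ∈ N → m ∈ Γ k → ∀ t : ℤ,
      a ^ (-t) * m * a ^ t ∈ N ∧ a ^ (-t) * m * a ^ t ∈ Γ k := by
    intro k m hm hmk t
    have h : a ^ (-t) * m * a ^ t = a ^ (-t) * m * (a ^ (-t))⁻¹ := by rw [← zpow_neg, neg_neg]
    rw [h]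
    exact ⟨(inferInstance : N.Normal).conj_mem m hm _, (hΓ k).conj_mem m hmk _⟩
  have hlow : ∀ (d : ℤ) (k : ℕ), 1 ≤ k → d - k < 0 → ∀ m ∈ N, m ∈ Γ k → ∀ φ : ℤ → G → ℝ,
      PolyFamily Γ N j d φ →
      PolyFamily Γ N j (d - k) (fun t => leftDiff (a ^ (-t) * m * a ^ t) (φ t)) := by
    intro d k hk hdk m hm hmk φ hφ
    exact of_eq_zero fun t =>
      ((hφ.apply t).diff hk (hconj hm hmk t).1 (hconj hm hmk t).2).eq_zero hdk
  induction n with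
  | zero => exact fun d hd i k hk _ => hlow d k hk (by push_cast at hd; omega)
  | succ n ih =>
    intro d hd i
    induction i with
    | zero => exact fun k hk hdk => hlow d k hk (by simpa using hdk)
    | succ i ih2 =>
      intro k hk hdk m hm hmk φ hφ
      have hm1 := hconj hm hmk 1
      set m' := a ^ (-1 : ℤ) * m * a ^ (1 : ℤ) with hm'
      set c := m' * m⁻¹ with hc
      have hcN : c ∈ N := N.mul_mem hm1.1 (N.inv_mem hm)
      have hcΓ : c ∈ Γ (k + j) := by
        have : c = ⁅a⁻¹, m⁆ := by simp [hc, hm', commutatorElement_def]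
        rw [this, add_comm]
        exact hcomm j k hj hk _ ((Γ j).inv_mem ha) _ hmk
      -- The forward difference of the conjugated family splits into three: the difference of
      -- `fwdDiff φ` along `m'`, the family belonging to the commutator `c`, and the difference of
      -- the latter along `m`. The first and third have smaller `d`; the second has the same `d` but
      -- larger weight.
      have hχ := ih2 (k + j) (by omega) (by push_cast at hdk ⊢; omega) c hcN hcΓ φ hφ
      have h1 := ih (d - j) (by push_cast at hd; omega) (d - j).toNat k hk (by omega) m' hm1.1
        hm1.2 _ hφ.fwdDiff
      have h2 := ih (d - (k + j : ℕ)) (by push_cast at hd ⊢; omega) (d - (k + j : ℕ)).toNat k hk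
        (by omega) m hm hmk _ hχ
      refine of_fwdDiff
        (fun t => (hφ.apply t).diff hk (hconj hm hmk t).1 (hconj hm hmk t).2) ?_
      refine (((h1.mono (by omega)).add (hχ.mono (by push_cast; omega))).add
        (h2.mono (e := d - k - j) (by push_cast; omega))).congr fun t x _ => ?_
      have e1 : a ^ (-(t + 1)) * m * a ^ (t + 1) = a ^ (-t) * m' * a ^ t := by
        rw [hm', neg_add_rev, zpow_add, zpow_add]
        group
      have e2 : a ^ (-t) * m' * a ^ t = a ^ (-t) * c * a ^ t * (a ^ (-t) * m * a ^ t) := by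
        rw [hc]; group
      simp only [Pi.add_apply, leftDiff, _root_.fwdDiff, Pi.sub_apply, e1]
      rw [e2]
      simp only [mul_assoc]
      ring

variable {M : Subgroup G} {τ : G → ℤ} (haM : a ∈ M)
  (hτ : ∀ g ∈ M, ∀ h ∈ M, τ (g * h) = τ g + τ h) (hτa : τ a = 1)
  (hker : ∀ g ∈ M, g ∈ N ↔ τ g = 0) (hjump : ∀ k, j < k → ∀ g ∈ M, g ∈ Γ k → g ∈ N)
  (hanti : Antitone Γ)

include haM hτ hτa in
theorem map_zpow_eq (s : ℤ) : τ (a ^ s) = s := by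
  have h1 : τ 1 = 0 := by
    have := hτ 1 M.one_mem 1 M.one_mem
    rw [mul_one] at this
    omega
  induction s using Int.induction_on with
  | zero => simpa using h1
  | succ n ih => rw [zpow_add_one, hτ _ (M.zpow_mem haM _) _ haM, ih, hτa]
  | pred n ih =>
    have h2 := hτ (a ^ (-(n : ℤ) - 1)) (M.zpow_mem haM _) a haM
    rw [← zpow_add_one, sub_add_cancel, ih, hτa] at h2
    omega

include hΓ hcomm hj ha haM hτ hτa hker hjump hanti in
-- Writing `h = a ^ s * m`, translation by `h` moves the exponent `t` to `t + s` and translates the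
-- `N`-component by `a ^ (-t) * m * a ^ t`. The difference is therefore a shift difference of the
-- family plus the term treated in `diff_conj`, and induction on the degree applies to their sum.
theorem polyOn (n : ℕ) : ∀ d : ℤ, d < n → ∀ φ : ℤ → G → ℝ, PolyFamily Γ N j d φ →
    PolyOn Γ M d (fun g => φ (τ g) (a ^ (-τ g) * g)) := by
  have hpow : ∀ s : ℤ, τ (a ^ s) = s := map_zpow_eq haM hτ hτa
  have hres : ∀ g ∈ M, a ^ (-τ g) * g ∈ N := fun g hg => by
    rw [hker _ (M.mul_mem (M.zpow_mem haM _) hg), hτ _ (M.zpow_mem haM _) _ hg, hpow]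
    omega
  induction n with
  | zero =>
    intro d hd φ hφ
    exact .neg (by simpa using hd) fun x hx =>
      (hφ.apply _).eq_zero (by simpa using hd) _ (hres x hx)
  | succ n ih =>
    intro d hd φ hφ
    by_cases h0 : d < 0
    · exact .neg h0 fun x hx => (hφ.apply _).eq_zero h0 _ (hres x hx)
    refine .step (by omega) fun k hk h hhM hhΓ => ?_
    set s := τ h with hs
    set m := a ^ (-s) * h with hm
    have hmN : m ∈ N := hres h hhM
    -- The shift lowers the degree by `j`, whereas `k` is needed. This suffices because elements of
    -- weight above `j` have exponent `s = 0`. The same observation puts `m` in `Γ k`.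
    have hsk : s ≠ 0 → k ≤ j := fun hs0 => by
      by_contra hlt
      exact hs0 ((hker h hhM).1 (hjump k (by omega) h hhM hhΓ))
    have hmΓ : m ∈ Γ k := by
      refine (Γ k).mul_mem ?_ hhΓ
      by_cases hs0 : s = 0
      · simp [hs0, (Γ k).one_mem]
      · exact (Γ k).zpow_mem (hanti (hsk hs0) ha) _
    have hφs := hφ.shift s
    have h1 := diff_conj hΓ hcomm hj ha (d.toNat + 1) d (by omega) (d - k).toNat.succ k hk
      (by omega) m hmN hmΓ _ hφs
    have h2 : PolyFamily Γ N j (d - k) (fun t => φ (t + s) - φ t) := by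
      by_cases hs0 : s = 0
      · exact of_eq_zero fun t x _ => by simp [hs0]
      · exact (hφ.shift_sub s).mono (by have := hsk hs0; omega)
    refine (ih (d - k) (by push_cast at hd; omega) _ (h2.add h1)).congr fun g hg => ?_
    have e1 : τ (h * g) = τ g + s := by rw [hτ h hhM g hg, add_comm]
    have e2 : a ^ (-(τ g + s)) * (h * g) = a ^ (-τ g) * m * a ^ τ g * (a ^ (-τ g) * g) := by
      rw [hm, neg_add, zpow_add]
      group
    simp only [Pi.add_apply, Pi.sub_apply, leftDiff, e1, e2]
    ring

end PolyFamily

/-- The extension is `a ^ t * n ↦ f n`, the function attached to a constant family. -/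
theorem PolyOn.exists_extend {a : G} [N.Normal] (hΓ : ∀ k, (Γ k).Normal)
    (hcomm : ∀ k l, 1 ≤ k → 1 ≤ l → ∀ x ∈ Γ k, ∀ y ∈ Γ l, ⁅x, y⁆ ∈ Γ (k + l))
    (hj : 1 ≤ j) (ha : a ∈ Γ j) {M : Subgroup G} {τ : G → ℤ} (hNM : N ≤ M) (haM : a ∈ M)
    (hτ : ∀ g ∈ M, ∀ h ∈ M, τ (g * h) = τ g + τ h) (hτa : τ a = 1)
    (hker : ∀ g ∈ M, g ∈ N ↔ τ g = 0) (hjump : ∀ k, j < k → ∀ g ∈ M, g ∈ Γ k → g ∈ N)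
    (hanti : Antitone Γ) {d : ℤ} {f : G → ℝ} (hf : PolyOn Γ N d f) :
    ∃ F : G → ℝ, PolyOn Γ M d F ∧ ∀ x ∈ N, F x = f x :=
  ⟨_, PolyFamily.polyOn hΓ hcomm hj ha haM hτ hτa hker hjump hanti (d.toNat + 1) d (by omega) _
    (PolyFamily.const hf), fun x hx => by simp [(hker x (hNM hx)).1 hx]⟩

end extension


/-! ### Adapted bases and their coordinate functions -/

/-- The adapted series as a filtration indexed from `1`. -/
def adaptedFiltration (π : Type*) [Group π] [Group.IsNilpotent π] (k : ℕ) : Subgroup π :=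
  adaptedSeries π (k - 1)

/-- Bases of the successive quotients of the adapted series, lifted to the group. -/
structure AdaptedBasis (π : Type*) [Group π] [Group.IsNilpotent π] where
  /-- The ranks of the successive quotients. -/
  rank : ℕ → ℕ
  /-- Isomorphisms with free abelian groups. -/
  equiv : ∀ j, AdaptedQuotient π j ≃* Multiplicative (Fin (rank j) → ℤ)
  /-- Lifts of the standard basis vectors. -/
  elt : ∀ j, Fin (rank j) → adaptedSeries π j
  equiv_elt : ∀ j i, equiv j (QuotientGroup.mk (elt j i)) = Multiplicative.ofAdd (Pi.single i 1)

theorem nonempty_adaptedBasis (π : Type*) [Group π] [Group.FG π] [Group.IsNilpotent π] :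
    Nonempty (AdaptedBasis π) := by
  choose r e using fun j => exists_adaptedQuotient_mulEquiv (π := π) j
  choose a ha using fun j (i : Fin (r j)) => QuotientGroup.mk_surjective
    ((e j).some.symm (Multiplicative.ofAdd (Pi.single i 1)))
  exact ⟨r, fun j => (e j).some, a, fun j i => by rw [ha]; simp⟩

section filtration

variable {π : Type*} [Group π] [Group.IsNilpotent π]

theorem adaptedFiltration_normal (k : ℕ) : (adaptedFiltration π k).Normal :=
  adaptedSeries_normal _ _

theorem adaptedFiltration_antitone : Antitone (adaptedFiltration π) :=
  fun _ _ h => adaptedSeries_antitone (by omega)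

theorem adaptedFiltration_one : adaptedFiltration π 1 = ⊤ := adaptedSeries_zero

theorem adaptedFiltration_commutator (k l : ℕ) (hk : 1 ≤ k) (hl : 1 ≤ l) :
    ∀ x ∈ adaptedFiltration π k, ∀ y ∈ adaptedFiltration π l,
      ⁅x, y⁆ ∈ adaptedFiltration π (k + l) := by
  intro x hx y hy
  have := commutator_mem_adaptedSeries hx hy
  rwa [show k - 1 + (l - 1) + 1 = k + l - 1 by omega] at this

/-- Polynomial functions of degree at most `d` with respect to the adapted filtration. -/
abbrev IsPoly (d : ℤ) (f : π → ℝ) : Prop := PolyOn (adaptedFiltration π) ⊤ d f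

theorem IsPoly.diff_adapted {d : ℤ} {f : π → ℝ} (hf : IsPoly d f) {j : ℕ} {h : π}
    (hh : h ∈ adaptedSeries π j) : IsPoly (d - (j + 1)) (leftDiff h f) := by
  have := PolyOn.diff hf (k := j + 1) (by omega) (Subgroup.mem_top h) hh
  exact_mod_cast this

theorem IsPoly.eq_zero {d : ℤ} {f : π → ℝ} (hf : IsPoly d f) (hd : d < 0) : f = 0 :=
  funext fun x => PolyOn.eq_zero hf hd x (Subgroup.mem_top x)

theorem IsPoly.apply_eq {f : π → ℝ} (hf : IsPoly 0 f) (g : π) : f g = f 1 := by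
  have h := (hf.diff_adapted (j := 0) (h := g) (adaptedSeries_zero (π := π) ▸ Subgroup.mem_top g))
  have := congrFun (h.eq_zero (by norm_num)) 1
  simp only [leftDiff, mul_one, Pi.zero_apply] at this
  linarith

theorem IsPoly.comp_hom {d : ℤ} {f : π → ℝ} (hf : IsPoly d f) (φ : π →* π) :
    IsPoly d (f ∘ φ) :=
  PolyOn.comp_hom hf φ (fun _ _ => Subgroup.mem_top _) fun k _ hx =>
    map_mem_adaptedSeries φ (k - 1) hx

end filtration

namespace AdaptedBasis

variable {π : Type*} [Group π] [Group.IsNilpotent π] (B : AdaptedBasis π)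

open Classical in
/-- The integer coordinates of the class of an element of `adaptedSeries π j`. -/
noncomputable def coord (j : ℕ) (g : π) : Fin (B.rank j) → ℤ :=
  if h : g ∈ adaptedSeries π j then (B.equiv j (QuotientGroup.mk ⟨g, h⟩)).toAdd else 0

variable {B} {j : ℕ} {g h : π}

theorem coord_of_mem (hg : g ∈ adaptedSeries π j) :
    B.coord j g = (B.equiv j (QuotientGroup.mk ⟨g, hg⟩)).toAdd := dif_pos hg

theorem coord_mul (hg : g ∈ adaptedSeries π j) (hh : h ∈ adaptedSeries π j) :
    B.coord j (g * h) = B.coord j g + B.coord j h := by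
  rw [coord_of_mem hg, coord_of_mem hh, coord_of_mem (mul_mem hg hh), ← toAdd_mul, ← map_mul]
  rfl

theorem coord_elt (i : Fin (B.rank j)) : B.coord j (B.elt j i) = Pi.single i 1 := by
  rw [coord_of_mem (B.elt j i).2]
  exact congrArg Multiplicative.toAdd (B.equiv_elt j i)

theorem coord_eq_zero_iff (hg : g ∈ adaptedSeries π j) :
    B.coord j g = 0 ↔ g ∈ adaptedSeries π (j + 1) := by
  rw [coord_of_mem hg, ← Subgroup.mem_subgroupOf (h := ⟨g, hg⟩) (H := adaptedSeries π (j + 1)),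
    ← QuotientGroup.eq_one_iff, ← (B.equiv j).map_eq_one_iff]
  rfl

theorem coord_eq_zero (hg : g ∈ adaptedSeries π (j + 1)) : B.coord j g = 0 :=
  (coord_eq_zero_iff (adaptedSeries_antitone (by omega) hg)).2 hg

theorem coord_one : B.coord j 1 = 0 := coord_eq_zero (one_mem _)

theorem coord_inv (hg : g ∈ adaptedSeries π j) : B.coord j g⁻¹ = -B.coord j g := by
  have := coord_mul (B := B) (inv_mem hg) hg
  rw [inv_mul_cancel, coord_one] at this
  exact eq_neg_of_add_eq_zero_left this.symm

theorem coord_zpow (hg : g ∈ adaptedSeries π j) (s : ℤ) :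
    B.coord j (g ^ s) = s • B.coord j g := by
  induction s using Int.induction_on with
  | zero => simp [coord_one]
  | succ n ih => rw [zpow_add_one, coord_mul (zpow_mem hg _) hg, ih, add_smul, one_smul]
  | pred n ih =>
    rw [zpow_sub_one, coord_mul (zpow_mem hg _) (inv_mem hg), ih, coord_inv hg, sub_smul, one_smul,
      sub_eq_add_neg]

theorem le_of_elt_mem {H : Subgroup π} (h1 : adaptedSeries π (j + 1) ≤ H)
    (h2 : ∀ i, (B.elt j i : π) ∈ H) : adaptedSeries π j ≤ H := by
  have key : ∀ s : Finset (Fin (B.rank j)), ∀ x ∈ adaptedSeries π j,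
      (∀ l ∉ s, B.coord j x l = 0) → x ∈ H := by
    intro s
    induction s using Finset.induction_on with
    | empty =>
      intro x hx h
      exact h1 ((coord_eq_zero_iff (B := B) hx).1 (funext fun l => h l (by simp)))
    | insert i s hi ih =>
      intro x hx h
      have hpow := zpow_mem (B.elt j i).2 (-B.coord j x i)
      have := ih ((B.elt j i : π) ^ (-B.coord j x i) * x) (mul_mem hpow hx) fun l hl => by
        rw [coord_mul hpow hx, coord_zpow (B.elt j i).2, coord_elt]
        by_cases hli : l = i
        · simp [hli]
        · simp [hli, h l (by simp [hl, hli])]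
      simpa using H.mul_mem (H.zpow_mem (h2 i) (B.coord j x i)) this
  exact fun x hx => key Finset.univ x hx (by simp)

/-- The subgroups interpolating between `adaptedSeries π j` and `adaptedSeries π (j + 1)`. -/
def interpolation (B : AdaptedBasis π) (j i : ℕ) : Subgroup π where
  carrier := {x | x ∈ adaptedSeries π j ∧ ∀ l : Fin (B.rank j), (l : ℕ) < i → B.coord j x l = 0}
  one_mem' := ⟨one_mem _, by simp [coord_one]⟩
  mul_mem' {x y} hx hy := ⟨mul_mem hx.1 hy.1, fun l hl => by
    rw [coord_mul hx.1 hy.1, Pi.add_apply, hx.2 l hl, hy.2 l hl, add_zero]⟩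
  inv_mem' {x} hx := ⟨inv_mem hx.1, fun l hl => by
    rw [coord_inv hx.1, Pi.neg_apply, hx.2 l hl, neg_zero]⟩

theorem adaptedSeries_le_interpolation (i : ℕ) : adaptedSeries π (j + 1) ≤ B.interpolation j i :=
  fun x hx => ⟨adaptedSeries_antitone (by omega) hx, by simp [coord_eq_zero hx]⟩

instance interpolation_normal (i : ℕ) : (B.interpolation j i).Normal where
  conj_mem x hx g := by
    have : g * x * g⁻¹ = ⁅g, x⁆ * x := by simp [commutatorElement_def]
    rw [this]
    refine mul_mem (adaptedSeries_le_interpolation i ?_) hx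
    have := commutator_mem_adaptedSeries (i := 0) (x := g)
      (adaptedSeries_zero (π := π) ▸ Subgroup.mem_top g) hx.1
    rwa [zero_add] at this

theorem interpolation_zero : B.interpolation j 0 = adaptedSeries π j :=
  le_antisymm (fun _ hx => hx.1) fun _ hx => ⟨hx, by simp⟩

theorem interpolation_rank : B.interpolation j (B.rank j) = adaptedSeries π (j + 1) :=
  le_antisymm (fun _ hx => (coord_eq_zero_iff (B := B) hx.1).1 (funext fun l => hx.2 l l.2))
    (adaptedSeries_le_interpolation _)

/-- Consecutive interpolating subgroups differ by an infinite cyclic quotient: the `i`-th coordinate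
is the projection and the `i`-th basis lift is a generator, of weight `j + 1` in the filtration
indexed from `1`. -/
theorem exists_extend_interpolation (B : AdaptedBasis π) {d : ℤ} {f : π → ℝ} {i : ℕ}
    (hi : i < B.rank j) (hf : PolyOn (adaptedFiltration π) (B.interpolation j (i + 1)) d f) :
    ∃ F, PolyOn (adaptedFiltration π) (B.interpolation j i) d F ∧
      ∀ x ∈ B.interpolation j (i + 1), F x = f x := by
  refine PolyOn.exists_extend (N := B.interpolation j (i + 1)) (M := B.interpolation j i)
    (j := j + 1) (a := (B.elt j ⟨i, hi⟩ : π)) (τ := fun g => B.coord j g ⟨i, hi⟩)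
    adaptedFiltration_normal adaptedFiltration_commutator (by omega) (B.elt j ⟨i, hi⟩).2
    (fun x hx => ⟨hx.1, fun l hl => hx.2 l (by omega)⟩)
    ⟨(B.elt j ⟨i, hi⟩).2, fun l hl => ?_⟩ (fun g hg h hh => ?_) ?_ (fun g hg => ?_) ?_
    adaptedFiltration_antitone hf
  · rw [coord_elt, Pi.single_eq_of_ne]
    intro h
    rw [h] at hl
    exact lt_irrefl _ hl
  · rw [coord_mul hg.1 hh.1, Pi.add_apply]
  · simp [coord_elt]
  · refine ⟨fun h => h.2 _ (Nat.lt_succ_self i), fun h => ⟨hg.1, fun l hl => ?_⟩⟩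
    rcases Nat.lt_succ_iff_lt_or_eq.1 hl with h1 | h1
    · exact hg.2 l h1
    · rw [← h]
      congr 1
      exact Fin.ext h1
  · intro k hk g _ hgk
    exact adaptedSeries_le_interpolation _ (adaptedSeries_antitone (by omega) hgk)

theorem exists_extend_adaptedSeries (B : AdaptedBasis π) {d : ℤ} {f : π → ℝ} :
    ∀ j, PolyOn (adaptedFiltration π) (adaptedSeries π j) d f →
      ∃ F, IsPoly d F ∧ ∀ x ∈ adaptedSeries π j, F x = f x := by
  intro j
  induction j generalizing f with
  | zero =>
    intro hf
    rw [adaptedSeries_zero] at hf ⊢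
    exact ⟨f, hf, fun _ _ => rfl⟩
  | succ j ih =>
    intro hf
    have key : ∀ n ≤ B.rank j, ∃ F,
        PolyOn (adaptedFiltration π) (B.interpolation j (B.rank j - n)) d F ∧
        ∀ x ∈ adaptedSeries π (j + 1), F x = f x := by
      intro n
      induction n with
      | zero => exact fun _ => ⟨f, by rwa [Nat.sub_zero, interpolation_rank], fun _ _ => rfl⟩
      | succ n ihn =>
        intro hn
        obtain ⟨F, hF, hFf⟩ := ihn (by omega)
        rw [show B.rank j - n = B.rank j - (n + 1) + 1 by omega] at hF
        obtain ⟨F', hF', hFF'⟩ := B.exists_extend_interpolation (by omega) hF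
        exact ⟨F', hF', fun x hx => by
          rw [hFF' x (adaptedSeries_le_interpolation _ hx), hFf x hx]⟩
    obtain ⟨F, hF, hFf⟩ := key (B.rank j) le_rfl
    rw [Nat.sub_self, interpolation_zero] at hF
    obtain ⟨F', hF', hFF'⟩ := ih hF
    exact ⟨F', hF', fun x hx => by
      rw [hFF' x (adaptedSeries_antitone (by omega) hx), hFf x hx]⟩

/-- On `adaptedSeries π j` a coordinate is a homomorphism, so its differences are constants, and
they vanish for elements of weight above `j + 1`. -/
theorem polyOn_coord (B : AdaptedBasis π) (j : ℕ) (i : Fin (B.rank j)) :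
    PolyOn (adaptedFiltration π) (adaptedSeries π j) (j + 1) (fun g => (B.coord j g i : ℝ)) := by
  refine .step (by positivity) fun k hk h hh hhk => ?_
  by_cases hkj : k ≤ j + 1
  · refine ((PolyOn.const (B.coord j h i : ℝ)).mono (by omega)).congr fun x hx => ?_
    simp [leftDiff, coord_mul hh hx]
  · refine .of_eq_zero fun x hx => ?_
    simp [leftDiff, coord_mul hh hx,
      coord_eq_zero (adaptedSeries_antitone (show j + 1 ≤ k - 1 by omega) hhk)]

theorem exists_coordFun (B : AdaptedBasis π) (j : ℕ) (i : Fin (B.rank j)) :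
    ∃ F : π → ℝ, IsPoly (j + 1) F ∧ ∀ x ∈ adaptedSeries π j, F x = B.coord j x i :=
  B.exists_extend_adaptedSeries j (B.polyOn_coord j i)

/-- A polynomial function of degree at most `j + 1` on `π` that extends the `i`-th coordinate
function of `adaptedSeries π j`. -/
noncomputable def coordFun (B : AdaptedBasis π) (j : ℕ) (i : Fin (B.rank j)) : π → ℝ :=
  (B.exists_coordFun j i).choose

theorem isPoly_coordFun (B : AdaptedBasis π) (j : ℕ) (i : Fin (B.rank j)) :
    IsPoly (j + 1) (B.coordFun j i) :=
  (B.exists_coordFun j i).choose_spec.1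

theorem coordFun_of_mem (i : Fin (B.rank j)) (hg : g ∈ adaptedSeries π j) :
    B.coordFun j i g = B.coord j g i :=
  (B.exists_coordFun j i).choose_spec.2 g hg

/-- The difference along `g` has degree at most `(j + 1) - (j + 1) = 0`, so it is constant and can
be computed at the identity. -/
theorem coordFun_mul (i : Fin (B.rank j)) (hg : g ∈ adaptedSeries π j) (h : π) :
    B.coordFun j i (g * h) = B.coord j g i + B.coordFun j i h := by
  have h1 := ((B.isPoly_coordFun j i).diff_adapted hg).mono
    (show (j : ℤ) + 1 - (j + 1) ≤ 0 by omega)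
  have h2 := IsPoly.apply_eq h1 h
  simp only [leftDiff, mul_one] at h2
  rw [coordFun_of_mem i hg, coordFun_of_mem i (one_mem _), coord_one] at h2
  simp only [Pi.zero_apply, Int.cast_zero, sub_zero] at h2
  linarith

end AdaptedBasis

/-! ### Polynomial functions are generated by the coordinate functions -/

/-- A multiplicative filtration of the algebra of real functions by subspaces. -/
structure IsFiltration {X : Type*} (F : ℕ → Submodule ℝ (X → ℝ)) : Prop where
  mono : Monotone F
  one_mem : 1 ∈ F 0
  mul_mem : ∀ {a b f g}, f ∈ F a → g ∈ F b → f * g ∈ F (a + b)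

theorem ringChoose_succ_mul (s : ℝ) (l : ℕ) :
    ((l : ℝ) + 1) * Ring.choose s (l + 1) = Ring.choose s l * (s - l) := by
  have := Ring.choose_smul_choose s (Nat.le_succ l)
  simpa using this

theorem IsFiltration.choose_mem {X : Type*} {F : ℕ → Submodule ℝ (X → ℝ)} (hF : IsFiltration F)
    {t : X → ℝ} {k : ℕ} (ht : t ∈ F k) (l : ℕ) : (fun g => Ring.choose (-t g) l) ∈ F (l * k) := by
  induction l with
  | zero =>
    simp only [Ring.choose_zero_right, zero_mul]
    exact hF.one_mem
  | succ l ih =>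
    have h1 : (fun g => Ring.choose (-t g) (l + 1)) =
        (-((l : ℝ) + 1)⁻¹) • ((fun g => Ring.choose (-t g) l) * (t + (l : ℝ) • 1)) := by
      ext g
      have h2 := ringChoose_succ_mul (-t g) l
      have h3 : ((l : ℝ) + 1) ≠ 0 := by positivity
      simp only [Pi.smul_apply, Pi.mul_apply, Pi.add_apply, Pi.one_apply, smul_eq_mul, mul_one]
      field_simp
      linear_combination h2
    rw [h1, add_mul, one_mul]
    exact (F _).smul_mem _ (hF.mul_mem ih ((F _).add_mem ht
      ((F _).smul_mem _ (hF.mono (Nat.zero_le k) hF.one_mem))))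

section generation

variable {π : Type*} [Group π] [Group.IsNilpotent π]

theorem isFiltration_isPoly : IsFiltration (X := π) fun d =>
    { carrier := {f | IsPoly d f}
      zero_mem' := PolyOn.zero _
      add_mem' := PolyOn.add
      smul_mem' := fun c _ h => PolyOn.smul c h } where
  mono _ _ h _ hf := PolyOn.mono hf (by exact_mod_cast h)
  one_mem := PolyOn.const 1
  mul_mem hf hg := (PolyOn.mul hf hg).mono (by push_cast; rfl)

theorem IsPoly.choose_neg {t : π → ℝ} {k : ℕ} (ht : IsPoly k t) (l : ℕ) :
    IsPoly ((l * k : ℕ) : ℤ) (fun g => Ring.choose (-t g) l) :=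
  isFiltration_isPoly.choose_mem (t := t) (k := k) ht l

theorem IsPoly.iterate_leftDiff {d : ℤ} {f : π → ℝ} (hf : IsPoly d f) {j : ℕ} {a : π}
    (ha : a ∈ adaptedSeries π j) (l : ℕ) : IsPoly (d - l * (j + 1)) ((leftDiff a)^[l] f) := by
  induction l generalizing f d with
  | zero => simpa using hf
  | succ l ih =>
    rw [Function.iterate_succ_apply]
    exact (ih (hf.diff_adapted ha)).mono (le_of_eq (by push_cast; ring))

/-- Taking differences preserves invariance under elements of `adaptedSeries π j`, modulo
`adaptedSeries π (j + 1)`. -/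
theorem iterate_leftDiff_invariant {f : π → ℝ} {j : ℕ} {a x : π} (ha : a ∈ adaptedSeries π j)
    (hx : x ∈ adaptedSeries π j) (h1 : ∀ y ∈ adaptedSeries π (j + 1), ∀ g, f (y * g) = f g)
    (h2 : ∀ g, f (x * g) = f g) (l : ℕ) (g : π) :
    (leftDiff a)^[l] f (x * g) = (leftDiff a)^[l] f g := by
  have key : ∀ x ∈ adaptedSeries π j, ∀ f : π → ℝ,
      (∀ y ∈ adaptedSeries π (j + 1), ∀ g, f (y * g) = f g) → (∀ g, f (x * g) = f g) →
      ∀ g, leftDiff a f (x * g) = leftDiff a f g := by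
    intro x hx f h1 h2 g
    have h3 : a * (x * g) = ⁅a, x⁆ * (x * (a * g)) := by
      rw [commutatorElement_def]; group
    simp only [leftDiff]
    rw [h2, h3, h1 _ (adaptedSeries_antitone (by omega) (commutator_mem_adaptedSeries ha hx)), h2]
  induction l generalizing f with
  | zero => exact h2 g
  | succ l ih =>
    rw [Function.iterate_succ_apply]
    exact ih (fun y hy => key y (adaptedSeries_antitone (by omega) hy) f h1 (h1 y hy))
      (key x hx f h1 h2)

theorem mul_left_invariant_of_mem_closure {π : Type*} [Group π] {f : π → ℝ} (H : Set π)
    (hH : ∀ x ∈ H, ∀ g, f (x * g) = f g)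
    {x : π} (hx : x ∈ Subgroup.closure H) (g : π) : f (x * g) = f g := by
  induction hx using Subgroup.closure_induction generalizing g with
  | mem x hx => exact hH x hx g
  | one => rw [one_mul]
  | mul x y _ _ hx hy => rw [mul_assoc, hx, hy]
  | inv x _ hx => rw [← hx (x⁻¹ * g), mul_inv_cancel_left]

variable (B : AdaptedBasis π)

open AdaptedBasis in
/-- A polynomial function of degree at most `d` that is invariant under `adaptedSeries π j` is a
polynomial of weighted degree at most `d` in the coordinate functions of index less than `j`. -/
theorem IsPoly.mem_filtration {F : ℕ → Submodule ℝ (π → ℝ)} (hF : IsFiltration F) :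
    ∀ j, (∀ k < j, ∀ i, B.coordFun k i ∈ F (k + 1)) → ∀ (d : ℕ) (f : π → ℝ), IsPoly d f →
      (∀ x ∈ adaptedSeries π j, ∀ g, f (x * g) = f g) → f ∈ F d := by
  intro j
  induction j with
  | zero =>
    intro _ d f _ hinv
    have : f = f 1 • 1 := by
      ext g
      have := hinv g (adaptedSeries_zero (π := π) ▸ Subgroup.mem_top g) 1
      rw [mul_one] at this
      simp [this]
    rw [this]
    exact (F d).smul_mem _ (hF.mono (Nat.zero_le d) hF.one_mem)
  | succ j ihj =>
    intro hT d
    induction d using Nat.strong_induction_on with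
    | _ d ihd =>
    -- The set `s` contains the basis lifts under which invariance is not yet known; they are
    -- removed one at a time until the induction hypothesis on `j` applies.
    have key : ∀ (s : Finset (Fin (B.rank j))) (f : π → ℝ), IsPoly d f →
        (∀ x ∈ adaptedSeries π (j + 1), ∀ g, f (x * g) = f g) →
        (∀ l ∉ s, ∀ g, f (B.elt j l * g) = f g) → f ∈ F d := by
      intro s
      induction s using Finset.induction_on with
      | empty =>
        intro f hf hinv helt
        refine ihj (fun k hk => hT k (by omega)) d f hf fun x hx g => ?_
        have hle : adaptedSeries π j ≤ Subgroup.closure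
            ((adaptedSeries π (j + 1) : Set π) ∪ Set.range fun l => (B.elt j l : π)) :=
          le_of_elt_mem (B := B) (fun y hy => Subgroup.subset_closure (Or.inl hy))
            (fun i => Subgroup.subset_closure (Or.inr ⟨i, rfl⟩))
        refine mul_left_invariant_of_mem_closure _ ?_ (hle hx) g
        rintro x (hx | ⟨l, rfl⟩)
        · exact hinv x hx
        · exact helt l (by simp)
      | insert i s hi ihs =>
        intro f hf hinv helt
        obtain ⟨a, ha⟩ : ∃ a : π, a = B.elt j i := ⟨_, rfl⟩
        have haj : a ∈ adaptedSeries π j := ha ▸ (B.elt j i).2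
        obtain ⟨t, ht⟩ : ∃ t, t = B.coordFun j i := ⟨_, rfl⟩
        have htp : IsPoly ((j + 1 : ℕ) : ℤ) t := ht ▸ B.isPoly_coordFun j i
        have htF : t ∈ F (j + 1) := ht ▸ hT j (by omega) i
        obtain ⟨D, hD⟩ : ∃ D : ℕ → π → ℝ, D = fun l => (leftDiff a)^[l] f := ⟨_, rfl⟩
        have hDp : ∀ l : ℕ, IsPoly (d - l * (j + 1)) (D l) := fun l => by
          rw [hD]; exact hf.iterate_leftDiff haj l
        -- Each difference along `a` lowers the degree by `j + 1 ≥ 1`, so the Newton series of `f`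
        -- along `a` stops at order `d`.
        have hD0 : D (d + 1) = 0 := (hDp (d + 1)).eq_zero (by push_cast; nlinarith)
        have hDs : ∀ l g, D l (a * g) = D l g + D (l + 1) g := fun l g => by
          simp only [hD, Function.iterate_succ_apply', leftDiff]
          ring
        obtain ⟨b, hb⟩ : ∃ b : ℕ → π → ℝ, b = fun l g => Ring.choose (-t g) l := ⟨_, rfl⟩
        -- By Newton's formula `f'` is formally `g ↦ f (a ^ (-t g) * g)`, which is invariant under
        -- `a` because `t (a * g) = t g + 1`. The term `l = 0` is `f`; the others involve the
        -- differences `D l`, whose degree is smaller than `d`.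
        obtain ⟨f', hf'⟩ : ∃ f' : π → ℝ, f' = ∑ l ∈ Finset.range (d + 1), b l * D l := ⟨_, rfl⟩
        have hDinv : ∀ l, ∀ x ∈ adaptedSeries π (j + 1), ∀ g, D l (x * g) = D l g :=
          fun l x hx => hD ▸ iterate_leftDiff_invariant haj (adaptedSeries_antitone (by omega) hx)
            hinv (hinv x hx) l
        have hsplit : f = f' - ∑ l ∈ Finset.range d, b (l + 1) * D (l + 1) := by
          rw [hf', Finset.sum_range_succ']
          ext g
          simp [hb, hD]
        have hf'p : IsPoly d f' := by
          rw [hf', hb]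
          exact PolyOn.sum _ _ fun l _ =>
            ((htp.choose_neg l).mul (hDp l)).mono (by push_cast; linarith)
        rw [hsplit]
        refine (F d).sub_mem (ihs f' hf'p ?_ ?_) ((F d).sum_mem fun l _ => ?_)
        · intro x hx g
          have : t (x * g) = t g := by
            rw [ht, coordFun_mul i (adaptedSeries_antitone (by omega) hx), coord_eq_zero hx]
            simp
          simp only [hf', Finset.sum_apply, Pi.mul_apply, hb, hDinv _ x hx, this]
        · intro l hl g
          by_cases hli : l = i
          · subst hli
            rw [← ha]
            have h1 : t (a * g) = t g + 1 := by
              rw [ht, coordFun_mul _ haj, ha, coord_elt]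
              simp [add_comm]
            -- Pascal's rule, together with `D (d + 1) = 0`, makes the two Newton sums equal.
            have h2 : ∀ l, Ring.choose (-t g) (l + 1) =
                Ring.choose (-t (a * g)) l + Ring.choose (-t (a * g)) (l + 1) := fun l => by
              rw [← Ring.choose_succ_succ, h1]
              congr 1
              ring
            simp only [hf', Finset.sum_apply, Pi.mul_apply, hb, hDs, mul_add,
              Finset.sum_add_distrib]
            rw [Finset.sum_range_succ' (fun l => Ring.choose (-t g) l * D l g),
              Finset.sum_range_succ' (fun l => Ring.choose (-t (a * g)) l * D l g),
              Finset.sum_range_succ (fun l => Ring.choose (-t (a * g)) l * D (l + 1) g), hD0]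
            simp only [h2, add_mul, Finset.sum_add_distrib, Ring.choose_zero_right, Pi.zero_apply]
            ring
          · have h1 : t (B.elt j l * g) = t g := by
              rw [ht, coordFun_mul _ (B.elt j l).2, coord_elt, Pi.single_eq_of_ne (Ne.symm hli)]
              simp
            have h2 : ∀ m, D m (B.elt j l * g) = D m g := fun m =>
              hD ▸ iterate_leftDiff_invariant haj (B.elt j l).2 hinv
                (helt l (by simp [hl, hli])) m g
            simp only [hf', Finset.sum_apply, Pi.mul_apply, hb, h1, h2]
        -- In the correction terms, `D (l + 1)` falls under the induction on the degree, unless its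
        -- degree is negative and it vanishes.
        · by_cases hld : (l + 1) * (j + 1) ≤ d
          · have h1 := ihd (d - (l + 1) * (j + 1)) (by
              have : 0 < (l + 1) * (j + 1) := by positivity
              omega) (D (l + 1)) ((hDp (l + 1)).mono (by push_cast [Nat.cast_sub hld]; rfl))
              (hDinv _)
            have h2 := hF.mul_mem (hF.choose_mem htF (l + 1)) h1
            rw [Nat.add_sub_cancel' hld] at h2
            rw [hb]
            exact h2
          · have : D (l + 1) = 0 := (hDp (l + 1)).eq_zero (by
              push Not at hld
              have : ((d : ℕ) : ℤ) < ((l + 1) * (j + 1) : ℕ) := by exact_mod_cast hld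
              push_cast at this ⊢
              omega)
            rw [this, mul_zero]
            exact (F d).zero_mem
    exact fun f hf hinv => key Finset.univ f hf hinv (by simp)

theorem IsPoly.mem_filtration_of_torsionFree (htf : ∀ g : π, IsOfFinOrder g → g = 1)
    {F : ℕ → Submodule ℝ (π → ℝ)} (hF : IsFiltration F)
    (hT : ∀ k < Group.nilpotencyClass π, ∀ i, B.coordFun k i ∈ F (k + 1)) {d : ℕ} {f : π → ℝ}
    (hf : IsPoly d f) : f ∈ F d := by
  refine hf.mem_filtration B hF _ hT d f fun x hx g => ?_
  rw [adaptedSeries_nilpotencyClass htf, Subgroup.mem_bot] at hx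
  rw [hx, one_mul]

end generation


/-! ### Functions on a group as functionals on its group algebra -/

section functionals

variable {G H : Type*} [Group G] [Group H]

/-- The linear functional on the group algebra that extends a function on the group. -/
noncomputable def linExt (f : G → ℝ) : MonoidAlgebra ℝ G →ₗ[ℝ] ℝ where
  toFun x := Finsupp.linearCombination ℝ f x.coeff
  map_add' x y := by simp
  map_smul' r x := by simp

theorem linExt_of (f : G → ℝ) (g : G) : linExt f (MonoidAlgebra.of ℝ G g) = f g := by
  simp [linExt]

theorem linearMap_ext_of {V : Type*} [AddCommGroup V] [Module ℝ V]
    {F F' : MonoidAlgebra ℝ G →ₗ[ℝ] V}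
    (h : ∀ g, F (MonoidAlgebra.of ℝ G g) = F' (MonoidAlgebra.of ℝ G g)) : F = F' := by
  ext x
  simpa using h x

theorem linExt_add (f g : G → ℝ) : linExt (f + g) = linExt f + linExt g :=
  linearMap_ext_of fun x => by simp only [linExt_of, LinearMap.add_apply, Pi.add_apply]

theorem linExt_smul (c : ℝ) (f : G → ℝ) : linExt (c • f) = c • linExt f :=
  linearMap_ext_of fun x => by simp only [linExt_of, LinearMap.smul_apply, Pi.smul_apply]

theorem linExt_one (x : MonoidAlgebra ℝ G) : linExt 1 x = augmentation G x := by
  have : linExt (1 : G → ℝ) = (augmentation G).toLinearMap :=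
    linearMap_ext_of fun x => by rw [linExt_of]; simp [augmentation]
  rw [this]
  rfl

theorem linExt_comp (φ : G →* H) (f : H → ℝ) (x : MonoidAlgebra ℝ G) :
    linExt (f ∘ φ) x = linExt f (MonoidAlgebra.mapDomainAlgHom ℝ ℝ φ x) := by
  have : linExt (f ∘ φ) = (linExt f).comp (MonoidAlgebra.mapDomainAlgHom ℝ ℝ φ).toLinearMap :=
    linearMap_ext_of fun x => by
      rw [linExt_of]
      have := linExt_of f (φ x)
      simpa using this.symm
  rw [this]
  rfl

theorem linExt_leftDiff (h : G) (f : G → ℝ) (x : MonoidAlgebra ℝ G) :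
    linExt (leftDiff h f) x = linExt f ((MonoidAlgebra.of ℝ G h - 1) * x) := by
  have : linExt (leftDiff h f) =
      (linExt f).comp (LinearMap.mulLeft ℝ (MonoidAlgebra.of ℝ G h - 1)) :=
    linearMap_ext_of fun x => by
      rw [LinearMap.comp_apply, LinearMap.mulLeft_apply, sub_mul, one_mul, ← map_mul, map_sub,
        linExt_of, linExt_of, linExt_of]
      rfl
  rw [this]
  rfl

/-- A function on `G` annihilates the `n`-th power of the augmentation ideal. -/
def Kills (n : ℕ) (f : G → ℝ) : Prop := ∀ x ∈ augIdeal G ^ n, linExt f x = 0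

theorem Kills.mono {m n : ℕ} {f : G → ℝ} (hf : Kills m f) (h : m ≤ n) : Kills n f :=
  fun x hx => hf x (Ideal.pow_le_pow_right h hx)

theorem of_sub_one_mem (h : G) : MonoidAlgebra.of ℝ G h - 1 ∈ augIdeal G := by
  change augmentation G _ = 0
  simp [augmentation]

/-- Taking the difference along `h` is dual to multiplication by `h - 1`, and `I ^ (n + 1) = I * I ^
n`. This identifies annihilation of powers of `I` with a condition on iterated differences. -/
theorem kills_succ_iff {n : ℕ} {f : G → ℝ} : Kills (n + 1) f ↔ ∀ h, Kills n (leftDiff h f) := by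
  constructor
  · intro hf h x hx
    rw [linExt_leftDiff]
    refine hf _ ?_
    rw [Ideal.IsTwoSided.pow_succ]
    exact Ideal.mul_mem_mul (of_sub_one_mem h) hx
  · intro hf x hx
    rw [Ideal.IsTwoSided.pow_succ] at hx
    refine Submodule.smul_induction_on hx (fun r hr s hs => ?_) fun x y hx hy => by
      rw [map_add, hx, hy, add_zero]
    -- Since the differences kill `s`, multiplying `s` by a group element does not change the
    -- functional; so any `r` acts through its augmentation.
    have key : ∀ r : MonoidAlgebra ℝ G, linExt f (r * s) = augmentation G r * linExt f s := by
      intro r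
      induction r using MonoidAlgebra.induction_on with
      | of g =>
        have h1 := hf g s hs
        rw [linExt_leftDiff, sub_mul, one_mul, map_sub, sub_eq_zero] at h1
        have h2 : augmentation G (MonoidAlgebra.of ℝ G g) = 1 := by simp [augmentation]
        rw [h1, h2, one_mul]
      | add a b ha hb => rw [add_mul, map_add, ha, hb, map_add, add_mul]
      | smul c a ha => rw [smul_mul_assoc, map_smul, ha, map_smul, smul_eq_mul, smul_eq_mul,
          mul_assoc]
    rw [smul_eq_mul, key]
    have : augmentation G r = 0 := hr
    rw [this, zero_mul]

theorem kills_zero_iff {f : G → ℝ} : Kills 0 f ↔ f = 0 := by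
  refine ⟨fun h => funext fun g => ?_, ?_⟩
  · rw [← linExt_of f]
    exact h _ (by simp [Submodule.pow_zero])
  · rintro rfl x _
    have : linExt (0 : G → ℝ) = 0 := linearMap_ext_of fun g => by rw [linExt_of]; rfl
    rw [this]
    rfl

theorem PolyOn.kills {Γ : ℕ → Subgroup G} (hΓ : Γ 1 = ⊤) {n : ℕ} : ∀ {d : ℤ} {f : G → ℝ},
    PolyOn Γ ⊤ d f → d < n → Kills n f := by
  induction n with
  | zero =>
    intro d f hf hd
    exact kills_zero_iff.2 (funext fun x => hf.eq_zero (by simpa using hd) x (Subgroup.mem_top x))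
  | succ n ih =>
    intro d f hf hd
    exact kills_succ_iff.2 fun h => ih (hf.diff le_rfl (Subgroup.mem_top h)
      (hΓ ▸ Subgroup.mem_top h)) (by push_cast at hd ⊢; omega)

/-- A difference lowers `n` by one, hence `c * n` by `c`, which is enough for every nontrivial
weight `k ≤ c`. -/
theorem Kills.polyOn {Γ : ℕ → Subgroup G} {c : ℕ} (hΓ : ∀ k, c < k → Γ k = ⊥) {n : ℕ} :
    ∀ {f : G → ℝ}, Kills n f → PolyOn Γ ⊤ (c * n : ℕ) f := by
  induction n with
  | zero =>
    intro f hf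
    rw [kills_zero_iff.1 hf]
    exact PolyOn.zero _
  | succ n ih =>
    intro f hf
    refine .step (by positivity) fun k hk h _ hhk => ?_
    by_cases hkc : k ≤ c
    · exact (ih (kills_succ_iff.1 hf h)).mono
        (by push_cast; linarith [(Nat.cast_le (α := ℤ)).2 hkc])
    · rw [hΓ k (by omega), Subgroup.mem_bot] at hhk
      exact .of_eq_zero fun x _ => by simp [hhk, leftDiff]

theorem Kills.comp_hom {n : ℕ} {f : H → ℝ} (hf : Kills n f) (φ : G →* H) : Kills n (f ∘ φ) :=
  fun x hx => by
    rw [linExt_comp]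
    exact hf _ (augIdeal_pow_le_comap φ n hx)

/-- For the filtration concentrated in weight `1`, annihilation of `I ^ n` and degree are comparable
up to a shift by one, and degrees add under products. -/
theorem Kills.mul {m n : ℕ} {f g : G → ℝ} (hf : Kills m f) (hg : Kills n g) :
    Kills (m + n + 1) (f * g) := by
  set Γ : ℕ → Subgroup G := fun k => if k ≤ 1 then ⊤ else ⊥ with hΓ
  have h1 : ∀ k, 1 < k → Γ k = ⊥ := fun k hk => if_neg (by omega)
  exact ((hf.polyOn h1).mul (hg.polyOn h1)).kills (if_pos le_rfl) (by push_cast; linarith)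

/-- The functional on the truncated group algebra induced by a function on the group (meaningful
if the function annihilates `Iⁿ`). -/
noncomputable def truncatedExt (n : ℕ) (f : G → ℝ) : TruncatedAlgebra G n →ₗ[ℝ] ℝ :=
  (linExt f).comp ((Ideal.Quotient.mkₐ ℝ
    (augIdeal G ^ n)).toLinearMap.exists_rightInverse_of_surjective
    (LinearMap.range_eq_top.2 (Ideal.Quotient.mkₐ_surjective ℝ _))).choose

theorem truncatedExt_mk {n : ℕ} {f : G → ℝ} (hf : Kills n f) (x : MonoidAlgebra ℝ G) :
    truncatedExt n f (Ideal.Quotient.mkₐ ℝ _ x) = linExt f x := by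
  obtain ⟨σ, hσ⟩ : ∃ σ, σ = ((Ideal.Quotient.mkₐ ℝ
    (augIdeal G ^ n)).toLinearMap.exists_rightInverse_of_surjective
    (LinearMap.range_eq_top.2 (Ideal.Quotient.mkₐ_surjective ℝ _))).choose := ⟨_, rfl⟩
  have h1 : (Ideal.Quotient.mkₐ ℝ (augIdeal G ^ n)).toLinearMap.comp σ = LinearMap.id := by
    rw [hσ]
    exact ((Ideal.Quotient.mkₐ ℝ
    (augIdeal G ^ n)).toLinearMap.exists_rightInverse_of_surjective
      (LinearMap.range_eq_top.2 (Ideal.Quotient.mkₐ_surjective ℝ _))).choose_spec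
  have h2 : Ideal.Quotient.mk (augIdeal G ^ n) (σ (Ideal.Quotient.mkₐ ℝ _ x)) =
      Ideal.Quotient.mk (augIdeal G ^ n) x := LinearMap.congr_fun h1 (Ideal.Quotient.mkₐ ℝ _ x)
  rw [Ideal.Quotient.mk_eq_mk_iff_sub_mem] at h2
  have h3 := hf _ h2
  rw [map_sub, sub_eq_zero] at h3
  rw [truncatedExt, ← hσ]
  exact h3

end functionals

/-! ### Primitive elements as derivations -/

section primitive

variable {π : Type*} [Group π]

/-- The function `f` extends to a functional that vanishes on `Y`. -/
def Vanishes (Y : completedAlgebra π) (f : π → ℝ) : Prop :=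
  ∃ n, Kills n f ∧ ∀ y, Ideal.Quotient.mkₐ ℝ _ y = Y.1 n → linExt f y = 0

theorem mk_of_le {Y : completedAlgebra π} {m n : ℕ} (h : m ≤ n) {y : MonoidAlgebra ℝ π}
    (hy : Ideal.Quotient.mkₐ ℝ (augIdeal π ^ n) y = Y.1 n) :
    Ideal.Quotient.mkₐ ℝ (augIdeal π ^ m) y = Y.1 m := by
  rw [← Y.2 m n h, ← hy]
  rfl

theorem linExt_eq_of_mk_eq {n : ℕ} {f : π → ℝ} (hf : Kills n f) {x y : MonoidAlgebra ℝ π}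
    (h : Ideal.Quotient.mkₐ ℝ (augIdeal π ^ n) x = Ideal.Quotient.mkₐ ℝ (augIdeal π ^ n) y) :
    linExt f x = linExt f y := by
  have h3 := hf _ (Ideal.Quotient.mk_eq_mk_iff_sub_mem _ _ |>.1 h)
  rwa [map_sub, sub_eq_zero] at h3

/-- The value of `f` on `Y` does not depend on the truncation level: two levels are compared through
a representative at their maximum. -/
theorem Vanishes.linExt_eq_zero {Y : completedAlgebra π} {f : π → ℝ} (hf : Vanishes Y f) {m : ℕ}
    (hm : Kills m f) {y : MonoidAlgebra ℝ π} (hy : Ideal.Quotient.mkₐ ℝ _ y = Y.1 m) :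
    linExt f y = 0 := by
  obtain ⟨n, -, h⟩ := hf
  obtain ⟨z, hz⟩ := Ideal.Quotient.mkₐ_surjective ℝ _ (Y.1 (max m n))
  rw [← h z (mk_of_le (le_max_right _ _) hz)]
  exact linExt_eq_of_mk_eq hm (hy.trans (mk_of_le (le_max_left _ _) hz).symm)

theorem Vanishes.add {Y : completedAlgebra π} {f g : π → ℝ} (hf : Vanishes Y f)
    (hg : Vanishes Y g) : Vanishes Y (f + g) := by
  obtain ⟨m, hm, -⟩ := id hf
  obtain ⟨n, hn, -⟩ := id hg
  have hm' := hm.mono (le_max_left m n)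
  have hn' := hn.mono (le_max_right m n)
  refine ⟨max m n, fun x hx => ?_, fun y hy => ?_⟩
  · rw [linExt_add, LinearMap.add_apply, hm' x hx, hn' x hx, add_zero]
  · rw [linExt_add, LinearMap.add_apply, hf.linExt_eq_zero hm' hy, hg.linExt_eq_zero hn' hy,
      add_zero]

theorem Vanishes.smul {Y : completedAlgebra π} {f : π → ℝ} (c : ℝ) (hf : Vanishes Y f) :
    Vanishes Y (c • f) := by
  obtain ⟨m, hm, h⟩ := hf
  refine ⟨m, fun x hx => ?_, fun y hy => ?_⟩
  · rw [linExt_smul, LinearMap.smul_apply, hm x hx, smul_zero]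
  · rw [linExt_smul, LinearMap.smul_apply, h y hy, smul_zero]

theorem vanishes_zero {Y : completedAlgebra π} : Vanishes Y 0 := by
  refine ⟨0, kills_zero_iff.2 rfl, fun y _ => kills_zero_iff.2 rfl y (by simp [Submodule.pow_zero])⟩

theorem vanishes_one (Y : malcevLieAlgebra π) : Vanishes Y.1 1 := by
  refine ⟨1, fun x hx => ?_, fun y hy => ?_⟩
  · rw [linExt_one]
    rwa [Submodule.pow_one] at hx
  · rw [primitive_one, Ideal.Quotient.mkₐ_eq_mk, Ideal.Quotient.eq_zero_iff_mem,
      Submodule.pow_one] at hy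
    rw [linExt_one]
    exact hy

/-- Evaluating `f ⊗ g` on `Δ Y = Y ⊗ 1 + 1 ⊗ Y` gives the derivation rule `Y (f g) = g 1 * Y f + f 1
* Y g`. -/
theorem Vanishes.mul {Y : malcevLieAlgebra π} {f g : π → ℝ} (hf : Vanishes Y.1 f)
    (hg : Vanishes Y.1 g) : Vanishes Y.1 (f * g) := by
  obtain ⟨m, hm, -⟩ := id hf
  obtain ⟨n, hn, -⟩ := id hg
  set N := m + n + 1 with hN
  have hm' := hm.mono (show m ≤ N by omega)
  have hn' := hn.mono (show n ≤ N by omega)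
  set F : π × π → ℝ := (f ∘ MonoidHom.fst π π) * (g ∘ MonoidHom.snd π π) with hF
  have hFk : Kills N F := (hm.comp_hom _).mul (hn.comp_hom _)
  have h1 : F ∘ diag π = f * g := rfl
  have h2 : F ∘ MonoidHom.inl π π = g 1 • f := by ext x; simp [hF, mul_comm]
  have h3 : F ∘ MonoidHom.inr π π = f 1 • g := by ext x; simp [hF]
  refine ⟨N, h1 ▸ hFk.comp_hom (diag π), fun y hy => ?_⟩
  have hY : completedMap (diag π) Y.1 = completedMap _ Y.1 + completedMap _ Y.1 := Y.2
  have h4 : truncatedMap (diag π) N (Y.1.1 N) = truncatedMap (MonoidHom.inl π π) N (Y.1.1 N) +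
      truncatedMap (MonoidHom.inr π π) N (Y.1.1 N) := congrFun (congrArg Subtype.val hY) N
  rw [← hy, truncatedMap_mk, truncatedMap_mk, truncatedMap_mk, ← map_add] at h4
  have h5 := linExt_eq_of_mk_eq hFk h4
  rw [map_add, ← linExt_comp, ← linExt_comp, ← linExt_comp, h1, h2, h3, linExt_smul, linExt_smul,
    LinearMap.smul_apply, LinearMap.smul_apply, hf.linExt_eq_zero hm' hy,
    hg.linExt_eq_zero hn' hy] at h5
  simpa using h5

theorem isFiltration_vanishes (Y : malcevLieAlgebra π) : IsFiltration (X := π) fun _ =>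
    { carrier := {f | Vanishes Y.1 f}
      zero_mem' := vanishes_zero
      add_mem' := Vanishes.add
      smul_mem' := fun c _ h => Vanishes.smul c h } where
  mono _ _ _ := le_rfl
  one_mem := vanishes_one Y
  mul_mem hf hg := Vanishes.mul hf hg

theorem kills_coordFun [Group.IsNilpotent π] (B : AdaptedBasis π) (j : ℕ) (i : Fin (B.rank j)) :
    Kills (j + 2) (B.coordFun j i) :=
  (B.isPoly_coordFun j i).kills adaptedFiltration_one (by push_cast; omega)

/-- A primitive element on which all coordinate functions vanish is zero. -/
theorem eq_zero_of_vanishes [Group.IsNilpotent π] (htf : ∀ g : π, IsOfFinOrder g → g = 1)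
    (B : AdaptedBasis π) {Y : malcevLieAlgebra π}
    (hY : ∀ j < Group.nilpotencyClass π, ∀ i, Vanishes Y.1 (B.coordFun j i)) : Y.1 = 0 := by
  refine Subtype.ext (funext fun n => ?_)
  change Y.1.1 n = 0
  rw [← Module.forall_dual_apply_eq_zero_iff ℝ]
  intro ψ
  obtain ⟨y, hy⟩ := Ideal.Quotient.mkₐ_surjective ℝ _ (Y.1.1 n)
  -- An arbitrary functional on the truncated algebra is turned into a function killing `I ^ n`. It
  -- is polynomial, hence generated by the coordinates, on which `Y` vanishes.
  set f : π → ℝ := fun g => ψ (Ideal.Quotient.mkₐ ℝ _ (MonoidAlgebra.of ℝ π g)) with hf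
  have h1 : ∀ x, linExt f x = ψ (Ideal.Quotient.mkₐ ℝ _ x) := fun x => by
    have : linExt f = ψ.comp (Ideal.Quotient.mkₐ ℝ (augIdeal π ^ n)).toLinearMap :=
      linearMap_ext_of fun x => by rw [linExt_of]; rfl
    rw [this]
    rfl
  have h2 : Kills n f := fun x hx => by
    rw [h1, Ideal.Quotient.mkₐ_eq_mk, Ideal.Quotient.eq_zero_iff_mem.2 hx, map_zero]
  have h3 : IsPoly ((Group.nilpotencyClass π + 1) * n : ℕ) f := h2.polyOn fun k hk => by
    rw [eq_bot_iff, ← adaptedSeries_nilpotencyClass htf]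
    exact adaptedSeries_antitone (by omega)
  have h4 : Vanishes Y.1 f := h3.mem_filtration_of_torsionFree B htf (isFiltration_vanishes Y) hY
  rw [← hy, ← h1]
  exact h4.linExt_eq_zero h2 hy

end primitive


/-! ### Logarithms -/

section log

open Polynomial

theorem commute_aeval {A : Type*} [Ring A] [Algebra ℝ A] {a b : A} (h : Commute a b) (p : ℝ[X]) :
    Commute (aeval a p) b := by
  rw [aeval_eq_sum_range]
  exact Commute.sum_left _ _ _ fun i _ => (h.pow_left i).smul_left _

theorem truncatedExp_zero {A : Type*} [Ring A] [Algebra ℝ A] {n : ℕ} (h : (0 : A) ^ n = 0) :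
    truncatedExp n (0 : A) = 1 := by
  rcases Nat.eq_zero_or_pos n with rfl | hn
  · rw [pow_zero] at h
    rw [← mul_one (truncatedExp 0 (0 : A)), h, mul_zero]
  · rw [truncatedExp, Finset.sum_eq_single_of_mem 0 (Finset.mem_range.2 hn)
      fun k _ hk => by rw [zero_pow hk, smul_zero]]
    simp

/-- The tail `∑ Xᵏ / (k + 2)!` of the exponential series. -/
noncomputable def expTail (n : ℕ) : ℝ[X] :=
  ∑ k ∈ Finset.range n, C ((k + 2).factorial : ℝ)⁻¹ * X ^ k

theorem truncatedExp_eq_expTail {A : Type*} [Ring A] [Algebra ℝ A] {n : ℕ} {a : A}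
    (h : a ^ n = 0) : truncatedExp n a = 1 + a + a ^ 2 * aeval a (expTail n) := by
  rw [← truncatedExp_of_le (Nat.le_add_right n 2) h, truncatedExp, Finset.sum_range_succ',
    Finset.sum_range_succ', expTail, map_sum, Finset.mul_sum]
  simp only [map_mul, aeval_C, map_pow, aeval_X, Algebra.algebraMap_eq_smul_one, smul_mul_assoc,
    one_mul, mul_smul_comm, ← pow_add]
  simp only [zero_add, pow_zero, pow_one, Nat.factorial_zero, Nat.factorial_one, Nat.cast_one,
    inv_one, one_smul]
  rw [add_assoc, add_comm, add_comm a 1]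
  congr 1
  refine Finset.sum_congr rfl fun k _ => ?_
  rw [add_comm 2 k]

/-- From `exp a = 1` one gets `a = a * w` with `w` a nilpotent multiple of `a`; iterating gives `a =
a * w ^ n = 0`. -/
theorem eq_zero_of_truncatedExp_eq_one {A : Type*} [Ring A] [Algebra ℝ A] {n : ℕ} {a : A}
    (h : a ^ n = 0) (h1 : truncatedExp n a = 1) : a = 0 := by
  set w := -(a * aeval a (expTail n)) with hw
  have hcomm : Commute a (aeval a (expTail n)) := (commute_aeval (Commute.refl a) _).symm
  have h2 : a = a * w := by
    rw [truncatedExp_eq_expTail h, add_assoc, add_eq_left] at h1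
    rw [hw, mul_neg, ← mul_assoc, ← pow_two]
    exact eq_neg_of_add_eq_zero_left h1
  have h3 : ∀ m, a = a * w ^ m := by
    intro m
    induction m with
    | zero => simp
    | succ m ih => rw [pow_succ', ← mul_assoc, ← h2]; exact ih
  rw [h3 n, hw, neg_pow, hcomm.mul_pow, h]
  simp

/-- For commuting arguments `exp (a - b) = exp a * exp (-b) = 1`. This uniqueness of logarithms
later yields both their compatibility across truncations and their primitivity. -/
theorem eq_of_truncatedExp_eq {A : Type*} [Ring A] [Algebra ℝ A] {n : ℕ} {a b : A}
    (hab : Commute a b) (ha : a ^ n = 0) (hb : b ^ n = 0) (hc : (a - b) ^ n = 0)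
    (h : truncatedExp n a = truncatedExp n b) : a = b := by
  have hb' : (-b) ^ n = 0 := by rw [neg_pow, hb, mul_zero]
  have h0 : (0 : A) ^ n = 0 := by
    rcases Nat.eq_zero_or_pos n with rfl | hn
    · rw [pow_zero] at ha ⊢
      exact ha
    · exact zero_pow hn.ne'
  rw [← sub_eq_zero]
  refine eq_zero_of_truncatedExp_eq_one hc ?_
  rw [sub_eq_add_neg, truncatedExp_add hab.neg_right ha hb' (by rwa [← sub_eq_add_neg]), h,
    ← truncatedExp_add (Commute.refl b).neg_right hb hb' (by rwa [add_neg_cancel]),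
    add_neg_cancel, truncatedExp_zero h0]

theorem aeval_X_mul_pow {A : Type*} [Ring A] [Algebra ℝ A] {n : ℕ} {u : A} (hu : u ^ n = 0)
    (q : ℝ[X]) : (aeval u (X * q)) ^ n = 0 := by
  rw [← map_pow, mul_pow, map_mul, map_pow, aeval_X, hu, zero_mul]

/-- Existence of logarithms of unipotent elements, by successive approximation. -/
theorem exists_truncatedExp_eq {A : Type*} [Ring A] [Algebra ℝ A] {n : ℕ} {u : A}
    (hu : u ^ n = 0) : ∃ q : ℝ[X], truncatedExp n (aeval u (X * q)) = 1 + u := by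
  have key : ∀ k : ℕ, ∃ q r : ℝ[X],
      truncatedExp n (aeval u (X * q)) = aeval u (1 + X + X ^ (k + 1) * r) := by
    intro k
    induction k with
    | zero =>
      -- The first approximation to the logarithm is `0`, with `1 = 1 + X - X`.
      refine ⟨0, -1, ?_⟩
      have h0 : (0 : A) ^ n = 0 := by simpa using aeval_X_mul_pow hu (0 : ℝ[X])
      rw [mul_zero, map_zero, truncatedExp_zero h0]
      simp
    | succ k ih =>
      obtain ⟨q, r, h⟩ := ih
      have h1 : aeval u (X * (q - X ^ k * r)) =
          aeval u (X * q) + aeval u (X * -(X ^ k * r)) := by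
        rw [← map_add]
        congr 1
        ring
      set c : ℝ[X] := X * -(X ^ k * r) with hc
      -- Adding `c = -X ^ (k + 1) * r` to the approximate logarithm multiplies the exponential by `1
      -- + c + c ^ 2 * (⋯)`. This cancels the error `X ^ (k + 1) * r` and leaves a multiple of `X ^
      -- (k + 2)`, whose cofactor is the second witness.
      refine ⟨q - X ^ k * r, (-r - X ^ k * r ^ 2 +
        (1 + X + X ^ (k + 1) * r) * X ^ k * r ^ 2 * (expTail n).comp c), ?_⟩
      rw [h1, truncatedExp_add (commute_aeval (commute_aeval (Commute.refl u) _).symm _)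
        (aeval_X_mul_pow hu _) (aeval_X_mul_pow hu _)
        (by rw [← h1]; exact aeval_X_mul_pow hu _), h,
        truncatedExp_eq_expTail (aeval_X_mul_pow hu _), ← aeval_comp]
      rw [← map_pow, ← map_mul, ← map_one (aeval (R := ℝ) u), ← map_add, ← map_add, ← map_mul]
      congr 1
      rw [hc]
      ring
  obtain ⟨q, r, h⟩ := key n
  refine ⟨q, ?_⟩
  rw [h]
  simp [pow_succ, hu]

variable {π : Type*} [Group π]

theorem mk_pow_eq_zero {y : MonoidAlgebra ℝ π} (hy : y ∈ augIdeal π) (n : ℕ) :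
    Ideal.Quotient.mkₐ ℝ (augIdeal π ^ n) y ^ n = 0 := by
  rw [← map_pow, Ideal.Quotient.mkₐ_eq_mk, Ideal.Quotient.eq_zero_iff_mem]
  exact Ideal.pow_mem_pow hy n

theorem aeval_X_mul_mem {y : MonoidAlgebra ℝ π} (hy : y ∈ augIdeal π) (q : ℝ[X]) :
    aeval y (X * q) ∈ augIdeal π := by
  have h1 : augmentation π y = 0 := hy
  change augmentation π _ = 0
  rw [map_mul, map_mul, aeval_X, h1, zero_mul]

theorem mapDomain_mem {G H : Type*} [Group G] [Group H] (φ : G →* H) {y : MonoidAlgebra ℝ G}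
    (hy : y ∈ augIdeal G) : MonoidAlgebra.mapDomainAlgHom ℝ ℝ φ y ∈ augIdeal H := by
  change augmentation H _ = 0
  rw [augmentation_mapDomain]
  exact hy

/-- Every element of `π` has a logarithm in the Malcev Lie algebra. -/
theorem exists_malcevExp_eq (g : π) : ∃ X : malcevLieAlgebra π, malcevExp X = toMalcev π g := by
  set v : MonoidAlgebra ℝ π := MonoidAlgebra.of ℝ π g - 1 with hv
  have hvI : v ∈ augIdeal π := of_sub_one_mem g
  choose q hq using fun n => exists_truncatedExp_eq (mk_pow_eq_zero hvI n)
  set y : ℕ → MonoidAlgebra ℝ π := fun n => aeval v (X * q n) with hy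
  have hyI : ∀ n, y n ∈ augIdeal π := fun n => aeval_X_mul_mem hvI _
  have hexp : ∀ n, truncatedExp n (Ideal.Quotient.mkₐ ℝ (augIdeal π ^ n) (y n)) =
      Ideal.Quotient.mkₐ ℝ (augIdeal π ^ n) (MonoidAlgebra.of ℝ π g) := fun n => by
    rw [hy, ← aeval_algHom_apply, hq, hv, map_sub, map_one]
    abel
  -- The polynomials `q n` are chosen independently for each `n`. Compatibility follows from
  -- uniqueness, as both logarithms are polynomials in `v` and so commute.
  have hcompat : ∀ m n, m ≤ n → Ideal.Quotient.mkₐ ℝ (augIdeal π ^ m) (y n) =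
      Ideal.Quotient.mkₐ ℝ (augIdeal π ^ m) (y m) := by
    intro m n hmn
    refine eq_of_truncatedExp_eq ?_ (mk_pow_eq_zero (hyI n) m) (mk_pow_eq_zero (hyI m) m) ?_ ?_
    · have : Commute (y n) (y m) := commute_aeval (commute_aeval (Commute.refl v) _).symm _
      exact this.map _
    · rw [← map_sub]
      exact mk_pow_eq_zero ((augIdeal π).sub_mem (hyI n) (hyI m)) m
    · rw [hexp m, ← truncatedExp_of_le hmn (mk_pow_eq_zero (hyI n) m)]
      have := congrArg (Ideal.Quotient.factorₐ ℝ (Ideal.pow_le_pow_right hmn)) (hexp n)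
      rw [map_truncatedExp] at this
      exact this
  set Y : completedAlgebra π := ⟨fun n => Ideal.Quotient.mkₐ ℝ _ (y n),
    fun m n h => hcompat m n h⟩ with hY
  -- Both sides exponentiate to the image of `(g, g) = (g, 1) * (1, g)` and they commute, so
  -- uniqueness of logarithms applies.
  have hprim : completedMap (diag π) Y =
      completedMap (MonoidHom.inl π π) Y + completedMap (MonoidHom.inr π π) Y := by
    refine Subtype.ext (funext fun n => ?_)
    change truncatedMap _ n (Ideal.Quotient.mkₐ ℝ _ (y n)) =
      truncatedMap _ n (Ideal.Quotient.mkₐ ℝ _ (y n)) +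
        truncatedMap _ n (Ideal.Quotient.mkₐ ℝ _ (y n))
    have hD := mapDomain_mem (diag π) (hyI n)
    have hL := mapDomain_mem (MonoidHom.inl π π) (hyI n)
    have hR := mapDomain_mem (MonoidHom.inr π π) (hyI n)
    have hm : ∀ φ : π →* π × π, truncatedExp n (Ideal.Quotient.mkₐ ℝ (augIdeal (π × π) ^ n)
        (MonoidAlgebra.mapDomainAlgHom ℝ ℝ φ (y n))) =
        Ideal.Quotient.mkₐ ℝ (augIdeal (π × π) ^ n) (MonoidAlgebra.of ℝ (π × π) (φ g)) := by
      intro φ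
      rw [← truncatedMap_mk, ← map_truncatedExp, hexp, truncatedMap_mk]
      simp
    have hcomm : ∀ φ ψ : π →* π × π, Commute (φ g) (ψ g) →
        Commute (MonoidAlgebra.mapDomainAlgHom ℝ ℝ φ (y n))
          (MonoidAlgebra.mapDomainAlgHom ℝ ℝ ψ (y n)) := by
      intro φ ψ h
      have h1 : Commute (MonoidAlgebra.mapDomainAlgHom ℝ ℝ φ v)
          (MonoidAlgebra.mapDomainAlgHom ℝ ℝ ψ v) := by
        have : ∀ φ : π →* π × π, MonoidAlgebra.mapDomainAlgHom ℝ ℝ φ v =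
            MonoidAlgebra.of ℝ (π × π) (φ g) - 1 := fun φ => by
          rw [hv, map_sub, map_one]; simp
        rw [this, this]
        refine Commute.sub_left (Commute.sub_right ?_ (Commute.one_right _)) (Commute.one_left _)
        exact h.map (MonoidAlgebra.of ℝ (π × π))
      rw [hy, ← aeval_algHom_apply, ← aeval_algHom_apply]
      exact commute_aeval (commute_aeval h1.symm _).symm _
    rw [truncatedMap_mk, truncatedMap_mk, truncatedMap_mk, ← map_add]
    have hLR := (hcomm (MonoidHom.inl π π) (MonoidHom.inr π π) (by simp [Commute, SemiconjBy])).map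
      (Ideal.Quotient.mkₐ ℝ (augIdeal (π × π) ^ n))
    refine eq_of_truncatedExp_eq ?_ (mk_pow_eq_zero hD n)
      (mk_pow_eq_zero ((augIdeal _).add_mem hL hR) n) ?_ ?_
    · refine Commute.map (Commute.add_right (hcomm _ _ ?_) (hcomm _ _ ?_)) _ <;>
        simp [Commute, SemiconjBy]
    · rw [← map_sub]
      exact mk_pow_eq_zero ((augIdeal (π × π)).sub_mem hD ((augIdeal (π × π)).add_mem hL hR)) n
    · rw [hm, map_add, truncatedExp_add hLR (mk_pow_eq_zero hL n) (mk_pow_eq_zero hR n)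
        (by rw [← map_add]; exact mk_pow_eq_zero ((augIdeal _).add_mem hL hR) n), hm, hm,
        ← map_mul, ← map_mul]
      congr 2
      simp
  refine ⟨⟨Y, hprim⟩, Subtype.ext (Units.ext (Subtype.ext (funext fun n => ?_)))⟩
  exact hexp n

/-- Functionals evaluate logarithms as derivatives along one-parameter subgroups. -/
theorem truncatedExt_log {f : π → ℝ} {n : ℕ} (hn : 2 ≤ n) (hf : Kills n f) {x : π}
    {Y : malcevLieAlgebra π} (hY : malcevExp Y = toMalcev π x) {c : ℝ}
    (hc : ∀ s : ℕ, f (x ^ s) = s * c) : truncatedExt n f (Y.1.1 n) = c := by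
  have hexp : truncatedExp n (Y.1.1 n) =
      Ideal.Quotient.mkₐ ℝ (augIdeal π ^ n) (MonoidAlgebra.of ℝ π x) :=
    congrFun (congrArg Subtype.val (congrArg Units.val (congrArg Subtype.val hY))) n
  set z := Y.1.1 n with hz
  have hz0 : z ^ n = 0 := primitive_pow Y le_rfl
  have hsz : ∀ s : ℕ, ((s : ℝ) • z) ^ n = 0 := fun s => by rw [_root_.smul_pow, hz0, smul_zero]
  have hpow : ∀ s : ℕ, truncatedExp n ((s : ℝ) • z) = truncatedExp n z ^ s := by
    intro s
    induction s with
    | zero =>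
      rw [Nat.cast_zero, zero_smul, pow_zero]
      exact truncatedExp_zero (by simpa using hsz 0)
    | succ s ih =>
      have h1 : ((s + 1 : ℕ) : ℝ) • z = (s : ℝ) • z + z := by push_cast; rw [add_smul, one_smul]
      rw [h1, truncatedExp_add ((Commute.refl z).smul_left _) (hsz s) hz0
        (by rw [← h1]; exact hsz _),
        ih, pow_succ]
  set b : ℕ → ℝ := fun k => ((k.factorial : ℝ)⁻¹) * truncatedExt n f (z ^ k) with hb
  -- Since `x ^ s = exp (s z)`, the value `f (x ^ s)` is a polynomial in `s` with coefficients `b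
  -- k`. It agrees with `s * c` at every natural number, so the linear coefficients agree; `2 ≤ n`
  -- ensures that the term `k = 1` occurs.
  set p : ℝ[X] := ∑ k ∈ Finset.range n, C (b k) * X ^ k - C c * X with hp
  have hp0 : p = 0 := by
    refine Polynomial.eq_zero_of_infinite_isRoot p ?_
    refine (Set.infinite_range_of_injective (Nat.cast_injective (R := ℝ))).mono ?_
    rintro _ ⟨s, rfl⟩
    have h1 := hc s
    rw [← linExt_of f, ← truncatedExt_mk hf, map_pow, map_pow, ← hexp, ← hpow, truncatedExp,
      map_sum] at h1
    change IsRoot p (s : ℝ)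
    rw [IsRoot, hp, eval_sub, eval_finsetSum, eval_mul, eval_C, eval_X, sub_eq_zero, mul_comm c,
      ← h1]
    refine Finset.sum_congr rfl fun k _ => ?_
    rw [eval_mul, eval_C, eval_pow, eval_X, map_smul, _root_.smul_pow, map_smul, hb, smul_eq_mul,
      smul_eq_mul]
    ring
  have h2 := congrArg (fun p : ℝ[X] => p.coeff 1) hp0
  simp only [hp, coeff_sub, finsetSum_coeff, coeff_C_mul, coeff_X_pow, coeff_X_one, mul_one,
    coeff_zero, mul_ite, mul_zero, Finset.sum_ite_eq, Finset.mem_range] at h2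
  rw [if_pos (by omega), sub_eq_zero] at h2
  simpa [hb] using h2

end log


/-! ### The basis of logarithms and the matrix of the linearization -/

namespace AdaptedBasis

section matrix

variable {π : Type*} [Group π] [Group.IsNilpotent π] (B : AdaptedBasis π) (φ : π →* π)

/-- The integer matrix of the endomorphism of a successive quotient of the adapted series induced
by an endomorphism of the group. -/
noncomputable def inducedMatrix (j : ℕ) : Matrix (Fin (B.rank j)) (Fin (B.rank j)) ℤ :=
  Matrix.of fun i l => B.coord j (φ (B.elt j l)) i

theorem coord_map {j : ℕ} {x : π} (hx : x ∈ adaptedSeries π j) :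
    B.coord j (φ x) = B.inducedMatrix φ j *ᵥ B.coord j x := by
  have hφ := fun {y : π} (hy : y ∈ adaptedSeries π j) => map_mem_adaptedSeries φ j hy
  let H : Subgroup π :=
    { carrier := {x | x ∈ adaptedSeries π j ∧ B.coord j (φ x) = B.inducedMatrix φ j *ᵥ B.coord j x}
      one_mem' := ⟨one_mem _, by simp [coord_one]⟩
      mul_mem' := fun {x y} hx hy => ⟨mul_mem hx.1 hy.1, by
        rw [map_mul, coord_mul (hφ hx.1) (hφ hy.1), coord_mul hx.1 hy.1, Matrix.mulVec_add, hx.2,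
          hy.2]⟩
      inv_mem' := fun {x} hx => ⟨inv_mem hx.1, by
        rw [map_inv, coord_inv (hφ hx.1), coord_inv hx.1, Matrix.mulVec_neg, hx.2]⟩ }
  have hle : adaptedSeries π j ≤ H := by
    refine le_of_elt_mem (B := B) (fun y hy => ⟨adaptedSeries_antitone (by omega) hy, ?_⟩) fun i =>
      ⟨(B.elt j i).2, ?_⟩
    · rw [coord_eq_zero hy, coord_eq_zero (map_mem_adaptedSeries φ (j + 1) hy), Matrix.mulVec_zero]
    · rw [coord_elt, Matrix.mulVec_single_one]
      rfl
  exact (hle hx).2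

theorem equiv_adaptedQuotientMap (j : ℕ) (x : AdaptedQuotient π j) :
    (B.equiv j (adaptedQuotientMap φ j x)).toAdd = B.inducedMatrix φ j *ᵥ (B.equiv j x).toAdd := by
  induction x using QuotientGroup.induction_on with
  | H x =>
    have := B.coord_map φ x.2
    rw [coord_of_mem x.2, coord_of_mem (map_mem_adaptedSeries φ j x.2)] at this
    exact this

end matrix

section basis

variable {π : Type*} [Group π] [Group.IsNilpotent π] (B : AdaptedBasis π)

/-- The index set of the basis of logarithms. -/
abbrev Index : Type := Σ j : Fin (Group.nilpotencyClass π), Fin (B.rank j)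

/-- The linear extension of the coordinate functions to the Malcev Lie algebra. -/
noncomputable def lieCoord : malcevLieAlgebra π →ₗ[ℝ] B.Index → ℝ where
  toFun Y p := truncatedExt (p.1 + 2) (B.coordFun p.1 p.2) (Y.1.1 (p.1 + 2))
  map_add' Y Z := funext fun p =>
    map_add (truncatedExt (p.1 + 2) (B.coordFun p.1 p.2)) (Y.1.1 (p.1 + 2)) (Z.1.1 (p.1 + 2))
  map_smul' r Y := funext fun p =>
    map_smul (truncatedExt (p.1 + 2) (B.coordFun p.1 p.2)) r (Y.1.1 (p.1 + 2))

theorem lieCoord_log {x : π} {Y : malcevLieAlgebra π} (hY : malcevExp Y = toMalcev π x)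
    (p : B.Index) (hx : x ∈ adaptedSeries π p.1) : B.lieCoord Y p = B.coord p.1 x p.2 := by
  refine truncatedExt_log (by omega) (kills_coordFun B _ _) hY fun s => ?_
  rw [coordFun_of_mem _ (pow_mem hx s), ← zpow_natCast, coord_zpow hx]
  simp

set_option synthInstance.maxHeartbeats 400000 in
theorem lieCoord_injective (htf : ∀ g : π, IsOfFinOrder g → g = 1) :
    Function.Injective B.lieCoord := by
  rw [injective_iff_map_eq_zero]
  intro Y hY
  have h : ∀ j < Group.nilpotencyClass π, ∀ i, Vanishes Y.1 (B.coordFun j i) := by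
    intro j hj i
    have h1 : truncatedExt (j + 2) (B.coordFun j i) (Y.1.1 (j + 2)) = 0 :=
      congrFun hY ⟨⟨j, hj⟩, i⟩
    refine ⟨j + 2, kills_coordFun B j i, fun y hy => ?_⟩
    rw [← truncatedExt_mk (kills_coordFun B j i) y, hy, h1]
  exact Subtype.ext (eq_zero_of_vanishes htf B h)

variable {B} {X : B.Index → malcevLieAlgebra π}
  (hX : ∀ p : B.Index, malcevExp (X p) = toMalcev π (B.elt p.1 p.2))

include hX in
set_option synthInstance.maxHeartbeats 400000 in
-- Triangularity of the pairing: in block `k`, logarithms from the same block give the identity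
-- matrix and those from later blocks give zero. Earlier blocks may contribute anything, so their
-- coefficients have to vanish.
theorem lieCoord_sum (g : B.Index → ℝ) (k : Fin (Group.nilpotencyClass π))
    (hg : ∀ p : B.Index, p.1 < k → g p = 0) (i : Fin (B.rank k)) :
    B.lieCoord (∑ p, g p • X p) ⟨k, i⟩ = g ⟨k, i⟩ := by
  rw [map_sum, Finset.sum_apply, Finset.sum_eq_single_of_mem ⟨k, i⟩ (Finset.mem_univ _)]
  · rw [map_smul, Pi.smul_apply, lieCoord_log B (hX _) _ (B.elt k i).2, coord_elt]
    simp
  · rintro ⟨l, m⟩ - hne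
    rw [map_smul, Pi.smul_apply]
    rcases lt_trichotomy l k with h | h | h
    · rw [hg _ h, zero_smul]
    · subst h
      rw [lieCoord_log B (hX _) _ (B.elt l m).2, coord_elt, Pi.single_eq_of_ne]
      · simp
      · rintro rfl
        exact hne rfl
    · have hlt : (k : ℕ) + 1 ≤ l := h
      have hmem := adaptedSeries_antitone hlt (B.elt l m).2
      have hmem' : (B.elt l m : π) ∈ adaptedSeries π k :=
        adaptedSeries_antitone (Nat.le_succ _) hmem
      rw [lieCoord_log B (hX ⟨l, m⟩) ⟨k, i⟩ hmem', coord_eq_zero hmem]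
      simp

include hX in
set_option synthInstance.maxHeartbeats 400000 in
-- Forward substitution in the triangular system, block by block.
theorem eq_zero_of_lieCoord_sum (g : B.Index → ℝ) (k : ℕ)
    (hg : ∀ p : B.Index, (p.1 : ℕ) < k → B.lieCoord (∑ p, g p • X p) p = 0) :
    ∀ p : B.Index, (p.1 : ℕ) < k → g p = 0 := by
  have key : ∀ n : ℕ, n ≤ k → ∀ p : B.Index, (p.1 : ℕ) < n → g p = 0 := by
    intro n
    induction n with
    | zero => intro _ p hp; omega
    | succ n ih =>
      intro hn p hp
      rcases Nat.lt_succ_iff_lt_or_eq.1 hp with h | h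
      · exact ih (by omega) p h
      · have := lieCoord_sum hX g p.1 (fun q hq => ih (by omega) q (by
          have : (q.1 : ℕ) < p.1 := hq
          omega)) p.2
        rw [← this]
        exact hg p (by omega)
  exact key k le_rfl

include hX in
set_option synthInstance.maxHeartbeats 400000 in
theorem linearIndependent_log : LinearIndependent ℝ X := by
  rw [Fintype.linearIndependent_iff]
  intro g hg p
  refine eq_zero_of_lieCoord_sum hX g (Group.nilpotencyClass π) (fun q _ => ?_) p p.1.2
  rw [hg, map_zero]
  rfl

include hX in
set_option synthInstance.maxHeartbeats 400000 in
-- Injectivity of the coordinates bounds the dimension above by the number of logarithms, and their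
-- independence bounds it below.
theorem exists_basis_log (htf : ∀ g : π, IsOfFinOrder g → g = 1) :
    ∃ b : Module.Basis B.Index ℝ (malcevLieAlgebra π), ∀ p, b p = X p := by
  have hinj := B.lieCoord_injective htf
  have hfin : Module.Finite ℝ (malcevLieAlgebra π) := Module.Finite.of_injective _ hinj
  have h1 := LinearMap.finrank_le_finrank_of_injective hinj
  have h2 := (linearIndependent_log hX).fintype_card_le_finrank
  rw [Module.finrank_fintype_fun_eq_card] at h1
  have h3 := (linearIndependent_log hX).span_eq_top_of_card_eq_finrank' (le_antisymm h2 h1)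
  exact ⟨Module.Basis.mk (linearIndependent_log hX) h3.ge, fun p => by rw [Module.Basis.mk_apply]⟩

set_option synthInstance.maxHeartbeats 400000 in
-- The linearization sends `log a` to `log (φ a)`, and `φ a` lies in the same isolator as `a`.
-- Coordinates of earlier blocks vanish on this logarithm, and those of its own block are the
-- coordinates of the class of `φ a`.
theorem toMatrix_linearization (φ : π →* π) (b : Module.Basis B.Index ℝ (malcevLieAlgebra π))
    (hb : ∀ p, malcevExp (b p) = toMalcev π (B.elt p.1 p.2)) (q : B.Index) :
    (∀ p : B.Index, p.1 < q.1 → LinearMap.toMatrix b b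
      (linearization φ : malcevLieAlgebra π →ₗ[ℝ] malcevLieAlgebra π) p q = 0) ∧
    ∀ i, LinearMap.toMatrix b b
      (linearization φ : malcevLieAlgebra π →ₗ[ℝ] malcevLieAlgebra π) ⟨q.1, i⟩ q =
        (B.inducedMatrix φ q.1 i q.2 : ℝ) := by
  set Y : malcevLieAlgebra π := linearization φ (b q) with hY
  have hexp : malcevExp Y = toMalcev π (φ (B.elt q.1 q.2)) := by
    rw [hY, ← malcevMap_malcevExp, hb, malcevMap_toMalcev]
  have hmem : φ (B.elt q.1 q.2) ∈ adaptedSeries π q.1 :=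
    map_mem_adaptedSeries φ _ (B.elt q.1 q.2).2
  have hsum : ∑ p, b.repr Y p • b p = Y := b.sum_repr Y
  have h0 : ∀ p : B.Index, p.1 < q.1 → b.repr Y p = 0 := by
    refine fun p hp => eq_zero_of_lieCoord_sum hb (b.repr Y) q.1 (fun p hp => ?_) p hp
    have hmem' : φ (B.elt q.1 q.2) ∈ adaptedSeries π (p.1 + 1) := adaptedSeries_antitone hp hmem
    rw [hsum, lieCoord_log B hexp p (adaptedSeries_antitone (Nat.le_succ _) hmem'),
      coord_eq_zero hmem']
    simp
  refine ⟨fun p hp => ?_, fun i => ?_⟩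
  · rw [LinearMap.toMatrix_apply]
    exact h0 p hp
  · rw [LinearMap.toMatrix_apply]
    have := lieCoord_sum hb (b.repr Y) q.1 h0 i
    rw [hsum, lieCoord_log B hexp ⟨q.1, i⟩ hmem] at this
    exact this.symm

end basis

end AdaptedBasis


/-! ### Word lengths -/

section wordLength

variable {π : Type*} [Group π] {S : Finset π}

theorem wordLength_le (w : List π) (hw : ∀ x ∈ w, x ∈ S ∨ x⁻¹ ∈ S) :
    wordLength S w.prod ≤ w.length :=
  Nat.sInf_le ⟨w, hw, rfl, rfl⟩

variable (hS : Subgroup.closure (S : Set π) = ⊤)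
include hS

theorem exists_word (g : π) : ∃ w : List π, (∀ x ∈ w, x ∈ S ∨ x⁻¹ ∈ S) ∧ w.prod = g ∧
    w.length = wordLength S g := by
  have hg : g ∈ Subgroup.closure (S : Set π) := hS ▸ Subgroup.mem_top g
  rw [← Subgroup.mem_toSubmonoid, Subgroup.closure_toSubmonoid] at hg
  obtain ⟨w, hw, hwg⟩ := Submonoid.exists_list_of_mem_closure hg
  exact Nat.sInf_mem (s := {n | ∃ w : List π, (∀ x ∈ w, x ∈ S ∨ x⁻¹ ∈ S) ∧ w.prod = g ∧
    w.length = n}) ⟨w.length, w, hw, hwg, rfl⟩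

theorem wordLength_mul_le (g h : π) : wordLength S (g * h) ≤ wordLength S g + wordLength S h := by
  obtain ⟨v, hv, rfl, hvl⟩ := exists_word hS g
  obtain ⟨w, hw, rfl, hwl⟩ := exists_word hS h
  rw [← hvl, ← hwl, ← List.length_append, ← List.prod_append]
  exact wordLength_le _ fun x hx => (List.mem_append.1 hx).elim (hv x) (hw x)

theorem wordLength_inv_le (g : π) : wordLength S g⁻¹ ≤ wordLength S g := by
  obtain ⟨v, hv, rfl, hvl⟩ := exists_word hS g
  rw [List.prod_inv_reverse, ← hvl]
  refine (wordLength_le _ fun x hx => ?_).trans (by simp)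
  rw [List.mem_reverse, List.mem_map] at hx
  obtain ⟨y, hy, rfl⟩ := hx
  rw [inv_inv]
  exact (hv y hy).symm

omit hS in
theorem wordLength_one : wordLength S (1 : π) = 0 :=
  Nat.le_zero.1 (wordLength_le (S := S) [] (by simp))

theorem eq_one_of_wordLength_eq_zero {g : π} (h : wordLength S g = 0) : g = 1 := by
  obtain ⟨w, -, rfl, hw⟩ := exists_word hS g
  rw [h, List.length_eq_zero_iff] at hw
  simp [hw]

theorem wordLength_pow_le (g : π) (n : ℕ) : wordLength S (g ^ n) ≤ n * wordLength S g := by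
  induction n with
  | zero => simp [wordLength_one]
  | succ n ih =>
    rw [pow_succ, Nat.succ_mul]
    exact (wordLength_mul_le hS _ _).trans (Nat.add_le_add_right ih _)

theorem wordLength_zpow_le (g : π) (n : ℤ) : wordLength S (g ^ n) ≤ n.natAbs * wordLength S g := by
  rcases Int.natAbs_eq n with h | h
  · rw [h, zpow_natCast, Int.natAbs_natCast]
    exact wordLength_pow_le hS g _
  · rw [h, zpow_neg, zpow_natCast, Int.natAbs_neg, Int.natAbs_natCast]
    exact (wordLength_inv_le hS _).trans (wordLength_pow_le hS g _)

end wordLength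

/-! ### Families of elements of bounded length -/

section families

variable {π : Type*} [Group π] {ι : Type*}

/-- The lengths of the elements of a family are bounded by a multiple of the scales `R`. -/
def LengthBounded (S : Finset π) (R : ι → ℝ) (g : ι → π) : Prop :=
  ∃ C : ℝ, ∀ i, (wordLength S (g i) : ℝ) ≤ C * R i

variable {S : Finset π} (hS : Subgroup.closure (S : Set π) = ⊤) {R : ι → ℝ} (hR : ∀ i, 1 ≤ R i)

include hS in
theorem LengthBounded.mul {g h : ι → π} (hg : LengthBounded S R g) (hh : LengthBounded S R h) :
    LengthBounded S R (fun i => g i * h i) := by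
  obtain ⟨C, hC⟩ := hg
  obtain ⟨C', hC'⟩ := hh
  refine ⟨C + C', fun i => ?_⟩
  have h1 : (wordLength S (g i * h i) : ℝ) ≤ wordLength S (g i) + wordLength S (h i) := by
    exact_mod_cast wordLength_mul_le hS _ _
  linarith [hC i, hC' i]

include hS in
theorem LengthBounded.inv {g : ι → π} (hg : LengthBounded S R g) :
    LengthBounded S R (fun i => (g i)⁻¹) := by
  obtain ⟨C, hC⟩ := hg
  exact ⟨C, fun i => le_trans (by exact_mod_cast wordLength_inv_le hS _) (hC i)⟩

include hS in
theorem LengthBounded.commutator {g h : ι → π} (hg : LengthBounded S R g)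
    (hh : LengthBounded S R h) : LengthBounded S R (fun i => ⁅g i, h i⁆) :=
  ((hg.mul hS hh).mul hS (hg.inv hS)).mul hS (hh.inv hS)

theorem lengthBounded_one : LengthBounded S R (fun _ => (1 : π)) :=
  ⟨0, fun i => by simp [wordLength_one]⟩

include hR in
theorem lengthBounded_const (g : π) : LengthBounded S R (fun _ => g) :=
  ⟨wordLength S g, fun i => le_mul_of_one_le_right (Nat.cast_nonneg _) (hR i)⟩

include hS in
theorem lengthBounded_zpow (g : π) {n : ι → ℤ} {C : ℝ} (hn : ∀ i, |(n i : ℝ)| ≤ C * R i) :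
    LengthBounded S R (fun i => g ^ n i) := by
  refine ⟨C * wordLength S g, fun i => ?_⟩
  have h1 : (wordLength S (g ^ n i) : ℝ) ≤ (n i).natAbs * wordLength S g := by
    exact_mod_cast wordLength_zpow_le hS g _
  rw [Nat.cast_natAbs, Int.cast_abs] at h1
  nlinarith [hn i, (Nat.cast_nonneg (wordLength S g) : (0 : ℝ) ≤ _)]

variable [Group.IsNilpotent π]

/-- Polynomial functions of degree `d` on the family grow at most like the `d`-th power of the
scales `R`. -/
def Tame (R : ι → ℝ) (g : ι → π) : Prop :=
  ∀ (d : ℕ) (f : π → ℝ), IsPoly d f → ∃ C : ℝ, ∀ i, |f (g i)| ≤ C * R i ^ d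

include hR in
-- Removing the first letter of a word changes `f` by a difference of degree one less, hence by `O(R
-- ^ d)` when `f` has degree `d + 1`; there are `O(R)` letters. Uniformity over all short words is
-- what allows the induction to be applied to suffixes.
theorem Tame.word_mul {g : ι → π} (hg : Tame R g) (C₀ : ℝ) (d : ℕ) : ∀ f : π → ℝ, IsPoly d f →
    ∃ C : ℝ, ∀ (i : ι) (w : List π), (∀ x ∈ w, x ∈ S ∨ x⁻¹ ∈ S) → (w.length : ℝ) ≤ C₀ * R i →
      |f (w.prod * g i)| ≤ C * R i ^ d := by
  classical
  induction d with
  | zero =>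
    intro f hf
    obtain ⟨C, hC⟩ := hg 0 f hf
    refine ⟨C, fun i w _ _ => ?_⟩
    rw [IsPoly.apply_eq hf, ← IsPoly.apply_eq hf (g i)]
    exact hC i
  | succ d ih =>
    intro f hf
    obtain ⟨C, hC⟩ := hg (d + 1) f hf
    have hdiff : ∀ s : π, IsPoly d (leftDiff s f) := fun s =>
      (hf.diff_adapted (j := 0) (adaptedSeries_zero (π := π) ▸ Subgroup.mem_top s)).mono
        (by push_cast; omega)
    choose D hD using fun s => ih _ (hdiff s)
    set L : Finset π := S ∪ S.image (·⁻¹) with hL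
    set D' := ∑ s ∈ L, |D s| with hD'
    have hD'0 : 0 ≤ D' := Finset.sum_nonneg fun _ _ => abs_nonneg _
    refine ⟨C + C₀ * D', fun i w hw hlen => ?_⟩
    have hRd : 0 ≤ R i ^ d := by have := hR i; positivity
    have key : ∀ w : List π, (∀ x ∈ w, x ∈ S ∨ x⁻¹ ∈ S) → (w.length : ℝ) ≤ C₀ * R i →
        |f (w.prod * g i)| ≤ C * R i ^ (d + 1) + w.length * (D' * R i ^ d) := by
      intro w
      induction w with
      | nil => intro _ _; simpa using hC i
      | cons s w ihw =>
        intro hw hlen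
        have hlen' : (w.length : ℝ) ≤ C₀ * R i := by
          refine le_trans ?_ hlen
          simp
        have hw' : ∀ x ∈ w, x ∈ S ∨ x⁻¹ ∈ S := fun x hx => hw x (List.mem_cons_of_mem _ hx)
        have h1 := ihw hw' hlen'
        have h2 := hD s i w hw' hlen'
        have hs : s ∈ L := by
          rw [hL, Finset.mem_union, Finset.mem_image]
          exact (hw s List.mem_cons_self).imp id fun h => ⟨_, h, inv_inv s⟩
        have h3 : D s ≤ D' := (le_abs_self _).trans
          (Finset.single_le_sum (f := fun s => |D s|) (fun _ _ => abs_nonneg _) hs)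
        have h4 : f ((s :: w).prod * g i) = f (w.prod * g i) + leftDiff s f (w.prod * g i) := by
          rw [List.prod_cons, leftDiff, mul_assoc]
          ring
        rw [h4]
        refine (abs_add_le _ _).trans ?_
        have h5 : D s * R i ^ d ≤ D' * R i ^ d := mul_le_mul_of_nonneg_right h3 hRd
        rw [List.length_cons]
        push_cast
        linarith
    refine (key w hw hlen).trans ?_
    have h6 : (w.length : ℝ) * (D' * R i ^ d) ≤ C₀ * R i * (D' * R i ^ d) :=
      mul_le_mul_of_nonneg_right hlen (mul_nonneg hD'0 hRd)
    rw [pow_succ]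
    linarith

include hS hR in
theorem Tame.mul_left {g h : ι → π} (hg : Tame R g) (hh : LengthBounded S R h) :
    Tame R (fun i => h i * g i) := by
  intro d f hf
  obtain ⟨C₀, hC₀⟩ := hh
  obtain ⟨C, hC⟩ := hg.word_mul (S := S) hR C₀ d f hf
  refine ⟨C, fun i => ?_⟩
  obtain ⟨w, hw, hwh, hlen⟩ := exists_word hS (h i)
  have := hC i w hw (by rw [hlen]; exact hC₀ i)
  rwa [hwh] at this

include hR in
theorem tame_one : Tame R (fun _ => (1 : π)) := fun _ f _ =>
  ⟨|f 1|, fun i => le_mul_of_one_le_right (abs_nonneg _) (one_le_pow₀ (hR i))⟩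

include hS hR in
theorem LengthBounded.tame {h : ι → π} (hh : LengthBounded S R h) : Tame R h := by
  simpa using (tame_one hR).mul_left hS hR hh

include hS in
/-- A polynomial function of degree at most `d` grows at most like the `d`-th power of the word
length. -/
theorem IsPoly.le_wordLength_pow {d : ℕ} {f : π → ℝ} (hf : IsPoly d f) :
    ∃ C : ℝ, ∀ x, |f x| ≤ C * (max 1 (wordLength S x : ℝ)) ^ d := by
  have h : LengthBounded S (fun x : π => max 1 (wordLength S x : ℝ)) id :=
    ⟨1, fun x => by rw [one_mul]; exact le_max_right _ _⟩
  exact h.tame hS (fun _ => le_max_left _ _) d f hf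

/-! ### Distortion of the adapted series -/

theorem commutator_zpow_zpow {G : Type*} [Group G] {a b : G} (ha : Commute ⁅a, b⁆ a)
    (hb : Commute ⁅a, b⁆ b) (p q : ℤ) : ⁅a ^ p, b ^ q⁆ = ⁅a, b⁆ ^ (p * q) := by
  have h1 : ∀ {a b : G}, Commute ⁅a, b⁆ b → ∀ q : ℤ, ⁅a, b ^ q⁆ = ⁅a, b⁆ ^ q := by
    intro a b h q
    have h2 : a * b * a⁻¹ = ⁅a, b⁆ * b := by rw [commutatorElement_def]; group
    rw [commutatorElement_def a, ← conj_zpow, h2, h.mul_zpow, mul_inv_cancel_right]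
  have h3 : ⁅a ^ p, b⁆ = ⁅a, b⁆ ^ p := by
    have h4 : Commute ⁅b, a⁆ a := by
      rw [← commutatorElement_inv]
      exact ha.inv_left
    rw [← commutatorElement_inv, h1 h4, ← commutatorElement_inv a b, inv_zpow, inv_inv]
  rw [h1 _ q, h3, zpow_mul]
  rw [h3]
  exact hb.zpow_left p

variable (S R) in
/-- Bounded powers of `x` are represented, modulo the next term of the adapted series, by elements
of bounded length. -/
def PowersBounded (j : ℕ) (x : π) : Prop :=
  ∀ (n : ι → ℤ) (C : ℝ), (∀ i, |(n i : ℝ)| ≤ C * R i ^ (j + 1)) →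
    ∃ h : ι → π, LengthBounded S R h ∧ ∀ i,
      QuotientGroup.mk' (adaptedSeries π (j + 1)) (h i) =
        QuotientGroup.mk' (adaptedSeries π (j + 1)) x ^ n i

theorem commute_mk_of_mem {j k l : ℕ} (h : j ≤ k + l + 1) {x y : π} (hx : x ∈ adaptedSeries π k)
    (hy : y ∈ adaptedSeries π l) : Commute (QuotientGroup.mk' (adaptedSeries π j) x)
      (QuotientGroup.mk' (adaptedSeries π j) y) := by
  rw [← commutatorElement_eq_one_iff_commute, ← map_commutatorElement, ← MonoidHom.mem_ker,
    QuotientGroup.ker_mk']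
  exact adaptedSeries_antitone h (commutator_mem_adaptedSeries hx hy)

include hS in
theorem PowersBounded.mul {j : ℕ} {x y : π} (hx : x ∈ adaptedSeries π j)
    (hy : y ∈ adaptedSeries π j) (hxp : PowersBounded S R j x) (hyp : PowersBounded S R j y) :
    PowersBounded S R j (x * y) := by
  intro n C hn
  obtain ⟨h, hh, hhx⟩ := hxp n C hn
  obtain ⟨k, hk, hky⟩ := hyp n C hn
  refine ⟨_, hh.mul hS hk, fun i => ?_⟩
  rw [map_mul, map_mul, (commute_mk_of_mem (by omega) hx hy).mul_zpow, hhx, hky]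

include hS in
theorem PowersBounded.inv {j : ℕ} {x : π} (hxp : PowersBounded S R j x) :
    PowersBounded S R j x⁻¹ := by
  intro n C hn
  obtain ⟨h, hh, hhx⟩ := hxp n C hn
  refine ⟨_, hh.inv hS, fun i => ?_⟩
  rw [map_inv, map_inv, hhx, inv_zpow]

theorem powersBounded_one {j : ℕ} : PowersBounded S R j (1 : π) :=
  fun n C _ => ⟨_, lengthBounded_one, fun i => by simp⟩

include hS hR in
-- Divide `n = m p + r` with `m` of size `R`. Then `⁅y, s⁆ ^ n = ⁅y ^ p, s ^ m⁆ * ⁅y, s ^ r⁆` modulo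
-- the term after next. Here `p` is of size `R ^ (j + 1)`, so `y ^ p` can be replaced by an element
-- of length `O(R)`.
theorem PowersBounded.commutator {j : ℕ} {y : π} (hy : y ∈ adaptedSeries π j)
    (hyp : PowersBounded S R j y) (s : π) : PowersBounded S R (j + 1) ⁅y, s⁆ := by
  intro n C hn
  set m : ι → ℤ := fun i => ⌈R i⌉ with hm
  have hm1 : ∀ i, R i ≤ m i := fun i => Int.le_ceil _
  have hm2 : ∀ i, (m i : ℝ) ≤ 2 * R i := fun i => by
    have := (Int.ceil_lt_add_one (R i)).le
    have := hR i
    change ((⌈R i⌉ : ℤ) : ℝ) ≤ _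
    linarith
  have hm0 : ∀ i, 0 < m i := fun i => by
    have : (0 : ℝ) < m i := by linarith [hR i, hm1 i]
    exact_mod_cast this
  have hr0 : ∀ i, 0 ≤ n i % m i := fun i => Int.emod_nonneg _ (hm0 i).ne'
  have hrm : ∀ i, n i % m i < m i := fun i => Int.emod_lt_of_pos _ (hm0 i)
  have hdm : ∀ i, (m i : ℝ) * (n i / m i : ℤ) + (n i % m i : ℤ) = n i := fun i => by
    exact_mod_cast Int.mul_ediv_add_emod (n i) (m i)
  have hp : ∀ i, |((n i / m i : ℤ) : ℝ)| ≤ (C + 1) * R i ^ (j + 1) := fun i => by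
    have h0 : (0 : ℝ) ≤ (n i % m i : ℤ) := by exact_mod_cast hr0 i
    have h1 : ((n i % m i : ℤ) : ℝ) ≤ m i := by exact_mod_cast (hrm i).le
    have hR0 : 0 < R i := by linarith [hR i]
    have h2 : |(m i : ℝ) * (n i / m i : ℤ)| ≤ C * R i ^ (j + 1 + 1) + m i := by
      have := hn i
      rw [← hdm i] at this
      rw [abs_le] at this ⊢
      constructor <;> linarith
    have hmR : 0 < (m i : ℝ) := by linarith [hm1 i]
    rw [abs_mul, abs_of_pos hmR] at h2
    have hC : 0 ≤ C := by
      have := (abs_nonneg _).trans (hn i)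
      exact nonneg_of_mul_nonneg_left this (by positivity)
    have h3 : C * R i ^ (j + 1 + 1) ≤ m i * (C * R i ^ (j + 1)) := by
      rw [pow_succ]
      have := mul_le_mul_of_nonneg_right (hm1 i) (by positivity : 0 ≤ C * R i ^ (j + 1))
      linarith
    have h4 : (m i : ℝ) * |((n i / m i : ℤ) : ℝ)| ≤ m i * (C * R i ^ (j + 1) + 1) := by linarith
    have h5 := le_of_mul_le_mul_left h4 hmR
    have h6 : 1 ≤ R i ^ (j + 1) := one_le_pow₀ (hR i)
    linarith
  obtain ⟨h, hh, hhy⟩ := hyp _ _ hp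
  have hsm : LengthBounded S R (fun i => s ^ m i) := lengthBounded_zpow hS s (C := 2) fun i => by
    rw [abs_of_pos (by exact_mod_cast hm0 i)]
    exact hm2 i
  have hsr : LengthBounded S R (fun i => s ^ (n i % m i)) :=
    lengthBounded_zpow hS s (C := 2) fun i => by
      rw [abs_of_nonneg (by exact_mod_cast hr0 i)]
      have : ((n i % m i : ℤ) : ℝ) ≤ m i := by exact_mod_cast (hrm i).le
      linarith [hm2 i]
  refine ⟨_, (hh.commutator hS hsm).mul hS ((lengthBounded_const hR y).commutator hS hsr),
    fun i => ?_⟩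
  set q := QuotientGroup.mk' (adaptedSeries π (j + 1 + 1)) with hq
  have hs0 : s ∈ adaptedSeries π 0 := adaptedSeries_zero (π := π) ▸ Subgroup.mem_top s
  have hys : ⁅y, s⁆ ∈ adaptedSeries π (j + 1) := by
    simpa using commutator_mem_adaptedSeries hy hs0
  have hc1 : Commute ⁅q y, q s⁆ (q y) := by
    rw [← map_commutatorElement]
    exact commute_mk_of_mem (by omega) hys hy
  have hc2 : Commute ⁅q y, q s⁆ (q s) := by
    rw [← map_commutatorElement]
    exact commute_mk_of_mem (by omega) hys hs0
  -- The replacement `h i` is correct only up to `z`, which does not affect the commutator because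
  -- `z` is central modulo `adaptedSeries π (j + 1 + 1)`.
  obtain ⟨z, hz, hhz⟩ : ∃ z ∈ adaptedSeries π (j + 1), h i = y ^ (n i / m i) * z := by
    refine ⟨(y ^ (n i / m i))⁻¹ * h i, ?_, by group⟩
    rw [← QuotientGroup.eq]
    have := hhy i
    rw [← map_zpow] at this
    exact this.symm
  have hcz : ⁅q (h i), q s ^ m i⁆ = ⁅q y ^ (n i / m i), q s ^ m i⁆ := by
    have h1 : Commute (q z) (q s ^ m i) := by
      rw [← map_zpow]
      exact commute_mk_of_mem (l := 0) (by omega) hz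
        (adaptedSeries_zero (π := π) ▸ Subgroup.mem_top _)
    rw [hhz, map_mul, map_zpow, commutatorElement_mul_left_eq_conj_mul,
      commutatorElement_eq_one_iff_commute.2 h1]
    simp
  rw [map_mul, map_commutatorElement, map_commutatorElement, map_commutatorElement, map_zpow,
    map_zpow, hcz, commutator_zpow_zpow hc1 hc2]
  have h2 := commutator_zpow_zpow hc1 hc2 1 (n i % m i)
  rw [zpow_one, one_mul] at h2
  rw [h2, ← zpow_add]
  congr 1
  rw [mul_comm]
  exact Int.mul_ediv_add_emod _ _

include hS hR in
theorem powersBounded_of_mem_lowerCentralSeries (j : ℕ) :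
    ∀ x ∈ (⊤ : Subgroup π).lowerCentralSeries j, PowersBounded S R j x := by
  induction j with
  | zero =>
    intro x _ n C hn
    refine ⟨_, lengthBounded_zpow hS x (n := n) (C := C) (fun i => ?_), fun i => map_zpow _ _ _⟩
    simpa using hn i
  | succ j ih =>
    intro x hx
    rw [Subgroup.lowerCentralSeries_succ, Subgroup.commutator_def] at hx
    have hle : ∀ y ∈ Subgroup.closure {g | ∃ g₁ ∈ (⊤ : Subgroup π).lowerCentralSeries j,
        ∃ g₂ ∈ (⊤ : Subgroup π), ⁅g₁, g₂⁆ = g}, y ∈ adaptedSeries π (j + 1) := by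
      intro y hy
      rw [← Subgroup.commutator_def, ← Subgroup.lowerCentralSeries_succ] at hy
      exact le_adaptedSeries _ hy
    induction hx using Subgroup.closure_induction with
    | mem x hx =>
      obtain ⟨y, hy, s, -, rfl⟩ := hx
      exact (ih y hy).commutator hS hR (le_adaptedSeries _ hy) s
    | one => exact powersBounded_one
    | mul x y hx hy hxp hyp => exact hxp.mul hS (hle x hx) (hle y hy) hyp
    | inv x _ hxp => exact hxp.inv hS

include hS hR in
-- Some `x ^ k` lies in the lower central series. Division of the exponent by `k` leaves a remainder
-- that costs only a bounded word.
theorem powersBounded_of_mem {j : ℕ} {x : π} (hx : x ∈ adaptedSeries π j) :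
    PowersBounded S R j x := by
  obtain ⟨k, hk, hxk⟩ := hx
  intro n C hn
  obtain ⟨h, hh, hhx⟩ := powersBounded_of_mem_lowerCentralSeries hS hR j _ hxk
    (fun i => n i / (k : ℤ)) C fun i => by
      refine le_trans ?_ (hn i)
      exact_mod_cast Int.abs_ediv_le_abs (n i) k
  have hk0 : (0 : ℤ) < k := by exact_mod_cast hk
  have hr : LengthBounded S R (fun i => x ^ (n i % (k : ℤ))) :=
    lengthBounded_zpow hS x (C := k) fun i => by
      have h1 : ((n i % (k : ℤ) : ℤ) : ℝ) ≤ k := by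
        exact_mod_cast (Int.emod_lt_of_pos (n i) hk0).le
      rw [abs_of_nonneg (by exact_mod_cast Int.emod_nonneg (n i) hk0.ne')]
      exact h1.trans (le_mul_of_one_le_right (Nat.cast_nonneg _) (hR i))
  refine ⟨_, hh.mul hS hr, fun i => ?_⟩
  rw [map_mul, hhx, map_zpow, map_pow, ← zpow_natCast, ← zpow_mul, ← zpow_add,
    Int.mul_ediv_add_emod]

variable (B : AdaptedBasis π)

open AdaptedBasis in
include hS hR B in
-- Tameness bounds each coordinate by a multiple of `R ^ (j + 1)`, so a short `h` realizes it. Then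
-- `h⁻¹ * g` is again tame by `Tame.mul_left` and has one coordinate fewer; once none is left, it
-- lies in the next term.
theorem Tame.lengthBounded_of_forall_mem {j : ℕ}
    (hnext : ∀ g : ι → π, Tame R g → (∀ i, g i ∈ adaptedSeries π (j + 1)) → LengthBounded S R g)
    (g : ι → π) (hg : Tame R g) (hgj : ∀ i, g i ∈ adaptedSeries π j) : LengthBounded S R g := by
  have key : ∀ (s : Finset (Fin (B.rank j))) (g : ι → π), Tame R g →
      (∀ i, g i ∈ adaptedSeries π j) → (∀ l ∉ s, ∀ i, B.coord j (g i) l = 0) →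
      LengthBounded S R g := by
    intro s
    induction s using Finset.induction_on with
    | empty =>
      intro g hg hgj h0
      exact hnext g hg fun i =>
        (coord_eq_zero_iff (B := B) (hgj i)).1 (funext fun l => h0 l (by simp) i)
    | insert l s hl ih =>
      intro g hg hgj h0
      obtain ⟨C, hC⟩ := hg (j + 1) (B.coordFun j l) (B.isPoly_coordFun j l)
      obtain ⟨h, hh, hhx⟩ := powersBounded_of_mem hS hR (B.elt j l).2 (fun i => B.coord j (g i) l) C
        fun i => by rw [← coordFun_of_mem l (hgj i)]; exact hC i
      have hz : ∀ i, ∃ z ∈ adaptedSeries π (j + 1),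
          h i = (B.elt j l : π) ^ B.coord j (g i) l * z := fun i => by
        refine ⟨((B.elt j l : π) ^ B.coord j (g i) l)⁻¹ * h i, ?_, by group⟩
        rw [← QuotientGroup.eq]
        have := hhx i
        rw [← map_zpow] at this
        exact this.symm
      have hpow : ∀ i, (B.elt j l : π) ^ B.coord j (g i) l ∈ adaptedSeries π j := fun i =>
        zpow_mem (B.elt j l).2 _
      have hhj : ∀ i, h i ∈ adaptedSeries π j := fun i => by
        obtain ⟨z, hz, hhz⟩ := hz i
        rw [hhz]
        exact mul_mem (hpow i) (adaptedSeries_antitone (by omega) hz)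
      have hhc : ∀ i, B.coord j (h i) = B.coord j (g i) l • Pi.single l 1 := fun i => by
        obtain ⟨z, hz, hhz⟩ := hz i
        rw [hhz, coord_mul (hpow i) (adaptedSeries_antitone (by omega) hz), coord_eq_zero hz,
          add_zero, coord_zpow (B.elt j l).2, coord_elt]
      have h1 := ih (fun i => (h i)⁻¹ * g i) (hg.mul_left hS hR (hh.inv hS))
        (fun i => mul_mem (inv_mem (hhj i)) (hgj i)) fun m hm i => by
          rw [coord_mul (inv_mem (hhj i)) (hgj i), coord_inv (hhj i), hhc]
          by_cases hml : m = l
          · simp [hml]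
          · simp [hml, h0 m (by simp [hml, hm]) i]
      have h2 := hh.mul hS h1
      simpa using h2
  exact key Finset.univ g hg hgj (by simp)

include hS hR B in
theorem Tame.lengthBounded (htf : ∀ g : π, IsOfFinOrder g → g = 1) {g : ι → π} (hg : Tame R g) :
    LengthBounded S R g := by
  have key : ∀ n ≤ Group.nilpotencyClass π, ∀ g : ι → π, Tame R g →
      (∀ i, g i ∈ adaptedSeries π (Group.nilpotencyClass π - n)) → LengthBounded S R g := by
    intro n
    induction n with
    | zero =>
      intro _ g _ h
      have : g = fun _ => 1 := funext fun i => by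
        have := h i
        rwa [Nat.sub_zero, adaptedSeries_nilpotencyClass htf, Subgroup.mem_bot] at this
      rw [this]
      exact lengthBounded_one
    | succ n ih =>
      intro hn g hg hgj
      refine hg.lengthBounded_of_forall_mem hS hR B (fun g hg hgj => ?_) g hgj
      refine ih (by omega) g hg ?_
      rwa [show Group.nilpotencyClass π - n = Group.nilpotencyClass π - (n + 1) + 1 by omega]
  refine key _ le_rfl g hg fun i => ?_
  rw [Nat.sub_self, adaptedSeries_zero]
  exact Subgroup.mem_top _

end families


/-! ### Powers of complex matrices -/

section matrixPowers

open Filter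

variable {n : Type*} [Fintype n] [DecidableEq n]

theorem eventually_mul_pow_le (C : ℝ) {b b' : ℝ} (hb : 0 ≤ b) (hbb' : b < b') :
    ∀ᶠ k : ℕ in atTop, C * b ^ k ≤ b' ^ k := by
  have h1 := ((isLittleO_pow_pow_of_lt_left hb hbb').const_mul_left C).bound one_pos
  filter_upwards [h1] with k hk
  rw [one_mul, Real.norm_eq_abs, Real.norm_eq_abs, abs_of_nonneg (a := b' ^ k)
    (pow_nonneg (hb.trans hbb'.le) k)] at hk
  exact (le_abs_self _).trans hk

/-- Gelfand's formula gives the bound for large exponents; the constant `C` absorbs the finitely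
many others. -/
theorem exists_norm_pow_mulVec_le (A : Matrix n n ℂ) {b : ℝ}
    (h : spectralRadius ℂ A < ENNReal.ofReal b) :
    ∃ r C : ℝ, 0 ≤ r ∧ r < b ∧ 0 ≤ C ∧ ∀ (m : ℕ) (v : n → ℂ), ‖A ^ m *ᵥ v‖ ≤ C * r ^ m * ‖v‖ := by
  let _ : NormedRing (Matrix n n ℂ) := Matrix.linftyOpNormedRing
  let _ : NormedAlgebra ℂ (Matrix n n ℂ) := Matrix.linftyOpNormedAlgebra
  have : CompleteSpace (Matrix n n ℂ) := FiniteDimensional.complete ℂ _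
  obtain ⟨r, hr1, hr2⟩ := ENNReal.lt_iff_exists_nnreal_btwn.1 h
  have hr0 : 0 < r := by exact_mod_cast zero_le.trans_lt hr1
  have hrb : (r : ℝ) < b := by
    rw [← ENNReal.ofReal_coe_nnreal] at hr2
    exact (ENNReal.ofReal_lt_ofReal_iff_of_nonneg r.2).1 hr2
  have hlim := spectrum.pow_nnnorm_pow_one_div_tendsto_nhds_spectralRadius A
  obtain ⟨M, hM⟩ := eventually_atTop.1 ((hlim.eventually (gt_mem_nhds hr1)).and
    (eventually_ge_atTop 1))
  have hle : ∀ m ≥ M, ‖A ^ m‖ ≤ (r : ℝ) ^ m := by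
    intro m hm
    obtain ⟨h1, h2⟩ := hM m hm
    have h3 : (0 : ℝ) < m := by exact_mod_cast h2
    rw [one_div, ENNReal.rpow_inv_lt_iff h3, ENNReal.rpow_natCast] at h1
    exact_mod_cast h1.le
  set C := 1 + ∑ m ∈ Finset.range M, ‖A ^ m‖ / (r : ℝ) ^ m with hC
  have hpos : ∀ m, 0 < (r : ℝ) ^ m := fun m => pow_pos (by exact_mod_cast hr0) m
  have hnn : ∀ m ∈ Finset.range M, 0 ≤ ‖A ^ m‖ / (r : ℝ) ^ m := fun m _ =>
    div_nonneg (norm_nonneg _) (hpos m).le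
  have hC1 : 1 ≤ C := le_add_of_nonneg_right (Finset.sum_nonneg hnn)
  refine ⟨r, C, r.2, hrb, by linarith, fun m v => ?_⟩
  refine (Matrix.linfty_opNorm_mulVec _ _).trans (mul_le_mul_of_nonneg_right ?_ (norm_nonneg v))
  rcases le_or_gt M m with hm | hm
  · exact (hle m hm).trans (le_mul_of_one_le_left (hpos m).le hC1)
  · rw [← div_le_iff₀ (hpos m)]
    have := Finset.single_le_sum hnn (Finset.mem_range.2 hm)
    linarith

/-- For `z` in the spectrum of `A`, the number `‖z‖ ^ k` is at most a constant times `‖A ^ k‖`,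
which excludes `‖z‖ > q`. -/
theorem spectralRadius_le_of_norm_pow_le (A : Matrix n n ℂ) {q C : ℝ} (hq : 0 ≤ q)
    (h : ∀ᶠ k : ℕ in atTop, ∀ i l, ‖(A ^ k) i l‖ ≤ C * q ^ k) :
    spectralRadius ℂ A ≤ ENNReal.ofReal q := by
  let _ : NormedRing (Matrix n n ℂ) := Matrix.linftyOpNormedRing
  let _ : NormedAlgebra ℂ (Matrix n n ℂ) := Matrix.linftyOpNormedAlgebra
  have : CompleteSpace (Matrix n n ℂ) := FiniteDimensional.complete ℂ _
  refine iSup₂_le fun z hz => ?_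
  rw [← ENNReal.ofReal_coe_nnreal, coe_nnnorm]
  refine ENNReal.ofReal_le_ofReal (le_of_not_gt fun hlt => ?_)
  set K := (Fintype.card n * C) * ‖(1 : Matrix n n ℂ)‖ with hK
  obtain ⟨p, hqp, hpz⟩ := exists_between hlt
  have hp0 : 0 ≤ p := hq.trans hqp.le
  have hlt' : ∀ᶠ k : ℕ in atTop, p ^ k < ‖z‖ ^ k := by
    filter_upwards [eventually_ge_atTop 1] with k hk
    exact pow_lt_pow_left₀ hpz hp0 (by omega)
  obtain ⟨k, hk, hkp, hkz⟩ := (h.and ((eventually_mul_pow_le K hq hqp).and hlt')).exists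
  have h1 := spectrum.norm_le_norm_mul_of_mem (spectrum.pow_mem_pow A k hz)
  have h2 : ‖A ^ k‖ ≤ Fintype.card n * C * q ^ k := by
    rcases isEmpty_or_nonempty n with hn | ⟨⟨i₀⟩⟩
    · rw [Subsingleton.elim (A ^ k) 0, norm_zero]
      simp
    have hnn : 0 ≤ Fintype.card n * C * q ^ k := by
      have := (norm_nonneg _).trans (hk i₀ i₀)
      rw [mul_assoc]
      positivity
    rw [Matrix.linfty_opNorm_def, ← NNReal.coe_mk _ hnn, NNReal.coe_le_coe]
    refine Finset.sup_le fun i _ => ?_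
    rw [← NNReal.coe_le_coe, NNReal.coe_mk, NNReal.coe_sum]
    refine (Finset.sum_le_sum fun l _ => hk i l).trans ?_
    rw [Finset.sum_const, Finset.card_univ, nsmul_eq_mul, mul_assoc]
  rw [norm_pow] at h1
  have h3 := mul_le_mul_of_nonneg_right h2 (norm_nonneg (1 : Matrix n n ℂ))
  have h4 : Fintype.card n * C * q ^ k * ‖(1 : Matrix n n ℂ)‖ = K * q ^ k := by rw [hK]; ring
  linarith

theorem norm_le_of_succ_eq (A : Matrix n n ℂ) {b : ℝ}
    (h : spectralRadius ℂ A < ENNReal.ofReal b) (v e : ℕ → n → ℂ)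
    (hv : ∀ m, v (m + 1) = A *ᵥ v m + e m) {C' : ℝ} (he : ∀ m, ‖e m‖ ≤ C' * b ^ m) :
    ∃ C, ∀ m, ‖v m‖ ≤ C * b ^ m := by
  obtain ⟨r, C, hr, hrb, hC, hA⟩ := exists_norm_pow_mulVec_le A h
  have hC' : 0 ≤ C' := by simpa using (norm_nonneg _).trans (he 0)
  have hb : 0 ≤ b := hr.trans hrb.le
  have hbr : 0 < b - r := sub_pos.2 hrb
  set K := ‖v 0‖ + C' / (b - r) with hK
  -- This inequality is what closes the induction, and it explains the choice of `K`. All vectors `A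
  -- ^ t *ᵥ v m` are bounded together, so that the constant `C` is paid only once.
  have hK' : K * r + C' ≤ K * b := by
    have : C' = C' / (b - r) * (b - r) := by field_simp
    have h0 : 0 ≤ ‖v 0‖ * (b - r) := by positivity
    rw [hK]
    nlinarith
  have key : ∀ m t : ℕ, ‖A ^ t *ᵥ v m‖ ≤ C * r ^ t * (K * b ^ m) := by
    intro m
    induction m with
    | zero =>
      intro t
      refine (hA t _).trans ?_
      have : ‖v 0‖ ≤ K := le_add_of_nonneg_right (by positivity)
      rw [pow_zero, mul_one]
      gcongr
    | succ m ih =>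
      intro t
      rw [hv, Matrix.mulVec_add, Matrix.mulVec_mulVec, ← pow_succ]
      refine (norm_add_le _ _).trans ((add_le_add (ih (t + 1)) ((hA t _).trans
        (mul_le_mul_of_nonneg_left (he m) (by positivity)))).trans ?_)
      have h1 : C * r ^ (t + 1) * (K * b ^ m) + C * r ^ t * (C' * b ^ m) =
        C * r ^ t * b ^ m * (K * r + C') := by ring
      have h2 : C * r ^ t * (K * b ^ (m + 1)) = C * r ^ t * b ^ m * (K * b) := by ring
      rw [h1, h2]
      gcongr
  exact ⟨C * K, fun m => by simpa [mul_assoc] using key m 0⟩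

theorem map_intCast_pow (A : Matrix n n ℤ) (m : ℕ) :
    A.map (Int.cast : ℤ → ℂ) ^ m = (A ^ m).map (Int.cast : ℤ → ℂ) :=
  (map_pow (Int.castRingHom ℂ).mapMatrix A m).symm

/-- The powers of `A` tend to zero and have integer entries. -/
theorem exists_pow_eq_zero (A : Matrix n n ℤ)
    (h : spectralRadius ℂ (A.map (Int.cast : ℤ → ℂ)) < 1) : ∃ m, A ^ m = 0 := by
  rw [← ENNReal.ofReal_one] at h
  obtain ⟨r, C, hr, hr1, hC, hA⟩ := exists_norm_pow_mulVec_le _ h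
  obtain ⟨s, hrs, hs1⟩ := exists_between hr1
  obtain ⟨m, hm, hm1⟩ := ((eventually_mul_pow_le C hr hrs).and (eventually_ge_atTop 1)).exists
  refine ⟨m, Matrix.ext fun i l => ?_⟩
  have h1 := hA m (Pi.single l 1)
  have h2 : ‖(Pi.single l 1 : n → ℂ)‖ ≤ 1 := by
    refine (pi_norm_le_iff_of_nonneg zero_le_one).2 fun k => ?_
    by_cases hk : k = l
    · subst hk; simp
    · simp [hk]
  have h3 : s ^ m < 1 := pow_lt_one₀ (hr.trans hrs.le) hs1 (by omega)
  have h4 := (norm_le_pi_norm _ i).trans h1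
  rw [map_intCast_pow, Matrix.mulVec_single_one, Matrix.col_apply, Matrix.map_apply,
    Complex.norm_intCast] at h4
  have h5 : C * r ^ m * ‖(Pi.single l 1 : n → ℂ)‖ ≤ C * r ^ m :=
    mul_le_of_le_one_right (by positivity) h2
  have h6 : |(A ^ m) i l| < 1 := by
    have : |((A ^ m) i l : ℝ)| < 1 := by linarith
    exact_mod_cast this
  exact Int.abs_lt_one_iff.1 h6

theorem spectralRadius_ne_top (A : Matrix n n ℂ) : spectralRadius ℂ A ≠ ⊤ := by
  let _ : NormedRing (Matrix n n ℂ) := Matrix.linftyOpNormedRing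
  let _ : NormedAlgebra ℂ (Matrix n n ℂ) := Matrix.linftyOpNormedAlgebra
  have : CompleteSpace (Matrix n n ℂ) := FiniteDimensional.complete ℂ _
  cases subsingleton_or_nontrivial (Matrix n n ℂ)
  · rw [spectrum.SpectralRadius.of_subsingleton]
    exact ENNReal.zero_ne_top
  · obtain ⟨z, -, hz⟩ := spectrum.exists_nnnorm_eq_spectralRadius A
    rw [← hz]
    exact ENNReal.coe_ne_top

/-- An eigenvalue `z` of maximal modulus is an algebraic integer, hence so are `z * conj z = ‖z‖ ^
2` and its square root. -/
theorem isIntegral_spectralRadius (A : Matrix n n ℤ) :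
    IsIntegral ℤ (spectralRadius ℂ (A.map (Int.cast : ℤ → ℂ))).toReal := by
  let _ : NormedRing (Matrix n n ℂ) := Matrix.linftyOpNormedRing
  let _ : NormedAlgebra ℂ (Matrix n n ℂ) := Matrix.linftyOpNormedAlgebra
  have : CompleteSpace (Matrix n n ℂ) := FiniteDimensional.complete ℂ _
  cases subsingleton_or_nontrivial (Matrix n n ℂ)
  · rw [spectrum.SpectralRadius.of_subsingleton]
    exact isIntegral_zero
  · obtain ⟨z, hz, hzr⟩ := spectrum.exists_nnnorm_eq_spectralRadius (A.map (Int.cast : ℤ → ℂ))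
    rw [← hzr, ENNReal.coe_toReal, coe_nnnorm]
    have hzi : IsIntegral ℤ z := by
      refine ⟨A.charpoly, A.charpoly_monic, ?_⟩
      rw [Matrix.mem_spectrum_iff_isRoot_charpoly] at hz
      have h1 : (A.map (Int.cast : ℤ → ℂ)).charpoly = A.charpoly.map (Int.castRingHom ℂ) :=
        A.charpoly_map (Int.castRingHom ℂ)
      rw [h1, Polynomial.IsRoot, Polynomial.eval_map] at hz
      exact hz
    have hzc : IsIntegral ℤ (starRingEnd ℂ z) :=
      hzi.map (starRingEnd ℂ).toIntAlgHom
    have h2 := hzi.mul hzc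
    rw [Complex.mul_conj, Complex.normSq_eq_norm_sq] at h2
    have h3 : IsIntegral ℤ (‖z‖ ^ 2) :=
      (isIntegral_algebraMap_iff (A := ℝ) (B := ℂ) (algebraMap ℝ ℂ).injective).1 h2
    exact h3.of_pow two_pos

end matrixPowers

/-! ### Orbits of an endomorphism -/

section orbits

/-- The functions that grow along the family `g` at most like the `d`-th power of the scales
`R`. -/
def growthFiltration {ι X : Type*} (R : ι → ℝ) (g : ι → X) (d : ℕ) : Submodule ℝ (X → ℝ) where
  carrier := {f | ∃ C : ℝ, ∀ i, |f (g i)| ≤ C * R i ^ d}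
  zero_mem' := ⟨0, fun i => by simp⟩
  add_mem' := by
    rintro f f' ⟨C, hC⟩ ⟨C', hC'⟩
    refine ⟨C + C', fun i => ?_⟩
    rw [add_mul]
    exact (abs_add_le _ _).trans (add_le_add (hC i) (hC' i))
  smul_mem' := by
    rintro c f ⟨C, hC⟩
    refine ⟨|c| * C, fun i => ?_⟩
    rw [Pi.smul_apply, smul_eq_mul, abs_mul, mul_assoc]
    exact mul_le_mul_of_nonneg_left (hC i) (abs_nonneg c)

theorem isFiltration_growthFiltration {ι X : Type*} {R : ι → ℝ} (hR : ∀ i, 1 ≤ R i) (g : ι → X) :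
    IsFiltration (growthFiltration R g) where
  mono := by
    rintro a b hab f ⟨C, hC⟩
    refine ⟨|C|, fun i => (hC i).trans ?_⟩
    have : 0 ≤ R i ^ a := pow_nonneg (by linarith [hR i]) a
    exact mul_le_mul (le_abs_self C) (pow_le_pow_right₀ (hR i) hab) this (abs_nonneg C)
  one_mem := ⟨1, fun i => by simp⟩
  mul_mem := by
    rintro a b f f' ⟨C, hC⟩ ⟨C', hC'⟩
    refine ⟨C * C', fun i => ?_⟩
    rw [Pi.mul_apply, abs_mul, pow_add, mul_mul_mul_comm]
    exact mul_le_mul (hC i) (hC' i) (abs_nonneg _) ((abs_nonneg _).trans (hC i))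

variable {π : Type*} [Group π] [Group.IsNilpotent π] (B : AdaptedBasis π) (φ : π →* π)

/-- The spectral radius of the endomorphism of a successive quotient of the adapted series. -/
noncomputable def AdaptedBasis.radius (j : ℕ) : ℝ≥0∞ :=
  spectralRadius ℂ ((B.inducedMatrix φ j).map (Int.cast : ℤ → ℂ))

open AdaptedBasis in
-- By strong induction on `j`: the failure of the `j`-th coordinates to transform linearly under `φ`
-- is a polynomial in earlier coordinates of the same weighted degree, so it is an admissible error
-- in `norm_le_of_succ_eq`.
theorem coordFun_mem_growthFiltration {b : ℝ} (hb : 1 ≤ b) (γ : π) (c : ℕ)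
    (h : ∀ j < c, B.radius φ j < ENNReal.ofReal (b ^ (j + 1))) (j : ℕ) (hj : j < c)
    (i : Fin (B.rank j)) :
    B.coordFun j i ∈ growthFiltration (fun m : ℕ => b ^ m) (fun m => φ^[m] γ) (j + 1) := by
  induction j using Nat.strong_induction_on with
  | _ j ih =>
    set F := growthFiltration (fun m : ℕ => b ^ m) (fun m => φ^[m] γ) with hF
    have hFF : IsFiltration F := isFiltration_growthFiltration (fun m => one_le_pow₀ hb) _
    set A := B.inducedMatrix φ j with hA
    set e : Fin (B.rank j) → π → ℝ := fun i =>
      B.coordFun j i ∘ φ - ∑ l, (A i l : ℝ) • B.coordFun j l with he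
    -- The linear part cancels exactly the effect of left multiplication by `adaptedSeries π j`, so
    -- `e i` is invariant under it and only coordinates of smaller index enter.
    have hmem : ∀ i, e i ∈ F (j + 1) := by
      intro i
      refine IsPoly.mem_filtration B hFF j (fun k hk i => ih k hk (hk.trans hj) i) (j + 1) (e i) ?_
        fun x hx g => ?_
      · exact ((B.isPoly_coordFun j i).comp_hom φ).sub
          (PolyOn.sum _ _ fun l _ => (B.isPoly_coordFun j l).smul _)
      · have h1 : (B.coord j (φ x) i : ℝ) = ∑ l, (A i l : ℝ) * B.coord j x l := by
          rw [B.coord_map φ hx, Matrix.mulVec, dotProduct]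
          push_cast
          rfl
        simp only [he, Pi.sub_apply, Function.comp_apply, Finset.sum_apply, Pi.smul_apply,
          smul_eq_mul, map_mul, coordFun_mul _ hx, coordFun_mul _ (map_mem_adaptedSeries φ j hx),
          mul_add, Finset.sum_add_distrib, h1]
        ring
    choose C hC using hmem
    obtain ⟨K, hK⟩ := norm_le_of_succ_eq (A.map (Int.cast : ℤ → ℂ)) (h j hj)
      (fun m i => (B.coordFun j i (φ^[m] γ) : ℂ)) (fun m i => (e i (φ^[m] γ) : ℂ)) (fun m => by
        ext i
        simp only [he, Function.iterate_succ_apply', Pi.add_apply, Matrix.mulVec, dotProduct,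
          Matrix.map_apply, Pi.sub_apply, Function.comp_apply, Finset.sum_apply, Pi.smul_apply,
          smul_eq_mul]
        push_cast
        ring) (C' := ∑ i, |C i|) (fun m => by
        have hb0 : 0 ≤ (b ^ (j + 1)) ^ m := by positivity
        refine (pi_norm_le_iff_of_nonneg (by positivity)).2 fun i => ?_
        rw [Complex.norm_real, Real.norm_eq_abs]
        refine (hC i m).trans ?_
        rw [← pow_mul, mul_comm m, pow_mul]
        refine mul_le_mul_of_nonneg_right ((le_abs_self _).trans ?_) hb0
        exact Finset.single_le_sum (f := fun i => |C i|) (fun _ _ => abs_nonneg _)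
          (Finset.mem_univ i))
    refine ⟨K, fun m => ?_⟩
    have h2 := (norm_le_pi_norm _ i).trans (hK m)
    rw [Complex.norm_real, Real.norm_eq_abs, ← pow_mul, mul_comm (j + 1), pow_mul] at h2
    exact h2

variable {S : Finset π} (hS : Subgroup.closure (S : Set π) = ⊤)
  (htf : ∀ g : π, IsOfFinOrder g → g = 1)

include hS htf in
theorem exists_wordLength_iterate_le {b : ℝ} (hb : 1 ≤ b)
    (h : ∀ j < Group.nilpotencyClass π, B.radius φ j < ENNReal.ofReal (b ^ (j + 1))) (γ : π) :
    ∃ C : ℝ, ∀ m : ℕ, (wordLength S (φ^[m] γ) : ℝ) ≤ C * b ^ m := by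
  have hR : ∀ m : ℕ, 1 ≤ b ^ m := fun m => one_le_pow₀ hb
  refine Tame.lengthBounded hS hR B htf fun d f hf => ?_
  exact IsPoly.mem_filtration_of_torsionFree B htf (isFiltration_growthFiltration hR _)
    (fun j hj i => coordFun_mem_growthFiltration B φ hb γ _ h j hj i) hf

theorem iterate_mem_adaptedSeries {j : ℕ} {x : π} (hx : x ∈ adaptedSeries π j) (m : ℕ) :
    φ^[m] x ∈ adaptedSeries π j := by
  induction m with
  | zero => exact hx
  | succ m ih =>
    rw [Function.iterate_succ_apply']
    exact map_mem_adaptedSeries φ j ih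

theorem coord_iterate {j : ℕ} {x : π} (hx : x ∈ adaptedSeries π j) (m : ℕ) :
    B.coord j (φ^[m] x) = B.inducedMatrix φ j ^ m *ᵥ B.coord j x := by
  induction m with
  | zero => simp
  | succ m ih =>
    rw [Function.iterate_succ_apply', B.coord_map φ (iterate_mem_adaptedSeries φ hx m), ih,
      Matrix.mulVec_mulVec, ← pow_succ']

include htf in
-- On each quotient `φ` is nilpotent, so the orbit descends through the whole adapted series to the
-- identity.
theorem exists_forall_iterate_eq_one
    (h : ∀ j < Group.nilpotencyClass π, B.radius φ j < 1) (γ : π) :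
    ∃ M, ∀ m ≥ M, φ^[m] γ = 1 := by
  have key : ∀ j ≤ Group.nilpotencyClass π, ∃ M, φ^[M] γ ∈ adaptedSeries π j := by
    intro j
    induction j with
    | zero => exact fun _ => ⟨0, adaptedSeries_zero (π := π) ▸ Subgroup.mem_top _⟩
    | succ j ih =>
      intro hj
      obtain ⟨M, hM⟩ := ih (by omega)
      obtain ⟨m, hm⟩ := exists_pow_eq_zero _ (h j hj)
      refine ⟨m + M, ?_⟩
      rw [Function.iterate_add_apply,
        ← AdaptedBasis.coord_eq_zero_iff (B := B) (iterate_mem_adaptedSeries φ hM m),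
        coord_iterate B φ hM, hm, Matrix.zero_mulVec]
  obtain ⟨M, hM⟩ := key _ le_rfl
  rw [adaptedSeries_nilpotencyClass htf, Subgroup.mem_bot] at hM
  refine ⟨M, fun m hm => ?_⟩
  rw [← Nat.sub_add_cancel hm, Function.iterate_add_apply, hM]
  exact iterate_map_one φ _

/-! ### The growth rate -/

open Filter

include hS htf in
theorem growthRate_le : growthRate S φ ≤
    ⨆ j : Fin (Group.nilpotencyClass π), B.radius φ j ^ (1 / ((j : ℕ) + 1 : ℝ)) := by
  set ρ := ⨆ j : Fin (Group.nilpotencyClass π), B.radius φ j ^ (1 / ((j : ℕ) + 1 : ℝ)) with hρ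
  have hlt : ∀ (b : ℝ≥0∞), ρ < b → ∀ j < Group.nilpotencyClass π, B.radius φ j < b ^ (j + 1) := by
    intro b hb j hj
    have h1 : B.radius φ j ^ (1 / ((j : ℕ) + 1 : ℝ)) < b :=
      (le_iSup (fun j : Fin (Group.nilpotencyClass π) =>
        B.radius φ j ^ (1 / ((j : ℕ) + 1 : ℝ))) ⟨j, hj⟩).trans_lt hb
    rw [one_div, ENNReal.rpow_inv_lt_iff (by positivity)] at h1
    exact_mod_cast h1
  refine iSup_le fun γ => ?_
  -- The estimate by scales `b ^ m` needs `b ≥ 1`, so it says nothing below `1`; there the orbits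
  -- become trivial and the rate is zero.
  rcases lt_or_ge ρ 1 with h1 | h1
  · obtain ⟨M, hM⟩ := exists_forall_iterate_eq_one B φ htf
      (fun j hj => by simpa using hlt 1 h1 j hj) γ
    refine limsup_le_of_le (h := ?_)
    filter_upwards [eventually_ge_atTop M, eventually_ge_atTop 1] with k hk hk1
    have : (0 : ℝ) < k := by exact_mod_cast hk1
    rw [hM k hk, wordLength_one, Nat.cast_zero, ENNReal.zero_rpow_of_pos (by positivity)]
    exact zero_le
  · refine le_of_forall_gt_imp_ge_of_dense fun b' hb' => ?_
    obtain ⟨b, hb, hbb'⟩ := ENNReal.lt_iff_exists_nnreal_btwn.1 hb'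
    -- The gap between `b` and `q` absorbs the constant: `C * b ^ k ≤ q ^ k` eventually.
    obtain ⟨q, hbq, hqb'⟩ := ENNReal.lt_iff_exists_nnreal_btwn.1 hbb'
    obtain ⟨C, hC⟩ := exists_wordLength_iterate_le B φ hS htf (b := b)
      (by exact_mod_cast (h1.trans hb.le)) (fun j hj => by
        rw [ENNReal.ofReal_pow (NNReal.coe_nonneg b), ENNReal.ofReal_coe_nnreal]
        exact hlt b hb j hj) γ
    refine limsup_le_of_le (h := ?_)
    filter_upwards [eventually_mul_pow_le C b.2 (NNReal.coe_lt_coe.2 (ENNReal.coe_lt_coe.1 hbq)),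
      eventually_ge_atTop 1] with k hk hk1
    have hk0 : (0 : ℝ) < k := by exact_mod_cast hk1
    refine le_trans ?_ hqb'.le
    rw [one_div, ENNReal.rpow_inv_le_iff hk0, ENNReal.rpow_natCast]
    have := (hC k).trans hk
    exact_mod_cast this

include hS in
-- The columns of the `k`-th power of the induced matrix are the coordinates of the `k`-th iterates
-- of the basis lifts. A coordinate has degree `j + 1`, so it is bounded by the `(j + 1)`-st power
-- of word length.
theorem radius_le_growthRate (j : ℕ) :
    B.radius φ j ^ (1 / ((j : ℕ) + 1 : ℝ)) ≤ growthRate S φ := by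
  refine le_of_forall_gt_imp_ge_of_dense fun q' hq' => ?_
  obtain ⟨q, hq, hqq'⟩ := ENNReal.lt_iff_exists_nnreal_btwn.1 hq'
  refine le_trans ?_ hqq'.le
  have hj : ((j : ℝ) + 1) = ((j + 1 : ℕ) : ℝ) := by push_cast; rfl
  rw [one_div, ENNReal.rpow_inv_le_iff (by positivity), hj, ENNReal.rpow_natCast,
    ← ENNReal.ofReal_coe_nnreal, ← ENNReal.ofReal_pow (NNReal.coe_nonneg q)]
  choose C hC using fun i => (B.isPoly_coordFun j i).le_wordLength_pow (d := j + 1) hS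
  have hC0 : ∀ i, 0 ≤ C i := fun i => by
    have := (abs_nonneg _).trans (hC i 1)
    exact nonneg_of_mul_nonneg_left this (by positivity)
  refine spectralRadius_le_of_norm_pow_le _ (C := ∑ i, C i) (pow_nonneg q.2 _) ?_
  have hlen : ∀ᶠ k : ℕ in atTop, ∀ l, (wordLength S (φ^[k] (B.elt j l : π)) : ℝ) ≤ (q : ℝ) ^ k := by
    refine eventually_all.2 fun l => ?_
    have h1 := eventually_lt_of_limsup_lt ((le_iSup (fun γ : π => limsup
      (fun k : ℕ => (wordLength S (φ^[k] γ) : ℝ≥0∞) ^ (1 / (k : ℝ))) atTop)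
        (B.elt j l : π)).trans_lt hq)
    filter_upwards [h1, eventually_ge_atTop 1] with k hk hk1
    have hk0 : (0 : ℝ) < k := by exact_mod_cast hk1
    rw [one_div, ENNReal.rpow_inv_lt_iff hk0, ENNReal.rpow_natCast] at hk
    exact_mod_cast hk.le
  filter_upwards [hlen] with k hk i l
  have hmem := iterate_mem_adaptedSeries φ (B.elt j l).2 k
  have hentry : (B.inducedMatrix φ j ^ k) i l = B.coord j (φ^[k] (B.elt j l : π)) i := by
    rw [coord_iterate B φ (B.elt j l).2, AdaptedBasis.coord_elt, Matrix.mulVec_single_one,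
      Matrix.col_apply]
  have hqk : 0 ≤ ((q : ℝ) ^ (j + 1)) ^ k := pow_nonneg (pow_nonneg q.2 _) _
  have hsum : C i ≤ ∑ i, C i := Finset.single_le_sum (fun i _ => hC0 i) (Finset.mem_univ i)
  rw [map_intCast_pow, Matrix.map_apply, Complex.norm_intCast, hentry,
    ← AdaptedBasis.coordFun_of_mem i hmem]
  refine le_trans ?_ (mul_le_mul_of_nonneg_right hsum hqk)
  -- The polynomial bound involves `max 1` of the length, which is useless when `q < 1` and the
  -- iterate is the identity; in that case the coordinate is itself zero.
  rcases Nat.eq_zero_or_pos (wordLength S (φ^[k] (B.elt j l : π))) with h0 | h0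
  · rw [AdaptedBasis.coordFun_of_mem i hmem, eq_one_of_wordLength_eq_zero hS h0,
      AdaptedBasis.coord_one]
    simpa using mul_nonneg (hC0 i) hqk
  · refine (hC i _).trans (mul_le_mul_of_nonneg_left ?_ (hC0 i))
    rw [max_eq_right (by exact_mod_cast h0), ← pow_mul, mul_comm (j + 1), pow_mul]
    exact pow_le_pow_left₀ (Nat.cast_nonneg _) (hk l) _

include hS htf in
theorem growthRate_eq : growthRate S φ =
    ⨆ j : Fin (Group.nilpotencyClass π), B.radius φ j ^ (1 / ((j : ℕ) + 1 : ℝ)) :=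
  le_antisymm (growthRate_le B φ hS htf) (iSup_le fun j => radius_le_growthRate B φ hS j)

include hS htf B in
theorem growthRate_ne_top_and_isIntegral :
    growthRate S φ ≠ ⊤ ∧ IsIntegral ℤ (growthRate S φ).toReal := by
  rw [growthRate_eq B φ hS htf]
  rcases isEmpty_or_nonempty (Fin (Group.nilpotencyClass π)) with h | h
  · rw [iSup_of_empty]
    exact ⟨ENNReal.zero_ne_top, by simpa using isIntegral_zero⟩
  -- The supremum is attained, and its `(j + 1)`-st power is the spectral radius of an integer
  -- matrix.
  · obtain ⟨j, hj⟩ := exists_eq_ciSup_of_finite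
      (f := fun j : Fin (Group.nilpotencyClass π) => B.radius φ j ^ (1 / ((j : ℕ) + 1 : ℝ)))
    rw [← hj]
    have hj0 : ((j : ℕ) : ℝ) + 1 = ((j + 1 : ℕ) : ℝ) := by push_cast; rfl
    refine ⟨ENNReal.rpow_ne_top_of_nonneg (by positivity) (spectralRadius_ne_top _), ?_⟩
    refine IsIntegral.of_pow (n := (j : ℕ) + 1) (Nat.succ_pos _) ?_
    rw [← ENNReal.toReal_pow, ← ENNReal.rpow_natCast, ← ENNReal.rpow_mul, hj0, one_div,
      inv_mul_cancel₀ (by positivity), ENNReal.rpow_one]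
    exact isIntegral_spectralRadius _

end orbits

end MalcevGrowth

theorem theorem3 {π : Type*} [Group π] [Group.FG π] [Group.IsNilpotent π]
    (htf : ∀ g : π, IsOfFinOrder g → g = 1) (φ : π →* π) :
    ∃ (r : Fin (Group.nilpotencyClass π) → ℕ)
      (e : ∀ j : Fin (Group.nilpotencyClass π),
        AdaptedQuotient π j ≃* Multiplicative (Fin (r j) → ℤ))
      (a : ∀ j : Fin (Group.nilpotencyClass π), Fin (r j) → adaptedSeries π j)
      (D : ∀ j : Fin (Group.nilpotencyClass π), Matrix (Fin (r j)) (Fin (r j)) ℤ)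
      (b : Module.Basis (Σ j : Fin (Group.nilpotencyClass π), Fin (r j)) ℝ (malcevLieAlgebra π)),
      (∀ j i, e j (QuotientGroup.mk (a j i)) = Multiplicative.ofAdd (Pi.single i 1)) ∧
      (∀ j x, (e j (adaptedQuotientMap φ j x)).toAdd = D j *ᵥ (e j x).toAdd) ∧
      (∀ j i, malcevExp (b ⟨j, i⟩) = toMalcev π (a j i)) ∧
      (∀ j k i l, j < k →
        LinearMap.toMatrix b b (linearization φ : malcevLieAlgebra π →ₗ[ℝ] malcevLieAlgebra π)
          ⟨j, i⟩ ⟨k, l⟩ = 0) ∧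
      (∀ j i l,
        LinearMap.toMatrix b b (linearization φ : malcevLieAlgebra π →ₗ[ℝ] malcevLieAlgebra π)
          ⟨j, i⟩ ⟨j, l⟩ = (D j i l : ℝ)) ∧
      ∀ S : Finset π, Subgroup.closure (S : Set π) = ⊤ →
        growthRate S φ =
          ⨆ j : Fin (Group.nilpotencyClass π),
            spectralRadius ℂ ((D j).map (Int.cast : ℤ → ℂ)) ^ (1 / ((j : ℕ) + 1 : ℝ)) ∧
        growthRate S φ ≠ ⊤ ∧
        IsIntegral ℤ (growthRate S φ).toReal := by
  obtain ⟨B⟩ := nonempty_adaptedBasis π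
  choose X hX using fun p : B.Index => exists_malcevExp_eq (B.elt p.1 p.2 : π)
  obtain ⟨b, hb⟩ := B.exists_basis_log hX htf
  have hexp : ∀ p, malcevExp (b p) = toMalcev π (B.elt p.1 p.2) := fun p => by rw [hb, hX]
  exact ⟨fun j => B.rank j, fun j => B.equiv j, fun j => B.elt j, fun j => B.inducedMatrix φ j, b,
    fun j i => B.equiv_elt j i, fun j x => B.equiv_adaptedQuotientMap φ j x,
    fun j i => hexp ⟨j, i⟩,
    fun j k i l hjk => (B.toMatrix_linearization φ b hexp ⟨k, l⟩).1 ⟨j, i⟩ hjk,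
    fun j i l => (B.toMatrix_linearization φ b hexp ⟨j, l⟩).2 i,
    fun S hS => ⟨growthRate_eq B φ hS htf, growthRate_ne_top_and_isIntegral B φ hS htf⟩⟩
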